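/- Let $k$ be an algebraically closed field, $G$ a finite group whose order is invertible in $k$, and $V$ a finite-dimensional $k$-linear representation of $G$ (not necessarily faithful). Let $S=k[V]=\mathrm{Sym}(V^*)$ be the polynomial ring on $V$, graded with the linear forms $V^*$ as homogeneous generators of one and the same degree, and with the induced action of $G$; let $S^G$ be the graded ring of invariants. Let $\mathfrak p$ be a closed point of $\mathrm{Proj}\,S$, that is, a homogeneous prime ideal which is maximal among the homogeneous prime ideals not containing the irrelevant ideal; its zero set in $V$ is a line $\ell=kv$ with $v\neq 0$. Put $\mathfrak q=\mathfrak p\cap S^G$, and let $G_{\mathfrak p}=\{g\in G: gv=v\}$ be the subgroup of elements that fix $\ell$ pointwise. Let $(S^G)_{(\mathfrak q)}$ be the homogeneous localisation of $S^G$ at $\mathfrak q$, i.e. the graded ring obtained from $S^G$ by inverting all homogeneous elements (of any degree) that do not lie in $\mathfrak q$. Then $(S^G)_{(\mathfrak q)}$ is a regular ring (Noetherian, with all its localisations at prime ideals regular local rings) if and only if $G_{\mathfrak p}$ acts on $V$ as a reflection group, i.e. the image of $G_{\mathfrak p}$ in $\mathrm{GL}(V)$ is generated by (pseudo)reflections: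 elements of finite order whose fixed subspace has codimension one. (The trivial group counts as a reflection group.) -/

import Mathlib

noncomputable section

namespace GradedInvariants

open scoped DirectSum

/-! ### Homogeneous localisation of a graded ring -/

section HomogeneousLocalisation

variable {k B : Type*} [CommRing k] [CommRing B] [Algebra k B]

/-- The multiplicative set of all homogeneous elements (of any degree) outside a prime `q`. -/
def homogeneousPrimeCompl (ℬ : ℕ → Submodule k B) [SetLike.GradedMonoid ℬ]
    (q : Ideal B) [q.IsPrime] : Submonoid B :=
  SetLike.homogeneousSubmonoid ℬ ⊓ q.primeCompl

/-- The homogeneous localisation of a graded ring at a prime `q`: the (graded) ring obtained by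
inverting all homogeneous elements outside `q`. It is the whole graded ring, not only its part of
degree zero. -/
abbrev GradedLocalisation (ℬ : ℕ → Submodule k B) [SetLike.GradedMonoid ℬ]
    (q : Ideal B) [q.IsPrime] : Type _ :=
  Localization (homogeneousPrimeCompl ℬ q)

end HomogeneousLocalisation

/-! ### The graded polynomial ring `k[V]` -/

section PolynomialRing

variable (k V : Type*) [Field k] [AddCommGroup V] [Module k V]

/-- `k[V]`, the free commutative `k`-algebra on the dual space of `V`. -/
abbrev PolyRing : Type _ := SymmetricAlgebra k (Module.Dual k V)

/-- The grading of `k[V]` by polynomial degree: the degree `n` part is spanned by the products of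
`n` linear forms. -/
def polyGrading (n : ℕ) : Submodule k (PolyRing k V) :=
  LinearMap.range (SymmetricAlgebra.ι k (Module.Dual k V)) ^ n

instance polyGrading_gradedMonoid : SetLike.GradedMonoid (polyGrading k V) :=
  Submodule.nat_power_gradedMonoid (LinearMap.range (SymmetricAlgebra.ι k (Module.Dual k V)))

/-- A linear form, placed in degree one of the direct sum of the graded parts of `k[V]`. -/
def gradedι : Module.Dual k V →ₗ[k] ⨁ i : ℕ, polyGrading k V i :=
  DirectSum.lof k ℕ (fun i => polyGrading k V i) 1 ∘ₗ
    (SymmetricAlgebra.ι k (Module.Dual k V)).codRestrict _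
      fun m => by simpa only [polyGrading, pow_one] using LinearMap.mem_range_self _ m

theorem gradedι_apply (m : Module.Dual k V) :
    gradedι k V m = DirectSum.of (fun i : ℕ => polyGrading k V i) 1
      ⟨SymmetricAlgebra.ι k (Module.Dual k V) m,
        by simpa only [polyGrading, pow_one] using LinearMap.mem_range_self _ m⟩ :=
  rfl

instance polyGrading_gradedAlgebra : GradedAlgebra (polyGrading k V) :=
  GradedAlgebra.ofAlgHom _ (SymmetricAlgebra.lift (gradedι k V))
    (by
      ext m
      change DirectSum.coeAlgHom (polyGrading k V) (SymmetricAlgebra.lift (gradedι k V)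
        (SymmetricAlgebra.ι k (Module.Dual k V) m)) = SymmetricAlgebra.ι k (Module.Dual k V) m
      rw [SymmetricAlgebra.lift_ι_apply, gradedι_apply, DirectSum.coeAlgHom_of, Subtype.coe_mk])
    fun i x => by
    obtain ⟨x, hx⟩ := x
    dsimp only [Subtype.coe_mk, DirectSum.lof_eq_of]
    induction hx using Submodule.pow_induction_on_left' with
    | algebraMap r =>
      rw [AlgHom.commutes, DirectSum.algebraMap_apply]; rfl
    | add x y i hx hy ihx ihy =>
      rw [map_add, ihx, ihy, ← map_add]
      rfl
    | mem_mul m hm i x hx ih =>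
      obtain ⟨_, rfl⟩ := hm
      rw [map_mul, ih, SymmetricAlgebra.lift_ι_apply, gradedι_apply, DirectSum.of_mul_of]
      exact DirectSum.of_eq_of_gradedMonoid_eq (Sigma.subtype_ext (add_comm _ _) rfl)

variable {k V}

/-- Evaluation of polynomials at a vector `v` of `V`. -/
def evalAt (v : V) : PolyRing k V →ₐ[k] k :=
  SymmetricAlgebra.lift (Module.Dual.eval k V v)

/-- The common zeros in `V` of the elements of an ideal of `k[V]`. If `k` is algebraically closed
and `I` is a closed point of `Proj k[V]`, then this is the line of `V` that corresponds to it. -/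
def zeroSet (I : Ideal (PolyRing k V)) : Set V :=
  {v | ∀ f ∈ I, evalAt v f = 0}

end PolynomialRing

/-! ### Group actions -/

section Action

variable {k G V : Type*} [Field k] [Group G] [AddCommGroup V] [Module k V]
variable (ρ : Representation k G V)

/-- The action of `g` on `k[V]` by algebra automorphisms, induced by the dual representation:
`(g f)(v) = f (g⁻¹ v)`. -/
def polyAct (g : G) : PolyRing k V →ₐ[k] PolyRing k V :=
  SymmetricAlgebra.lift (SymmetricAlgebra.ι k (Module.Dual k V) ∘ₗ ρ.dual g)

/-- The invariant ring `k[V]^G`. -/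
def invariantRing : Subalgebra k (PolyRing k V) :=
  ⨅ g : G, AlgHom.equalizer (polyAct ρ g) (AlgHom.id k (PolyRing k V))

/-- The grading that `k[V]^G` inherits from `k[V]`. -/
def invariantGrading (n : ℕ) : Submodule k (invariantRing ρ) :=
  (polyGrading k V n).comap (invariantRing ρ).val.toLinearMap

instance invariantGrading_gradedMonoid : SetLike.GradedMonoid (invariantGrading ρ) where
  one_mem := (SetLike.GradedOne.one_mem : (1 : PolyRing k V) ∈ polyGrading k V 0)
  mul_mem _ _ _ _ hx hy :=
    (SetLike.mul_mem_graded (A := polyGrading k V) hx hy :)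

/-- The contraction `I ∩ k[V]^G` of an ideal `I` of `k[V]`. -/
abbrev contraction (I : Ideal (PolyRing k V)) : Ideal (invariantRing ρ) :=
  I.comap (invariantRing ρ).val

/-- The subgroup of all `g` that fix every vector of the zero set of `I`. For a closed point of
`Proj k[V]` these are the `g` that fix a vector spanning the corresponding line. -/
def pointwiseStabiliser (I : Ideal (PolyRing k V)) : Subgroup G where
  carrier := {g | ∀ v ∈ zeroSet I, ρ g v = v}
  one_mem' := fun v _ => by simp
  mul_mem' := fun {a b} ha hb v hv => by
    rw [map_mul, Module.End.mul_apply, hb v hv, ha v hv]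
  inv_mem' := fun {a} ha v hv => by
    calc ρ a⁻¹ v = ρ a⁻¹ (ρ a v) := by rw [ha v hv]
      _ = v := by simp

/-- A (pseudo)reflection: an automorphism of finite order whose fixed space has codimension one. -/
def IsReflection (s : LinearMap.GeneralLinearGroup k V) : Prop :=
  IsOfFinOrder s ∧ Module.finrank k (LinearMap.range ((s : V →ₗ[k] V) - 1)) = 1

/-- `H` acts on `V` as a reflection group: the image of `H` in `GL(V)` is generated by the
reflections that it contains. The action need not be faithful. -/
def ActsAsReflectionGroup (H : Subgroup G) : Prop :=
  Subgroup.closure {s | s ∈ H.map ρ.toHomUnits ∧ IsReflection s} = H.map ρ.toHomUnits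

end Action

end GradedInvariants

end

/-! Write `S = k[V]`, let `v` span the line of the closed point, let `H` be the stabiliser of `v`,
and let `W` be the subgroup of `H` generated by its elements that act on `V` as a reflection or as
the identity. The group `H` acts as a reflection group if and only if `W = H`
(`actsAsReflectionGroup_iff`).

Two facts link the three rings `S^G ⊆ S^H ⊆ S^W`. The first is Chevalley's theorem
(`exists_generators_fixedSubalgebra_closure`): `S^W` is a polynomial ring on homogeneous
generators. Its core is Chevalley's lemma on relations between invariants
(`mem_invariantIdeal_of_sum_eq_zero`). In characteristic zero it gives the algebraic independence of
minimal generators by differentiating a relation and applying Euler's identity. In characteristic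
`p`, where derivatives may vanish, it says that minimal generators are Lech independent; flatness of
Frobenius carries this over to all their powers (`LechIndependent.pow`), and this forces algebraic
independence (`algebraicIndependent_of_lechIndependent`). The second fact is that, for a subgroup
`K` of a group `Γ`, the extension `S^Γ ⊆ S^K` is étale at the points where some `b ∈ S^K` is
separated from its other conjugates. It is made explicit by Lagrange interpolation: with `F` the
polynomial whose roots are the conjugates of `b`, multiplication by `F'(b)` sends `S^K` into
`S^Γ[b]` (`exists_lagrange`). So wherever `F'(b)` is a unit, maximal ideals extend to maximal ideals
(`exists_mul_mem_map_under`) and regularity descends (`isRegularLocalRing_under`).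

If `W = H`, then `S^H` is a polynomial ring, hence regular. A prime of the homogeneous localisation
comes from a prime `P` of `S^G` whose homogeneous elements vanish at `v`. There is a homogeneous `b`
in `S^H` that is separated at `v` from its other conjugates (`exists_homogeneous_separating`); the
product of the differences `b - g b` is homogeneous, so it lies outside a suitable prime of `S`
above `P` (`exists_map_notMem`), and the extension is étale there. Hence `S^G` is regular at `P`.

If the homogeneous localisation is regular, then so is `S^G` at `v`; its maximal ideal there is
generated by at most as many elements as `S^W` has generators, by comparing Krull dimensions.
Étaleness at `v` transports these generators to `S^H`, and the translation by `v`, which commutes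
with `H`, moves them to the origin. By the graded Nakayama lemma `S^H` is then generated by at most
as many homogeneous elements as `S^W`. If `W ≠ H`, the elements of `H` outside `W` fix only
subspaces of codimension at least two. Outside these subspaces `S^H ⊆ S^W` is étale, so the Jacobian
determinant of the generators of `S^H` with respect to those of `S^W` has no zeros there; restricted
to a general plane it has at most an isolated zero, hence none. So the Jacobian is invertible at the
origin, which gives `S^H = S^W`, and this contradicts the separation of orbits
(`reflectionSubgroup_eq_of_generators`). -/

namespace GradedInvariants

open Polynomial IsLocalRing

/-! ### Heights of primes in integral extensions -/

section Height

variable {R B : Type*} [CommRing R] [CommRing B] [Algebra R B] [Algebra.IsIntegral R B]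

theorem height_le_height_under (Q : Ideal B) [Q.IsPrime] : Q.height ≤ (Q.under R).height := by
  have h := Order.height_le_height_apply_of_strictMono
    (PrimeSpectrum.comap (algebraMap R B)) (fun I J hIJ => by
      have : I.asIdeal < J.asIdeal := hIJ
      exact Ideal.IsIntegral.comap_lt_comap (R := R) this) ⟨Q, inferInstance⟩
  rw [← PrimeSpectrum.height_eq_orderHeight, ← PrimeSpectrum.height_eq_orderHeight] at h
  exact h

/-- Chains of primes lift along an injective integral extension, by going up. -/
theorem exists_under_eq_height_le (hinj : Function.Injective (algebraMap R B)) (n : ℕ) :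
    ∀ (P : Ideal R) [P.IsPrime], (n : ℕ∞) ≤ P.height →
      ∃ Q : Ideal B, Q.IsPrime ∧ Q.under R = P ∧ (n : ℕ∞) ≤ Q.height := by
  induction n with
  | zero =>
    intro P _ _
    obtain ⟨Q, -, hQ, hQP⟩ := Ideal.exists_ideal_over_prime_of_isIntegral (S := B) P ⊥
      (by
        intro x hx
        have : algebraMap R B x = 0 := by simpa using hx
        rw [(map_eq_zero_iff _ hinj).mp this]; exact P.zero_mem)
    exact ⟨Q, hQ, hQP, by simp⟩
  | succ n ih =>
    intro P _ hP
    have h1 : ((n + 1 : ℕ) : ℕ∞) ≤ Order.height (⟨P, inferInstance⟩ : PrimeSpectrum R) := by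
      rwa [← PrimeSpectrum.height_eq_orderHeight]
    obtain ⟨s, hs, hlen⟩ := Order.exists_series_of_le_height _ h1
    have hlt : s ⟨n, by omega⟩ < (⟨P, inferInstance⟩ : PrimeSpectrum R) := by
      rw [← hs]
      refine s.strictMono ?_
      simp [Fin.lt_def, hlen]
    have hn : (n : ℕ∞) ≤ (s ⟨n, by omega⟩).asIdeal.height := by
      rw [PrimeSpectrum.height_eq_orderHeight]
      simpa using Order.index_le_height s ⟨n, by omega⟩
    obtain ⟨Q', hQ', hQ'P, hht⟩ := ih (s ⟨n, by omega⟩).asIdeal hn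
    have hle : Q'.comap (algebraMap R B) ≤ P := by
      have : Q'.comap (algebraMap R B) = _ := hQ'P
      rw [this]; exact hlt.le
    obtain ⟨Q, hQQ, hQ, hQP⟩ := Ideal.exists_ideal_over_prime_of_isIntegral (S := B) P Q' hle
    refine ⟨Q, hQ, hQP, ?_⟩
    have hlt' : Q' < Q := by
      refine lt_of_le_of_ne hQQ ?_
      rintro rfl
      have e : (s ⟨n, by omega⟩).asIdeal = P := hQ'P.symm.trans hQP
      exact hlt.ne (PrimeSpectrum.ext e)
    calc ((n + 1 : ℕ) : ℕ∞) = n + 1 := by push_cast; rfl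
      _ ≤ Q'.height + 1 := by gcongr
      _ ≤ Q.height := Ideal.height_add_one_le_of_lt_of_isPrime hlt'

theorem height_le_of_ringKrullDim_le (hinj : Function.Injective (algebraMap R B))
    (P : Ideal R) [P.IsPrime] {d : ℕ} (hd : ringKrullDim B ≤ d) : P.height ≤ d := by
  by_contra h
  have h' : ((d + 1 : ℕ) : ℕ∞) ≤ P.height := by
    push_cast
    exact Order.add_one_le_of_lt (not_le.mp h)
  obtain ⟨Q, hQ, -, hh⟩ := exists_under_eq_height_le hinj (d + 1) P h'
  have h3 : (Q.height : WithBot ℕ∞) ≤ d := Ideal.height_le_ringKrullDim_of_isPrime.trans hd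
  have h4 : Q.height ≤ d := by exact_mod_cast h3
  have h5 : ((d + 1 : ℕ) : ℕ∞) ≤ d := hh.trans h4
  have : d + 1 ≤ d := by exact_mod_cast h5
  omega

end Height

/-! ### Generically étale extensions -/

section Etale

variable {R B : Type*} [CommRing R] [CommRing B] [Algebra R B]
  {b : B} {F : R[X]} {Λ : B →ₗ[R] R[X]}

/-- Away from the zeros of `F'(b)`, contraction of extended ideals is the identity: the
coefficients of `Λ` are `R`-linear forms on `B`, and one of them is prime to `Q` on `t`. -/
theorem exists_mul_mem_of_mul_mem_map
    (hΛ : ∀ c, aeval b (Λ c) = aeval b (derivative F) * c)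
    (Q : Ideal B) [Q.IsPrime] (hQ : aeval b (derivative F) ∉ Q) {J : Ideal R} {x : R} {t : B}
    (ht : t ∉ Q) (hx : algebraMap R B x * t ∈ J.map (algebraMap R B)) :
    ∃ r, r ∉ Q.under R ∧ r * x ∈ J := by
  have key : ∀ i, ∀ c ∈ J.map (algebraMap R B), (Λ c).coeff i ∈ J := by
    intro i c hc
    refine Submodule.span_induction (p := fun c _ => ∀ a : B, (Λ (a * c)).coeff i ∈ J)
      ?_ ?_ ?_ ?_ hc 1 |> fun h => by simpa using h
    · rintro _ ⟨y, hy, rfl⟩ a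
      rw [mul_comm, ← Algebra.smul_def, map_smul, coeff_smul, smul_eq_mul]
      exact J.mul_mem_right _ hy
    · intro a; simp
    · intro y z _ _ hy hz a
      rw [mul_add, map_add, coeff_add]
      exact J.add_mem (hy a) (hz a)
    · intro c y _ hy a
      rw [smul_eq_mul, ← mul_assoc]
      exact hy _
  by_cases h : ∀ i, (Λ t).coeff i ∈ Q.under R
  · exfalso
    have : aeval b (Λ t) ∈ Q := by
      rw [aeval_eq_sum_range]
      refine Q.sum_mem fun i _ => ?_
      rw [Algebra.smul_def]
      exact Q.mul_mem_right _ (h i)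
    rw [hΛ] at this
    exact (Ideal.IsPrime.mem_or_mem ‹_› this).elim hQ ht
  · push Not at h
    obtain ⟨i, hi⟩ := h
    refine ⟨_, hi, ?_⟩
    have := key i _ hx
    rwa [← Algebra.smul_def, map_smul, coeff_smul, smul_eq_mul, mul_comm] at this

/-- Where `F'(b)` does not vanish, `B` is unramified over `R`, formulated over fields `κ → K` with
the properties of the residue fields at `P` and `Q`. -/
theorem exists_mul_mem_map_of_residue {κ K : Type*} [Field κ] [Field K] [Algebra R κ] [Algebra κ K]
    [Algebra B K] [Algebra R K] [IsScalarTower R κ K] [IsScalarTower R B K]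
    {P : Ideal R} {Q : Ideal B} [Q.IsPrime]
    (hPκ : ∀ x, algebraMap R κ x = 0 ↔ x ∈ P) (hQK : ∀ x, algebraMap B K x = 0 ↔ x ∈ Q)
    (hfrac : ∀ s : Finset κ, ∃ d : R, algebraMap R κ d ≠ 0 ∧
      ∀ a ∈ s, ∃ r, algebraMap R κ r = algebraMap R κ d * a)
    (hF : aeval b F = 0) (hΛ : ∀ c, aeval b (Λ c) = aeval b (derivative F) * c)
    (hQ : aeval b (derivative F) ∉ Q) {x : B} (hx : x ∈ Q) :
    ∃ s, s ∉ Q ∧ s * x ∈ P.map (algebraMap R B) := by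
  classical
  obtain ⟨β, hβ⟩ : ∃ β : K, β = algebraMap B K b := ⟨_, rfl⟩
  have hev : ∀ f : R[X], aeval β (f.map (algebraMap R κ)) = algebraMap B K (aeval b f) := by
    intro f
    rw [aeval_map_algebraMap, hβ, aeval_algebraMap_apply]
  have h0 : ∀ f : R[X], aeval b f ∈ Q → minpoly κ β ∣ f.map (algebraMap R κ) := by
    intro f hf
    apply minpoly.dvd
    rw [hev, hQK]
    exact hf
  obtain ⟨h, hh⟩ := h0 F (by rw [hF]; exact Q.zero_mem)
  obtain ⟨m, hm⟩ := h0 (Λ x) (by rw [hΛ]; exact Q.mul_mem_left _ hx)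
  -- `β` is a simple root of `F`, so the cofactor of its minimal polynomial does not vanish there.
  have hhβ : aeval β h ≠ 0 := by
    intro h0
    apply hQ
    rw [← hQK, ← hev, ← derivative_map, hh, derivative_mul, map_add, map_mul, map_mul, h0,
      minpoly.aeval, mul_zero, zero_mul, add_zero]
  -- Clear the denominators of `h` and `m`.
  obtain ⟨d, hd0, hd⟩ := hfrac (h.coeffs ∪ m.coeffs)
  have lift : ∀ f : κ[X], f.coeffs ⊆ h.coeffs ∪ m.coeffs →
      ∃ g : R[X], g.map (algebraMap R κ) = C (algebraMap R κ d) * f := by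
    intro f hf
    have : C (algebraMap R κ d) * f ∈ lifts (algebraMap R κ) := by
      rw [lifts_iff_coeff_lifts]
      intro n
      rw [coeff_C_mul]
      by_cases hn : f.coeff n = 0
      · exact ⟨0, by simp [hn]⟩
      · exact hd _ (hf (coeff_mem_coeffs hn))
    exact (mem_lifts _).mp this
  obtain ⟨h1, hh1⟩ := lift h Finset.subset_union_left
  obtain ⟨m1, hm1⟩ := lift m Finset.subset_union_right
  have hz : (h1 * Λ x - F * m1).map (algebraMap R κ) = 0 := by
    rw [Polynomial.map_sub, Polynomial.map_mul, Polynomial.map_mul, hh1, hm1, hh, hm]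
    ring
  have hcoef : ∀ i, (h1 * Λ x - F * m1).coeff i ∈ P := by
    intro i
    rw [← hPκ, ← coeff_map, hz, coeff_zero]
  refine ⟨aeval b h1 * aeval b (derivative F), ?_, ?_⟩
  · intro hmem
    refine (Ideal.IsPrime.mem_or_mem ‹_› hmem).elim (fun h2 => ?_) hQ
    rw [← hQK, ← hev, hh1, map_mul, aeval_C, mul_eq_zero] at h2
    refine h2.elim (fun h3 => hd0 ?_) hhβ
    exact (map_eq_zero_iff _ (algebraMap κ K).injective).mp h3
  · have : aeval b (h1 * Λ x - F * m1) = aeval b h1 * aeval b (derivative F) * x := by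
      rw [map_sub, map_mul, map_mul, hF, hΛ]; ring
    rw [← this, aeval_eq_sum_range]
    refine Ideal.sum_mem _ fun i _ => ?_
    rw [Algebra.smul_def]
    exact Ideal.mul_mem_right _ _ (Ideal.mem_map_of_mem _ (hcoef i))

/-- Where `F'(b)` does not vanish, `B` is unramified over `R`. -/
theorem exists_mul_mem_map_under
    (hF : aeval b F = 0) (hΛ : ∀ c, aeval b (Λ c) = aeval b (derivative F) * c)
    (Q : Ideal B) [Q.IsPrime] (hQ : aeval b (derivative F) ∉ Q) {x : B} (hx : x ∈ Q) :
    ∃ s, s ∉ Q ∧ s * x ∈ (Q.under R).map (algebraMap R B) := by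
  have hc : Q.under R = Q.comap (algebraMap R B) := rfl
  let _ : Algebra (Q.under R).ResidueField Q.ResidueField :=
    (Ideal.ResidueField.map (Q.under R) Q (algebraMap R B) hc).toAlgebra
  have : IsScalarTower R (Q.under R).ResidueField Q.ResidueField :=
    IsScalarTower.of_algebraMap_eq fun r => by
      rw [RingHom.algebraMap_toAlgebra, Ideal.ResidueField.map_algebraMap,
        IsScalarTower.algebraMap_apply R B]
  refine exists_mul_mem_map_of_residue (κ := (Q.under R).ResidueField) (K := Q.ResidueField)
    (fun _ => Ideal.algebraMap_residueField_eq_zero)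
    (fun _ => Ideal.algebraMap_residueField_eq_zero) (fun s => ?_) hF hΛ hQ hx
  obtain ⟨d, hd⟩ := IsLocalization.exist_integer_multiples_of_finset
    (nonZeroDivisors (R ⧸ Q.under R)) s
  obtain ⟨d0, hd0⟩ := Ideal.Quotient.mk_surjective (I := Q.under R) (d : R ⧸ Q.under R)
  refine ⟨d0, ?_, fun a ha => ?_⟩
  · rw [Ne, Ideal.algebraMap_residueField_eq_zero, ← Ideal.Quotient.eq_zero_iff_mem, hd0]
    exact nonZeroDivisors.ne_zero d.2
  · obtain ⟨c, hc⟩ := hd a ha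
    obtain ⟨c0, rfl⟩ := Ideal.Quotient.mk_surjective c
    refine ⟨c0, ?_⟩
    rw [Ideal.algebraMap_quotient_residueField_mk] at hc
    rw [hc, ← hd0, Algebra.smul_def, Ideal.algebraMap_quotient_residueField_mk]

end Etale
end GradedInvariants

namespace GradedInvariants

open Polynomial IsLocalRing

/-! ### Regularity along generically étale extensions -/

section Regular

/-- Minimal generators of the maximal ideal can be chosen inside any generating set. -/
theorem exists_fin_span_eq_maximalIdeal {A : Type*} [CommRing A] [IsLocalRing A]
    [IsNoetherianRing A] {s : Set A} (h0 : (0 : A) ∈ s) (hs : Ideal.span s = maximalIdeal A)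
    {n : ℕ} (hn : (maximalIdeal A).spanFinrank ≤ n) :
    ∃ a : Fin n → A, (∀ i, a i ∈ s) ∧ Ideal.span (Set.range a) = maximalIdeal A := by
  have hsub : s ⊆ maximalIdeal A := hs ▸ Ideal.subset_span
  set s' : Set (maximalIdeal A) := Subtype.val ⁻¹' s
  have hval : Subtype.val '' s' = s := by
    rw [show Subtype.val '' s' = (maximalIdeal A : Set A) ∩ s from
      Subtype.image_preimage_coe _ _, Set.inter_eq_right.mpr hsub]
  have hlift : ∀ t : Set (maximalIdeal A), Submodule.span A t = ⊤ ↔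
      Ideal.span (Subtype.val '' t) = maximalIdeal A := by
    intro t
    rw [← (Submodule.map_injective_of_injective
      (Submodule.injective_subtype (maximalIdeal A))).eq_iff, Submodule.map_span,
      Submodule.map_top, Submodule.range_subtype]
    rfl
  have hs' : Submodule.span A s' = ⊤ := by rw [hlift, hval, hs]
  rw [← CotangentSpace.span_image_eq_top_iff] at hs'
  obtain ⟨b, hb, hbs, hli⟩ := exists_linearIndependent (ResidueField A)
    ((maximalIdeal A).toCotangent '' s')
  obtain ⟨t, ht, hbij⟩ := Set.SurjOn.exists_bijOn_subset
    (f := (maximalIdeal A).toCotangent) (s := s') (t := b) (fun x hx => hb hx)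
  have hbfin : b.Finite := hli.setFinite
  have hcard : b.ncard ≤ n := by
    refine le_trans ?_ hn
    rw [spanFinrank_maximalIdeal_eq_finrank_cotangentSpace]
    have : Fintype b := hbfin.fintype
    rw [Set.ncard_eq_toFinset_card']
    simpa using hli.fintype_card_le_finrank
  have htfin : t.Finite := hbij.finite_iff_finite.mpr hbfin
  have htcard : t.ncard ≤ n := by
    rw [← hbij.injOn.ncard_image, hbij.image_eq]; exact hcard
  have htspan : Ideal.span (Subtype.val '' t) = maximalIdeal A := by
    rw [← hlift, ← CotangentSpace.span_image_eq_top_iff, hbij.image_eq, hbs, hs']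
  classical
  have hF : (Subtype.val '' t).Finite := htfin.image _
  have hFc : hF.toFinset.card ≤ n := by
    rw [← Set.ncard_eq_toFinset_card _ hF]
    exact (Set.ncard_image_le htfin).trans htcard
  let e := hF.toFinset.equivFin
  refine ⟨fun i => if h : (i : ℕ) < hF.toFinset.card then (e.symm ⟨i, h⟩ : A) else 0, ?_, ?_⟩
  · intro i
    dsimp only
    split_ifs with h
    · have := (e.symm ⟨i, h⟩).2
      rw [Set.Finite.mem_toFinset] at this
      obtain ⟨x, hx, hxe⟩ := this
      rw [← hxe]; exact ht hx
    · exact h0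
  · apply le_antisymm
    · rw [Ideal.span_le]
      rintro _ ⟨i, rfl⟩
      dsimp only
      split_ifs with h
      · have := (e.symm ⟨i, h⟩).2
        rw [Set.Finite.mem_toFinset] at this
        obtain ⟨x, hx, hxe⟩ := this
        rw [← hxe]; exact x.2
      · exact zero_mem _
    · refine htspan.symm.le.trans (Ideal.span_mono ?_)
      intro x hx
      have hx' : x ∈ hF.toFinset := by simpa using hx
      refine ⟨⟨e ⟨x, hx'⟩, (e ⟨x, hx'⟩).2.trans_le hFc⟩, ?_⟩
      simp

theorem mem_map_localization_iff {R : Type*} [CommRing R] (P : Ideal R) [P.IsPrime]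
    (J : Ideal R) (x : R) : algebraMap R (Localization.AtPrime P) x ∈
      J.map (algebraMap R (Localization.AtPrime P)) ↔ ∃ s, s ∉ P ∧ s * x ∈ J := by
  rw [IsLocalization.algebraMap_mem_map_algebraMap_iff P.primeCompl]
  rfl

/-- The maximal ideal of a regular local ring `R_P` is generated by `ht P` elements of `P`. -/
theorem exists_fin_generators_of_isRegularLocalRing {R : Type*} [CommRing R] (P : Ideal R)
    [P.IsPrime] [IsRegularLocalRing (Localization.AtPrime P)] {n : ℕ} (hn : P.height ≤ n) :
    ∃ a : Fin n → R, (∀ i, a i ∈ P) ∧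
      ∀ x ∈ P, ∃ s, s ∉ P ∧ s * x ∈ Ideal.span (Set.range a) := by
  have hreg := (isRegularLocalRing_iff (Localization.AtPrime P)).mp inferInstance
  rw [IsLocalization.AtPrime.ringKrullDim_eq_height P] at hreg
  have hr : (maximalIdeal (Localization.AtPrime P)).spanFinrank ≤ n := by
    have : (((maximalIdeal (Localization.AtPrime P)).spanFinrank : ℕ∞) : WithBot ℕ∞) ≤
        ((n : ℕ∞) : WithBot ℕ∞) := by
      rw [show (((maximalIdeal (Localization.AtPrime P)).spanFinrank : ℕ∞) : WithBot ℕ∞) =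
        P.height from hreg]
      exact WithBot.coe_le_coe.mpr hn
    exact_mod_cast this
  obtain ⟨c, hc, hspan⟩ := exists_fin_span_eq_maximalIdeal
    (s := algebraMap R (Localization.AtPrime P) '' P) ⟨0, P.zero_mem, map_zero _⟩
    (Localization.AtPrime.map_eq_maximalIdeal (I := P)) hr
  choose a ha hac using hc
  refine ⟨a, ha, fun x hx => ?_⟩
  rw [← mem_map_localization_iff, Ideal.map_span, ← Set.range_comp]
  have : (algebraMap R (Localization.AtPrime P)) ∘ a = c := funext hac
  rw [this, hspan, ← Localization.AtPrime.map_eq_maximalIdeal]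
  exact Ideal.mem_map_of_mem _ hx

/-- Regularity descends along an integral extension that is étale in the sense of
`exists_mul_mem_of_mul_mem_map` and `exists_mul_mem_map_under` at `Q`. -/
theorem isRegularLocalRing_under {R B : Type*} [CommRing R] [CommRing B] [Algebra R B]
    [IsNoetherianRing R] [Algebra.IsIntegral R B] {b : B} {F : R[X]} {Λ : B →ₗ[R] R[X]}
    (hF : aeval b F = 0) (hΛ : ∀ c, aeval b (Λ c) = aeval b (derivative F) * c)
    (Q : Ideal B) [Q.IsPrime] (hQ : aeval b (derivative F) ∉ Q)
    [IsRegularLocalRing (Localization.AtPrime Q)] :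
    IsRegularLocalRing (Localization.AtPrime (Q.under R)) := by
  set f := algebraMap B (Localization.AtPrime Q)
  have hreg := (isRegularLocalRing_iff (Localization.AtPrime Q)).mp inferInstance
  rw [IsLocalization.AtPrime.ringKrullDim_eq_height Q] at hreg
  have hs : Ideal.span ((f.comp (algebraMap R B)) '' (Q.under R)) =
      maximalIdeal (Localization.AtPrime Q) := by
    rw [← Localization.AtPrime.map_eq_maximalIdeal (I := Q)]
    apply le_antisymm
    · rw [Ideal.span_le]
      rintro _ ⟨r, hr, rfl⟩
      exact Ideal.mem_map_of_mem _ hr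
    · rw [Ideal.map_le_iff_le_comap]
      intro x hx
      have := (mem_map_localization_iff Q _ x).mpr (exists_mul_mem_map_under hF hΛ Q hQ hx)
      rwa [Ideal.map_map] at this
  obtain ⟨c, hc, hspan⟩ := exists_fin_span_eq_maximalIdeal
    (s := (f.comp (algebraMap R B)) '' (Q.under R))
    ⟨0, zero_mem _, map_zero _⟩ hs le_rfl
  choose a ha hac using hc
  have hmax : Ideal.span (Set.range (algebraMap R (Localization.AtPrime (Q.under R)) ∘ a)) =
      maximalIdeal (Localization.AtPrime (Q.under R)) := by
    rw [Set.range_comp, ← Ideal.map_span]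
    refine Eq.trans ?_ (Localization.AtPrime.map_eq_maximalIdeal (I := Q.under R))
    apply le_antisymm
    · apply Ideal.map_mono
      rw [Ideal.span_le]
      rintro _ ⟨i, rfl⟩
      exact ha i
    · rw [Ideal.map_le_iff_le_comap]
      intro x hx
      rw [Ideal.mem_comap, mem_map_localization_iff]
      have h1 : f (algebraMap R B x) ∈
          ((Ideal.span (Set.range a)).map (algebraMap R B)).map f := by
        rw [Ideal.map_map, Ideal.map_span, ← Set.range_comp]
        have : (f.comp (algebraMap R B)) ∘ a = c := funext hac
        rw [this, hspan, ← hs]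
        exact Ideal.subset_span ⟨x, hx, rfl⟩
      obtain ⟨t, ht, htx⟩ := (mem_map_localization_iff Q _ _).mp h1
      rw [mul_comm] at htx
      exact exists_mul_mem_of_mul_mem_map hΛ Q hQ ht htx
  apply IsRegularLocalRing.of_spanFinrank_maximalIdeal_le
  rw [IsLocalization.AtPrime.ringKrullDim_eq_height (Q.under R)]
  calc ((maximalIdeal (Localization.AtPrime (Q.under R))).spanFinrank : WithBot ℕ∞)
      ≤ ((maximalIdeal (Localization.AtPrime Q)).spanFinrank : WithBot ℕ∞) := by
        have : (maximalIdeal (Localization.AtPrime (Q.under R))).spanFinrank ≤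
            (maximalIdeal (Localization.AtPrime Q)).spanFinrank := by
          conv_lhs => rw [← hmax]
          refine (Submodule.spanFinrank_span_le_ncard_of_finite (Set.finite_range _)).trans ?_
          rw [← Set.image_univ]
          refine (Set.ncard_image_le Set.finite_univ).trans ?_
          simp [Set.ncard_univ]
        exact_mod_cast this
    _ = Q.height := hreg
    _ ≤ (Q.under R).height := WithBot.coe_le_coe.mpr (height_le_height_under Q)

end Regular
end GradedInvariants

namespace GradedInvariants

open Polynomial

/-! ### Lagrange interpolation over cosets -/

section Lagrange

variable {k S Γ : Type*} [CommRing k] [CommRing S] [Algebra k S] [Group Γ]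
  (φ : Γ →* (S →ₐ[k] S)) (K : Subgroup Γ)

/-- The subalgebra of elements fixed by a subgroup `K`. -/
def fixedSubalgebra : Subalgebra k S where
  carrier := {x | ∀ g ∈ K, φ g x = x}
  mul_mem' hx hy g hg := by rw [map_mul, hx g hg, hy g hg]
  add_mem' hx hy g hg := by rw [map_add, hx g hg, hy g hg]
  algebraMap_mem' r g _ := AlgHom.commutes _ r

variable {φ K}

theorem mem_fixedSubalgebra {x : S} : x ∈ fixedSubalgebra φ K ↔ ∀ g ∈ K, φ g x = x := Iff.rfl

theorem map_mul_apply' (g h : Γ) (x : S) : φ (g * h) x = φ g (φ h x) := by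
  rw [map_mul]; rfl

theorem map_out_apply {c : S} (hc : c ∈ fixedSubalgebra φ K) (g : Γ) (q : Γ ⧸ K) :
    φ g (φ q.out c) = φ (g • q).out c := by
  have hmem : (g • q).out⁻¹ * (g * q.out) ∈ K := by
    rw [← QuotientGroup.eq, QuotientGroup.out_eq']
    conv_lhs => rw [← QuotientGroup.out_eq' q]
    rfl
  conv_rhs => rw [← hc _ hmem]
  rw [← map_mul_apply', ← map_mul_apply', mul_inv_cancel_left]

theorem map_out_one {c : S} (hc : c ∈ fixedSubalgebra φ K) :
    φ ((1 : Γ) : Γ ⧸ K).out c = c := by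
  apply hc
  have := QuotientGroup.mk_out_eq_mul K 1
  obtain ⟨h, hh⟩ := this
  rw [hh, one_mul]
  exact h.2

variable [Fintype (Γ ⧸ K)] [DecidableEq (Γ ⧸ K)]

/-- The Lagrange interpolation polynomial: it takes the value `(g c) · ∏_{g' ≠ g} (g b - g' b)`
at each conjugate `g b`. -/
noncomputable def lagrange (φ : Γ →* (S →ₐ[k] S)) (K : Subgroup Γ)
    [Fintype (Γ ⧸ K)] [DecidableEq (Γ ⧸ K)] (b c : S) : S[X] :=
  ∑ q : Γ ⧸ K, C (φ q.out c) * ∏ q' ∈ Finset.univ.erase q, (X - C (φ q'.out b))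

theorem lagrange_map {b c : S} (hb : b ∈ fixedSubalgebra φ K) (hc : c ∈ fixedSubalgebra φ K)
    (g : Γ) : (lagrange φ K b c).map (φ g : S →+* S) = lagrange φ K b c := by
  rw [lagrange, Polynomial.map_sum]
  simp only [Polynomial.map_mul, Polynomial.map_prod, Polynomial.map_sub, map_X, map_C]
  refine Fintype.sum_equiv (MulAction.toPerm g) _ _ fun q => ?_
  simp only [RingHom.coe_coe, map_out_apply hb, map_out_apply hc, MulAction.toPerm_apply]
  congr 1
  refine Finset.prod_equiv (MulAction.toPerm g) (fun q' => ?_) (fun q' _ => rfl)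
  simp

theorem lagrange_eval {b c : S} (hb : b ∈ fixedSubalgebra φ K) (hc : c ∈ fixedSubalgebra φ K) :
    (lagrange φ K b c).eval b =
      (∏ q' ∈ Finset.univ.erase ((1 : Γ) : Γ ⧸ K), (b - φ q'.out b)) * c := by
  rw [lagrange, eval_finsetSum, Finset.sum_eq_single ((1 : Γ) : Γ ⧸ K)]
  · rw [eval_mul, eval_C, map_out_one hc, eval_prod, mul_comm]
    simp
  · intro q _ hq
    rw [eval_mul, eval_prod, Finset.prod_eq_zero (i := ((1 : Γ) : Γ ⧸ K)), mul_zero]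
    · simpa using hq.symm
    · rw [map_out_one hb]; simp
  · simp

theorem lagrange_add (b c c' : S) :
    lagrange φ K b (c + c') = lagrange φ K b c + lagrange φ K b c' := by
  simp only [lagrange, map_add, add_mul, Finset.sum_add_distrib]

theorem lagrange_mul (b c r : S) (hr : ∀ g, φ g r = r) :
    lagrange φ K b (r * c) = C r * lagrange φ K b c := by
  simp only [lagrange, map_mul, hr, Finset.mul_sum, mul_assoc]

theorem derivative_prod_conjugates (b : S) :
    derivative (∏ q : Γ ⧸ K, (X - C (φ q.out b))) = lagrange φ K b 1 := by
  rw [derivative_prod_finset, lagrange]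
  refine Finset.sum_congr rfl fun q _ => ?_
  simp

end Lagrange

/-- Let `R` and `B` be the invariants of `Γ` and of `K`, and let `b ∈ B`. The polynomial `F` is the
product of the `X - g b` over the cosets of `K`, and `Λ c` is the Lagrange interpolation polynomial
of `c`, so that `F'(b) c` lies in `R[b]` for every `c` in `B`. Hence `B` is étale over `R` wherever
`F'(b)` is a unit, that is, wherever `b` is separated from its other conjugates. -/
theorem exists_lagrange {k S Γ : Type*} [CommRing k] [CommRing S] [Algebra k S] [Group Γ]
    {φ : Γ →* (S →ₐ[k] S)} {K : Subgroup Γ} [Finite (Γ ⧸ K)]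
    {R B : Type*} [CommRing R] [CommRing B] [Algebra R B] [Algebra R S]
    [Algebra B S] [IsScalarTower R B S]
    (hR : ∀ x : S, x ∈ (algebraMap R S).range ↔ ∀ g, φ g x = x)
    (hB : ∀ x : S, x ∈ (algebraMap B S).range ↔ ∀ g ∈ K, φ g x = x)
    (hiR : Function.Injective (algebraMap R S)) (hiB : Function.Injective (algebraMap B S))
    (b : B) : ∃ (F : R[X]) (Λ : B →ₗ[R] R[X]), aeval b F = 0 ∧
      (∀ c, aeval b (Λ c) = aeval b (derivative F) * c) ∧
      (∀ Q : Ideal S, Q.IsPrime →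
        (∀ g, g ∉ K → algebraMap B S b - φ g (algebraMap B S b) ∉ Q) →
        algebraMap B S (aeval b (derivative F)) ∉ Q) := by
  classical
  have := Fintype.ofFinite (Γ ⧸ K)
  have hB' : ∀ c : B, algebraMap B S c ∈ fixedSubalgebra φ K := fun c =>
    (hB _).mp ⟨c, rfl⟩
  have hlift : ∀ p : S[X], (∀ g, p.map (φ g : S →+* S) = p) →
      ∃ p' : R[X], p'.map (algebraMap R S) = p := by
    intro p hp
    have : p ∈ lifts (algebraMap R S) := by
      rw [lifts_iff_coeff_lifts]
      intro n
      refine (hR _).mpr fun g => ?_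
      conv_rhs => rw [← hp g]
      rw [coeff_map]; rfl
    exact (mem_lifts _).mp this
  have hmapinj := Polynomial.map_injective _ hiR
  have hev : ∀ p : R[X], algebraMap B S (aeval b p) =
      (p.map (algebraMap R S)).eval (algebraMap B S b) := by
    intro p
    rw [eval_map_algebraMap, aeval_algebraMap_apply]
  choose Λ hΛ using fun c : B => hlift (lagrange φ K (algebraMap B S b) (algebraMap B S c))
    (fun g => lagrange_map (hB' b) (hB' c) g)
  obtain ⟨F, hF⟩ := hlift (∏ q : Γ ⧸ K, (X - C (φ q.out (algebraMap B S b)))) (by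
    intro g
    rw [Polynomial.map_prod]
    refine Fintype.prod_equiv (MulAction.toPerm g) _ _ fun q => ?_
    simp [map_out_apply (hB' b)])
  have hF' : (derivative F).map (algebraMap R S) = lagrange φ K (algebraMap B S b) 1 := by
    rw [← derivative_map, hF, derivative_prod_conjugates]
  have hone : (1 : S) ∈ fixedSubalgebra φ K := one_mem _
  refine ⟨F, ⟨⟨Λ, ?_⟩, ?_⟩, ?_, ?_, ?_⟩
  · intro c c'
    apply hmapinj
    rw [Polynomial.map_add, hΛ, hΛ, hΛ, map_add, lagrange_add]
  · intro r c
    apply hmapinj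
    dsimp only [RingHom.id_apply]
    rw [hΛ, Polynomial.map_smul, hΛ, Algebra.smul_def, map_mul, ← IsScalarTower.algebraMap_apply,
      lagrange_mul _ _ _ ((hR _).mp ⟨r, rfl⟩), smul_eq_C_mul]
  · apply hiB
    rw [hev, hF, map_zero, eval_prod, Finset.prod_eq_zero (i := ((1 : Γ) : Γ ⧸ K)) (by simp)]
    rw [map_out_one (hB' b)]; simp
  · intro c
    apply hiB
    change algebraMap B S (aeval b (Λ c)) = _
    rw [map_mul, hev, hev, hΛ, hF', lagrange_eval (hB' b) (hB' c), lagrange_eval (hB' b) hone,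
      mul_one]
  · intro Q hQ hsep hmem
    rw [hev, hF', lagrange_eval (hB' b) hone, mul_one] at hmem
    obtain ⟨q, hq, hqQ⟩ := (hQ.prod_mem_iff).mp hmem
    refine hsep q.out (fun hK => ?_) hqQ
    rw [Finset.mem_erase] at hq
    apply hq.1
    rw [← QuotientGroup.out_eq' q, QuotientGroup.eq]
    simpa using hK

end GradedInvariants

namespace GradedInvariants

/-! ### Generators of graded subalgebras -/

section GradedGenerators

variable {k S : Type*} [Field k] [CommRing S] [Algebra k S] (𝒜 : ℕ → Submodule k S)
  [GradedAlgebra 𝒜] (ε : S →ₐ[k] k)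

/-- The elements of a subalgebra that are killed by the augmentation `ε`. -/
def augPart (ε : S →ₐ[k] k) (B : Subalgebra k S) : Submodule k S :=
  B.toSubmodule ⊓ LinearMap.ker ε.toLinearMap

variable {𝒜 ε} {B : Subalgebra k S}

theorem sub_algebraMap_mem_augPart {x : S} (hx : x ∈ B) :
    x - algebraMap k S (ε x) ∈ augPart ε B :=
  ⟨B.sub_mem hx (B.algebraMap_mem _), by simp⟩

theorem proj_of_mem {m n : ℕ} {x : S} (hx : x ∈ 𝒜 m) :
    GradedAlgebra.proj 𝒜 n x = if m = n then x else 0 := by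
  rw [GradedAlgebra.proj_apply]
  split_ifs with h
  · subst h; exact DirectSum.decompose_of_mem_same _ hx
  · exact DirectSum.decompose_of_mem_ne _ hx h

theorem proj_mem (i : ℕ) (x : S) : GradedAlgebra.proj 𝒜 i x ∈ 𝒜 i := by
  rw [GradedAlgebra.proj_apply]; exact SetLike.coe_mem _

variable (𝒜) in
theorem exists_sum_proj_eq (x : S) :
    ∃ s : Finset ℕ, 0 ∈ s ∧ ∑ i ∈ s, GradedAlgebra.proj 𝒜 i x = x := by
  classical
  refine ⟨insert 0 (DirectSum.decompose 𝒜 x).support, by simp, ?_⟩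
  conv_rhs => rw [← DirectSum.sum_support_decompose 𝒜 x]
  refine (Finset.sum_subset (Finset.subset_insert _ _) fun i _ hi => ?_).symm
  rw [DFinsupp.notMem_support_iff] at hi
  rw [GradedAlgebra.proj_apply, hi]; rfl

theorem augmentation_proj_zero (hε : ∀ n, 0 < n → ∀ x ∈ 𝒜 n, ε x = 0) (x : S) :
    ε (GradedAlgebra.proj 𝒜 0 x) = ε x := by
  obtain ⟨s, h0, hs⟩ := exists_sum_proj_eq 𝒜 x
  conv_rhs => rw [← hs]
  rw [map_sum, Finset.sum_eq_single_of_mem 0 h0]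
  intro n _ hn
  exact hε n (Nat.pos_of_ne_zero hn) _ (proj_mem n x)

/-- Graded Nakayama lemma: homogeneous elements that generate the augmentation ideal modulo its
square generate the algebra. -/
theorem le_adjoin_of_augPart_le (h0 : ∀ x ∈ 𝒜 0, x ∈ (algebraMap k S).range)
    (hε : ∀ n, 0 < n → ∀ x ∈ 𝒜 n, ε x = 0)
    (hB : ∀ x ∈ B, ∀ n, GradedAlgebra.proj 𝒜 n x ∈ B) {E : Set S}
    (hE : ∀ e ∈ E, ∃ n, e ∈ 𝒜 n)
    (hle : augPart ε B ≤ Submodule.span k E ⊔ augPart ε B * augPart ε B) :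
    B ≤ Algebra.adjoin k E := by
  have hproj0 : ∀ x ∈ augPart ε B, GradedAlgebra.proj 𝒜 0 x = 0 := by
    intro x hx
    obtain ⟨c, hc⟩ := h0 _ (proj_mem 0 x)
    have h1 := augmentation_proj_zero hε x
    have h2 : c = 0 := by
      rw [← hc, show ε x = 0 from hx.2] at h1
      simpa using h1
    rw [← hc, h2, map_zero]
  have key : ∀ n, ∀ x ∈ B, x ∈ 𝒜 n → x ∈ Algebra.adjoin k E := by
    intro n
    induction n using Nat.strong_induction_on with
    | _ n ih =>
      intro x hxB hxn
      rcases Nat.eq_zero_or_pos n with rfl | hn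
      · obtain ⟨c, rfl⟩ := h0 x hxn
        exact Subalgebra.algebraMap_mem _ _
      have hxM : x ∈ augPart ε B := ⟨hxB, hε n hn x hxn⟩
      obtain ⟨y, hy, z, hz, hyz⟩ := Submodule.mem_sup.mp (hle hxM)
      have hx : x = GradedAlgebra.proj 𝒜 n y + GradedAlgebra.proj 𝒜 n z := by
        rw [← map_add, hyz, proj_of_mem hxn, if_pos rfl]
      rw [hx]
      refine add_mem ?_ ?_
      · refine Submodule.span_induction (p := fun y _ =>
          GradedAlgebra.proj 𝒜 n y ∈ Algebra.adjoin k E) ?_ ?_ ?_ ?_ hy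
        · intro e he
          obtain ⟨m, hm⟩ := hE e he
          rw [proj_of_mem hm]
          split_ifs
          · exact Algebra.subset_adjoin he
          · exact zero_mem _
        · simp
        · intro a b _ _ ha hb
          rw [map_add]; exact add_mem ha hb
        · intro c a _ ha
          rw [map_smul]; exact Subalgebra.smul_mem _ ha c
      · refine Submodule.mul_induction_on hz ?_ ?_
        · intro a ha b hb
          obtain ⟨sa, -, hsa⟩ := exists_sum_proj_eq 𝒜 a
          obtain ⟨sb, -, hsb⟩ := exists_sum_proj_eq 𝒜 b
          have hab : a * b = ∑ i ∈ sa, ∑ j ∈ sb,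
              GradedAlgebra.proj 𝒜 i a * GradedAlgebra.proj 𝒜 j b := by
            rw [← Finset.sum_mul_sum, hsa, hsb]
          rw [hab, map_sum]
          refine sum_mem fun i _ => ?_
          rw [map_sum]
          refine sum_mem fun j _ => ?_
          have hi := proj_mem (𝒜 := 𝒜) i a
          have hj := proj_mem (𝒜 := 𝒜) j b
          rw [proj_of_mem (SetLike.mul_mem_graded hi hj)]
          split_ifs with hij
          · rcases Nat.eq_zero_or_pos i with rfl | hi0
            · rw [hproj0 a ha, zero_mul]; exact zero_mem _
            rcases Nat.eq_zero_or_pos j with rfl | hj0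
            · rw [hproj0 b hb, mul_zero]; exact zero_mem _
            exact mul_mem (ih i (by omega) _ (hB a ha.1 i) hi)
              (ih j (by omega) _ (hB b hb.1 j) hj)
          · exact zero_mem _
        · intro a b ha hb
          rw [map_add]; exact add_mem ha hb
  intro x hx
  obtain ⟨s, -, hs⟩ := exists_sum_proj_eq 𝒜 x
  rw [← hs]
  exact sum_mem fun i _ => key i _ (hB x hx i) (proj_mem i x)

/-- A graded algebra whose augmentation ideal is finitely generated modulo its square has a
minimal finite system of homogeneous generators. -/
theorem exists_minimal_generators (h0 : ∀ x ∈ 𝒜 0, x ∈ (algebraMap k S).range)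
    (hε : ∀ n, 0 < n → ∀ x ∈ 𝒜 n, ε x = 0)
    (hB : ∀ x ∈ B, ∀ n, GradedAlgebra.proj 𝒜 n x ∈ B) {m : ℕ} (a : Fin m → S)
    (ha : augPart ε B ≤ Submodule.span k (Set.range a) ⊔ augPart ε B * augPart ε B) :
    ∃ (r : ℕ) (f : Fin r → S), r ≤ m ∧ (∀ i, f i ∈ augPart ε B) ∧ (∀ i, ∃ n, 0 < n ∧ f i ∈ 𝒜 n) ∧
      (∀ c : Fin r → k, ∑ i, c i • f i ∈ augPart ε B * augPart ε B → c = 0) ∧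
      Algebra.adjoin k (Set.range f) = B := by
  classical
  set M := augPart ε B
  set p : S →ₗ[k] S ⧸ (M * M) := (M * M).mkQ
  set E : Set S := {e | e ∈ M ∧ ∃ n, 0 < n ∧ e ∈ 𝒜 n}
  have hspanE : M ≤ Submodule.span k E := by
    intro x hx
    have hpm : ∀ i, GradedAlgebra.proj 𝒜 i x ∈ 𝒜 i := fun i => proj_mem i x
    have hε0 : ε (GradedAlgebra.proj 𝒜 0 x) = 0 := (augmentation_proj_zero hε x).trans hx.2
    obtain ⟨s, -, hs⟩ := exists_sum_proj_eq 𝒜 x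
    rw [← hs]
    refine sum_mem fun i _ => ?_
    rcases Nat.eq_zero_or_pos i with rfl | hi
    · obtain ⟨c, hc⟩ := h0 _ (hpm 0)
      rw [← hc] at hε0 ⊢
      have : c = 0 := by simpa using hε0
      rw [this, map_zero]; exact zero_mem _
    · exact Submodule.subset_span ⟨⟨hB x hx.1 i, hε i hi _ (hpm i)⟩, i, hi, hpm i⟩
  obtain ⟨b, hbE, hbs, hli⟩ := exists_linearIndependent k (p '' E)
  have hspan_le : Submodule.span k b ≤ Submodule.span k (Set.range (p ∘ a)) := by
    rw [hbs, Submodule.span_le]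
    rintro _ ⟨e, he, rfl⟩
    obtain ⟨y, hy, z, hz, hyz⟩ := Submodule.mem_sup.mp (ha he.1)
    have hz0 : p z = 0 := (Submodule.Quotient.mk_eq_zero _).mpr hz
    rw [← hyz, map_add, hz0, add_zero, Set.range_comp, ← Submodule.map_span]
    exact Submodule.mem_map_of_mem hy
  have hfd : FiniteDimensional k (Submodule.span k (Set.range (p ∘ a))) :=
    FiniteDimensional.span_of_finite k (Set.finite_range _)
  have hfd' : FiniteDimensional k (Submodule.span k b) :=
    Submodule.finiteDimensional_of_le hspan_le
  have hbfin : b.Finite := by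
    have h : LinearIndependent k (fun x : b => (⟨x, Submodule.subset_span x.2⟩ :
      Submodule.span k b)) := by
      apply LinearIndependent.of_comp (Submodule.span k b).subtype
      exact hli
    exact Set.finite_coe_iff.mp h.finite
  have : Fintype b := hbfin.fintype
  have hcard : Fintype.card b ≤ m := by
    calc Fintype.card b = Module.finrank k (Submodule.span k b) := by
          rw [finrank_span_set_eq_card hli, Set.toFinset_card]
      _ ≤ Module.finrank k (Submodule.span k (Set.range (p ∘ a))) :=
          Submodule.finrank_mono hspan_le
      _ ≤ m := by
          refine (finrank_range_le_card (p ∘ a)).trans ?_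
          simp
  choose g hg using fun x : b => hbE x.2
  let e := (Fintype.equivFin b).symm
  have hpf : ∀ i, p (g (e i)) = e i := fun i => (hg (e i)).2
  have hgen : M ≤ Submodule.span k (Set.range (fun i => g (e i))) ⊔ M * M := by
    intro x hx
    have h1 : p x ∈ Submodule.span k b := by
      rw [hbs, ← Submodule.map_span]
      exact Submodule.mem_map_of_mem (hspanE hx)
    have h2 : b = p '' (Set.range (fun i => g (e i))) := by
      ext y
      constructor
      · intro hy
        refine ⟨g ⟨y, hy⟩, ⟨e.symm ⟨y, hy⟩, by simp⟩, (hg ⟨y, hy⟩).2⟩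
      · rintro ⟨_, ⟨i, rfl⟩, rfl⟩
        dsimp only
        rw [hpf]; exact (e i).2
    rw [h2, ← Submodule.map_span] at h1
    obtain ⟨y, hy, hyx⟩ := h1
    rw [← sub_add_cancel x y, add_comm]
    refine Submodule.add_mem_sup hy ?_
    rw [← Submodule.Quotient.mk_eq_zero]
    change p (x - y) = 0
    rw [map_sub, hyx, sub_self]
  refine ⟨Fintype.card b, fun i => g (e i), hcard, fun i => (hg (e i)).1.1,
    fun i => (hg (e i)).1.2, ?_, le_antisymm ?_ ?_⟩
  · intro c hc
    have h1 : p (∑ i, c i • g (e i)) = 0 := (Submodule.Quotient.mk_eq_zero _).mpr hc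
    rw [map_sum] at h1
    simp only [map_smul, hpf] at h1
    have h2 : LinearIndependent k (fun i => ((e i : b) : S ⧸ (M * M))) :=
      hli.comp e e.injective
    rw [Fintype.linearIndependent_iff] at h2
    exact funext (h2 c h1)
  · rw [Algebra.adjoin_le_iff]
    rintro _ ⟨i, rfl⟩
    exact (hg (e i)).1.1.1
  · refine le_adjoin_of_augPart_le h0 hε hB ?_ hgen
    rintro _ ⟨i, rfl⟩
    obtain ⟨n, -, hn⟩ := (hg (e i)).1.2
    exact ⟨n, hn⟩

/-- Generators of an algebra, corrected by constants, generate the augmentation ideal modulo its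
square. -/
theorem augPart_adjoin_le (s : Set S) :
    augPart ε (Algebra.adjoin k s) ≤
      Submodule.span k ((fun x => x - algebraMap k S (ε x)) '' s) ⊔
        augPart ε (Algebra.adjoin k s) * augPart ε (Algebra.adjoin k s) := by
  set B := Algebra.adjoin k s
  have key : ∀ x (hx : x ∈ Algebra.adjoin k s), x - algebraMap k S (ε x) ∈
      Submodule.span k ((fun x => x - algebraMap k S (ε x)) '' s) ⊔
        augPart ε B * augPart ε B := by
    intro x hx
    induction hx using Algebra.adjoin_induction with
    | mem x hx => exact Submodule.mem_sup_left (Submodule.subset_span ⟨x, hx, rfl⟩)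
    | algebraMap r => simp
    | add x y _ _ hx hy =>
      rw [map_add, map_add, add_sub_add_comm]
      exact add_mem hx hy
    | mul x y hx' hy' hx hy =>
      have : x * y - algebraMap k S (ε (x * y)) =
          (x - algebraMap k S (ε x)) * (y - algebraMap k S (ε y)) +
          (ε x • (y - algebraMap k S (ε y)) + ε y • (x - algebraMap k S (ε x))) := by
        rw [map_mul, map_mul, Algebra.smul_def, Algebra.smul_def]; ring
      rw [this]
      refine add_mem (Submodule.mem_sup_right ?_)
        (add_mem (Submodule.smul_mem _ _ hy) (Submodule.smul_mem _ _ hx))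
      exact Submodule.mul_mem_mul (sub_algebraMap_mem_augPart hx') (sub_algebraMap_mem_augPart hy')
  intro x hx
  have := key x hx.1
  rwa [show ε x = 0 from hx.2, map_zero, sub_zero] at this

end GradedGenerators
section Algebras

/-- A graded endomorphism commutes with the projections to the graded parts. -/
theorem map_proj_of_graded {k S : Type*} [Field k] [CommRing S] [Algebra k S]
    {𝒜 : ℕ → Submodule k S}
    [GradedAlgebra 𝒜] {φ : S →ₐ[k] S} (hφ : ∀ n, ∀ x ∈ 𝒜 n, φ x ∈ 𝒜 n) (n : ℕ) (x : S) :
    φ (GradedAlgebra.proj 𝒜 n x) = GradedAlgebra.proj 𝒜 n (φ x) := by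
  obtain ⟨s, -, hs⟩ := exists_sum_proj_eq 𝒜 x
  have h1 : ∀ i, GradedAlgebra.proj 𝒜 n (φ (GradedAlgebra.proj 𝒜 i x)) =
      if i = n then φ (GradedAlgebra.proj 𝒜 n x) else 0 := by
    intro i
    rw [proj_of_mem (hφ i _ (proj_mem i x))]
    split_ifs with h
    · rw [h]
    · rfl
  conv_rhs => rw [← hs, map_sum, map_sum, Finset.sum_congr rfl fun i _ => h1 i,
    Finset.sum_ite_eq']
  split_ifs with h
  · rfl
  · have h2 := congrArg (GradedAlgebra.proj 𝒜 n) hs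
    rw [map_sum, Finset.sum_eq_zero fun i hi => ?_] at h2
    · rw [← h2, map_zero]
    · rw [proj_of_mem (proj_mem i x), if_neg]
      rintro rfl
      exact h hi

/-- The augmentation ideal of an algebra is generated by its generators, corrected by constants. -/
theorem exists_sum_mul_sub_of_mem_adjoin {k S ι : Type*} [Field k] [CommRing S] [Algebra k S]
    [Fintype ι] (ε : S →ₐ[k] k) (f : ι → S) {x : S}
    (hx : x ∈ Algebra.adjoin k (Set.range f)) :
    ∃ c : ι → S, (∀ i, c i ∈ Algebra.adjoin k (Set.range f)) ∧
      x - algebraMap k S (ε x) = ∑ i, c i * (f i - algebraMap k S (ε (f i))) := by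
  classical
  induction hx using Algebra.adjoin_induction with
  | mem x hx =>
    obtain ⟨i, rfl⟩ := hx
    refine ⟨fun j => if j = i then 1 else 0, fun j => ?_, by simp⟩
    dsimp only
    split_ifs
    exacts [one_mem _, zero_mem _]
  | algebraMap r => exact ⟨0, fun _ => zero_mem _, by simp⟩
  | add x y _ _ hx hy =>
    obtain ⟨c, hc, h⟩ := hx
    obtain ⟨d, hd, h'⟩ := hy
    refine ⟨c + d, fun i => add_mem (hc i) (hd i), ?_⟩
    simp only [Pi.add_apply, add_mul, Finset.sum_add_distrib, ← h, ← h', map_add]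
    ring
  | mul x y hxm hym hx hy =>
    obtain ⟨c, hc, h⟩ := hx
    obtain ⟨d, hd, h'⟩ := hy
    refine ⟨fun i => y * c i + algebraMap k S (ε x) * d i,
      fun i => add_mem (mul_mem hym (hc i)) (mul_mem (Subalgebra.algebraMap_mem _ _) (hd i)), ?_⟩
    simp only [add_mul, Finset.sum_add_distrib, mul_assoc, ← Finset.mul_sum, ← h, ← h', map_mul]
    ring

end Algebras

end GradedInvariants

namespace GradedInvariants

open MvPolynomial

/-! ### Averaging and divided differences -/

section Reynolds

variable {k S Γ : Type*} [Field k] [CommRing S] [Algebra k S] [Group Γ] [Fintype Γ]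
  (φ : Γ →* (S →ₐ[k] S))

/-- The average over the group, a projection to the invariants if the order of the group is
invertible. -/
noncomputable def reynolds : S →ₗ[k] S :=
  (Nat.card Γ : k)⁻¹ • ∑ g : Γ, (φ g).toLinearMap

variable {φ}

theorem reynolds_apply (x : S) : reynolds φ x = (Nat.card Γ : k)⁻¹ • ∑ g : Γ, φ g x := by
  simp [reynolds]

theorem reynolds_mem (x : S) : reynolds φ x ∈ fixedSubalgebra φ ⊤ := by
  intro h _
  rw [reynolds_apply, map_smul, map_sum]
  congr 1
  refine Fintype.sum_equiv (Equiv.mulLeft h) _ _ fun g => ?_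
  rw [Equiv.coe_mulLeft, map_mul_apply']

theorem reynolds_mul {u : S} (hu : u ∈ fixedSubalgebra φ ⊤) (x : S) :
    reynolds φ (x * u) = reynolds φ x * u := by
  rw [reynolds_apply, reynolds_apply, smul_mul_assoc, Finset.sum_mul]
  congr 1
  refine Finset.sum_congr rfl fun g _ => ?_
  rw [map_mul, hu g trivial]

theorem sub_reynolds (hcard : (Nat.card Γ : k) ≠ 0) (x : S) :
    x - reynolds φ x = (Nat.card Γ : k)⁻¹ • ∑ g : Γ, (x - φ g x) := by
  rw [Finset.sum_sub_distrib, smul_sub, reynolds_apply]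
  congr 1
  rw [Finset.sum_const, Finset.card_univ, ← Nat.card_eq_fintype_card, ← Nat.cast_smul_eq_nsmul k,
    smul_smul, inv_mul_cancel₀ hcard, one_smul]

theorem reynolds_of_mem (hcard : (Nat.card Γ : k) ≠ 0) {x : S} (hx : x ∈ fixedSubalgebra φ ⊤) :
    reynolds φ x = x := by
  have := sub_reynolds (φ := φ) hcard x
  rw [Finset.sum_eq_zero (fun g _ => by rw [hx g trivial, sub_self]), smul_zero] at this
  exact (sub_eq_zero.mp this).symm

theorem augmentation_reynolds (hcard : (Nat.card Γ : k) ≠ 0) {ε : S →ₐ[k] k}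
    (hε : ∀ g x, ε (φ g x) = ε x) (x : S) : ε (reynolds φ x) = ε x := by
  have := congrArg ε (sub_reynolds (φ := φ) hcard x)
  rw [map_smul, map_sum, Finset.sum_eq_zero (fun g _ => by rw [map_sub, hε, sub_self]), smul_zero,
    map_sub, sub_eq_zero] at this
  exact this.symm

end Reynolds

section Syzygies

variable {k σ Γ : Type*} [Field k] [Group Γ]
  {φ : Γ →* (MvPolynomial σ k →ₐ[k] MvPolynomial σ k)} {ε : MvPolynomial σ k →ₐ[k] k}

/-- The ideal generated by the invariants that are killed by the augmentation. -/
noncomputable def invariantIdeal (φ : Γ →* (MvPolynomial σ k →ₐ[k] MvPolynomial σ k))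
    (ε : MvPolynomial σ k →ₐ[k] k) : Ideal (MvPolynomial σ k) :=
  Ideal.span (augPart ε (fixedSubalgebra φ ⊤))

theorem map_mem_invariantIdeal (g : Γ) {x : MvPolynomial σ k} (hx : x ∈ invariantIdeal φ ε) :
    φ g x ∈ invariantIdeal φ ε := by
  refine Submodule.span_induction (p := fun x _ => φ g x ∈ invariantIdeal φ ε) ?_ ?_ ?_ ?_ hx
  · intro x hx
    rw [hx.1 g trivial]
    exact Ideal.subset_span hx
  · simp
  · intro x y _ _ hx hy
    rw [map_add]; exact add_mem hx hy
  · intro a x _ hx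
    rw [smul_eq_mul, map_mul]; exact Ideal.mul_mem_left _ _ hx

/-- Chevalley's lemma: if no relation `∑ rᵢ uᵢ = 0` with invariant coefficients has a coefficient
outside the augmentation ideal at `i₀`, then neither has any relation with polynomial coefficients.
The proof lowers the degree by the divided differences `(s - t s) / L` of the reflections `t`. -/
theorem mem_invariantIdeal_of_sum_eq_zero [Finite Γ] (hcard : (Nat.card Γ : k) ≠ 0)
    (hφ : ∀ g x, (φ g x).totalDegree ≤ x.totalDegree) {T : Set Γ} (hT : Subgroup.closure T = ⊤)
    (hrefl : ∀ t ∈ T, ∃ L : MvPolynomial σ k, L.IsHomogeneous 1 ∧ L ≠ 0 ∧ ∀ f, L ∣ f - φ t f)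
    {ι : Type*} [Fintype ι] {u : ι → MvPolynomial σ k} (hu : ∀ i, u i ∈ fixedSubalgebra φ ⊤)
    (i₀ : ι) (hmin : ∀ r : ι → MvPolynomial σ k, (∀ i, r i ∈ fixedSubalgebra φ ⊤) →
      ∑ i, r i * u i = 0 → ε (r i₀) = 0)
    (s : ι → MvPolynomial σ k) (hs : ∑ i, s i * u i = 0) : s i₀ ∈ invariantIdeal φ ε := by
  have := Fintype.ofFinite Γ
  suffices H : ∀ n, ∀ s : ι → MvPolynomial σ k, (s i₀).totalDegree < n → ∑ i, s i * u i = 0 →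
      s i₀ ∈ invariantIdeal φ ε from H _ s (Nat.lt_succ_self _) hs
  intro n
  induction n with
  | zero => intro s h; exact absurd h (Nat.not_lt_zero _)
  | succ n ih =>
    intro s hdeg hs
    have h1 : ∀ t ∈ T, s i₀ - φ t (s i₀) ∈ invariantIdeal φ ε := by
      intro t ht
      obtain ⟨L, hL1, hL0, hL⟩ := hrefl t ht
      choose q hq using fun i => hL (s i)
      have hsum : ∑ i, q i * u i = 0 := by
        have h2 : L * ∑ i, q i * u i = 0 := by
          rw [Finset.mul_sum]
          have h3 : ∑ i, s i * u i - φ t (∑ i, s i * u i) = 0 := by rw [hs, map_zero, sub_zero]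
          rw [← h3, map_sum, ← Finset.sum_sub_distrib]
          refine Finset.sum_congr rfl fun i _ => ?_
          rw [map_mul, hu i t trivial, ← sub_mul, hq, mul_assoc]
        exact (mul_eq_zero.mp h2).resolve_left hL0
      rw [hq]
      by_cases hq0 : q i₀ = 0
      · rw [hq0, mul_zero]; exact zero_mem _
      refine Ideal.mul_mem_left _ _ (ih q ?_ hsum)
      have h4 : (L * q i₀).totalDegree = 1 + (q i₀).totalDegree := by
        rw [totalDegree_mul_of_isDomain hL0 hq0, hL1.totalDegree hL0]
      have h6 : (s i₀ - φ t (s i₀)).totalDegree ≤ (s i₀).totalDegree :=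
        (totalDegree_sub _ _).trans (max_le le_rfl (hφ _ _))
      rw [hq, h4] at h6
      omega
    have h2 : ∀ g, s i₀ - φ g (s i₀) ∈ invariantIdeal φ ε := by
      intro g
      have hg : g ∈ Subgroup.closure T := by rw [hT]; trivial
      induction hg using Subgroup.closure_induction with
      | mem t ht => exact h1 t ht
      | one => simp
      | mul a b _ _ ha hb =>
        have : s i₀ - φ (a * b) (s i₀) =
            (s i₀ - φ a (s i₀)) + φ a (s i₀ - φ b (s i₀)) := by
          rw [map_mul_apply', map_sub]; ring
        rw [this]
        exact add_mem ha (map_mem_invariantIdeal a hb)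
      | inv a _ ha =>
        have : s i₀ - φ a⁻¹ (s i₀) = - φ a⁻¹ (s i₀ - φ a (s i₀)) := by
          rw [map_sub, ← map_mul_apply', inv_mul_cancel, map_one, AlgHom.one_apply]; ring
        rw [this]
        exact neg_mem (map_mem_invariantIdeal _ ha)
    have h3 : s i₀ - reynolds φ (s i₀) ∈ invariantIdeal φ ε := by
      rw [sub_reynolds hcard, Algebra.smul_def]
      exact Ideal.mul_mem_left _ _ (Ideal.sum_mem _ fun g _ => h2 g)
    have h4 : ε (reynolds φ (s i₀)) = 0 := by
      refine hmin (fun i => reynolds φ (s i)) (fun i => reynolds_mem _) ?_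
      have : reynolds φ (∑ i, s i * u i) = 0 := by rw [hs, map_zero]
      rw [map_sum] at this
      rw [← this]
      exact Finset.sum_congr rfl fun i _ => (reynolds_mul (hu i) _).symm
    rw [← sub_add_cancel (s i₀) (reynolds φ (s i₀))]
    exact add_mem h3 (Ideal.subset_span ⟨reynolds_mem _, h4⟩)

end Syzygies
end GradedInvariants

namespace GradedInvariants

open MvPolynomial

/-! ### Lech independence -/

section Lech

/-- A family is Lech independent if the coefficients of all its linear relations lie in the ideal
that it generates. -/
def LechIndependent {S ι : Type*} [CommRing S] [Fintype ι] (u : ι → S) : Prop :=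
  ∀ s : ι → S, ∑ i, s i * u i = 0 → ∀ i, s i ∈ Ideal.span (Set.range u)

variable {S ι : Type*} [CommRing S] [DecidableEq ι]

theorem span_le_span_update {u : ι → S} {i₀ : ι} {g h : S} (hu : u i₀ = g * h) :
    Ideal.span (Set.range u) ≤ Ideal.span (Set.range (Function.update u i₀ g)) := by
  rw [Ideal.span_le]
  rintro _ ⟨i, rfl⟩
  by_cases hi : i = i₀
  · subst hi
    rw [SetLike.mem_coe, hu]
    refine Ideal.mul_mem_right _ _ (Ideal.subset_span ⟨i, by simp⟩)
  · exact Ideal.subset_span ⟨i, by simp [hi]⟩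

theorem update_pow (f : ι → S) (a : ι → ℕ) (i₀ : ι) (n : ℕ) :
    Function.update (fun i => f i ^ a i) i₀ (f i₀ ^ n) =
      fun i => f i ^ Function.update a i₀ n i := by
  funext i
  by_cases hi : i = i₀
  · subst hi; simp
  · simp [hi]

variable [Fintype ι]

theorem sum_update_mul (s u : ι → S) (i₀ : ι) (g : S) :
    ∑ i, s i * Function.update u i₀ g i = s i₀ * g + ∑ i ∈ Finset.univ.erase i₀, s i * u i := by
  rw [← Finset.add_sum_erase _ _ (Finset.mem_univ i₀)]
  congr 1
  · simp
  · refine Finset.sum_congr rfl fun i hi => ?_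
    rw [Function.update_of_ne (Finset.ne_of_mem_erase hi)]

theorem sum_mul_eq_add (s u : ι → S) (i₀ : ι) :
    ∑ i, s i * u i = s i₀ * u i₀ + ∑ i ∈ Finset.univ.erase i₀, s i * u i :=
  (Finset.add_sum_erase _ _ (Finset.mem_univ i₀)).symm

/-- A factor of a member of a Lech independent family may replace it. -/
theorem LechIndependent.update {u : ι → S} (hu : LechIndependent u) {i₀ : ι} {g h : S}
    (hgh : u i₀ = g * h) : LechIndependent (Function.update u i₀ g) := by
  intro s hs
  have hle := span_le_span_update hgh
  rw [sum_update_mul] at hs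
  -- Multiplication by `h` gives a relation between the members of `u`.
  have h1 : ∑ i, (if i = i₀ then s i₀ else h * s i) * u i = 0 := by
    rw [sum_mul_eq_add _ _ i₀, if_pos rfl, hgh]
    have : ∑ i ∈ Finset.univ.erase i₀, (if i = i₀ then s i₀ else h * s i) * u i =
        h * ∑ i ∈ Finset.univ.erase i₀, s i * u i := by
      rw [Finset.mul_sum]
      refine Finset.sum_congr rfl fun i hi => ?_
      rw [if_neg (Finset.ne_of_mem_erase hi), mul_assoc]
    rw [this]
    linear_combination h * hs
  have h2 := hu _ h1 i₀
  rw [if_pos rfl] at h2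
  obtain ⟨t, ht⟩ := Ideal.mem_span_range_iff_exists_fun.mp h2
  rw [sum_mul_eq_add _ _ i₀, hgh] at ht
  have h3 : ∑ i, (if i = i₀ then t i₀ * g else s i + g * t i) * u i = 0 := by
    rw [sum_mul_eq_add _ _ i₀, if_pos rfl, hgh]
    have : ∑ i ∈ Finset.univ.erase i₀, (if i = i₀ then t i₀ * g else s i + g * t i) * u i =
        ∑ i ∈ Finset.univ.erase i₀, s i * u i + g * ∑ i ∈ Finset.univ.erase i₀, t i * u i := by
      rw [Finset.mul_sum, ← Finset.sum_add_distrib]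
      refine Finset.sum_congr rfl fun i hi => ?_
      rw [if_neg (Finset.ne_of_mem_erase hi)]; ring
    rw [this]
    linear_combination hs + g * ht
  have h4 := hu _ h3
  intro i
  by_cases hi : i = i₀
  · subst hi; exact hle h2
  · have h5 := h4 i
    rw [if_neg hi] at h5
    have h6 : g * t i ∈ Ideal.span (Set.range (Function.update u i₀ g)) :=
      Ideal.mul_mem_right _ _ (Ideal.subset_span ⟨i₀, by simp⟩)
    have := sub_mem (hle h5) h6
    rwa [add_sub_cancel_right] at this

/-- A factor of a member of a Lech independent family may be cancelled. -/
theorem LechIndependent.mem_of_mul_mem {u : ι → S} (hu : LechIndependent u) {i₀ : ι} {g h x : S}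
    (hgh : u i₀ = g * h) (hx : g * x ∈ Ideal.span (Set.range u)) :
    x ∈ Ideal.span (Set.range (Function.update u i₀ h)) := by
  obtain ⟨t, ht⟩ := Ideal.mem_span_range_iff_exists_fun.mp hx
  rw [sum_mul_eq_add _ _ i₀, hgh] at ht
  have h1 : ∑ i, (if i = i₀ then x - t i₀ * h else - (h * t i)) * u i = 0 := by
    rw [sum_mul_eq_add _ _ i₀, if_pos rfl, hgh]
    have : ∑ i ∈ Finset.univ.erase i₀, (if i = i₀ then x - t i₀ * h else - (h * t i)) * u i =
        - (h * ∑ i ∈ Finset.univ.erase i₀, t i * u i) := by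
      rw [Finset.mul_sum, ← Finset.sum_neg_distrib]
      refine Finset.sum_congr rfl fun i hi => ?_
      rw [if_neg (Finset.ne_of_mem_erase hi)]; ring
    rw [this]
    linear_combination - h * ht
  have h2 := hu _ h1 i₀
  rw [if_pos rfl] at h2
  have h3 := span_le_span_update (h := g) (by rw [hgh, mul_comm]) h2
  have h4 : t i₀ * h ∈ Ideal.span (Set.range (Function.update u i₀ h)) :=
    Ideal.mul_mem_left _ _ (Ideal.subset_span ⟨i₀, by simp⟩)
  have := add_mem h3 h4
  rwa [sub_add_cancel] at this

/-- Exponents may be lowered. -/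
theorem LechIndependent.of_le {f : ι → S} {a : ι → ℕ} (ha : LechIndependent (fun i => f i ^ a i))
    {b : ι → ℕ} (hb : ∀ i, b i ≤ a i) : LechIndependent (fun i => f i ^ b i) := by
  suffices H : ∀ s : Finset ι, LechIndependent (fun i => f i ^ (if i ∈ s then b i else a i)) by
    simpa using H Finset.univ
  intro s
  induction s using Finset.induction_on with
  | empty => simpa using ha
  | insert i₀ s hi₀ ih =>
    have := ih.update (i₀ := i₀) (g := f i₀ ^ b i₀) (h := f i₀ ^ (a i₀ - b i₀)) (by
      simp only [if_neg hi₀]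
      rw [← pow_add, Nat.add_sub_cancel' (hb i₀)])
    rw [update_pow] at this
    convert! this using 3 with i
    by_cases hi : i = i₀
    · subst hi; simp
    · simp [hi]

theorem one_mem_of_prod_pow_mem {f : ι → S} (hf : ∀ a : ι → ℕ, LechIndependent (fun i => f i ^ a i))
    (n : ℕ) : ∀ a : ι → ℕ, ∑ i, a i = n →
      ∏ i, f i ^ a i ∈ Ideal.span (Set.range fun i => f i ^ (a i + 1)) →
      (1 : S) ∈ Ideal.span (Set.range f) := by
  induction n with
  | zero =>
    intro a ha h
    have h0 : ∀ i, a i = 0 := fun i => by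
      have := (Finset.sum_eq_zero_iff.mp ha) i (Finset.mem_univ i); exact this
    simpa [h0] using h
  | succ n ih =>
    intro a ha h
    obtain ⟨i₀, -, hi₀⟩ : ∃ i ∈ Finset.univ, a i ≠ 0 := by
      by_contra hc
      push Not at hc
      rw [Finset.sum_eq_zero hc] at ha
      omega
    obtain ⟨m, hm⟩ := Nat.exists_eq_succ_of_ne_zero hi₀
    refine ih (Function.update a i₀ m) ?_ ?_
    · rw [Finset.sum_update_of_mem (Finset.mem_univ i₀)]
      rw [← Finset.add_sum_erase _ _ (Finset.mem_univ i₀), hm] at ha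
      rw [Finset.sdiff_singleton_eq_erase]
      omega
    · have h1 := (hf (fun i => a i + 1)).mem_of_mul_mem (i₀ := i₀) (g := f i₀)
        (h := f i₀ ^ a i₀) (x := ∏ i, f i ^ Function.update a i₀ m i) (by
          rw [pow_succ, mul_comm]) (by
          convert! h using 1
          rw [← Finset.mul_prod_erase _ _ (Finset.mem_univ i₀),
            ← Finset.mul_prod_erase _ (fun i => f i ^ a i) (Finset.mem_univ i₀), ← mul_assoc]
          congr 1
          · rw [Function.update_self, hm, pow_succ, mul_comm]
          · refine Finset.prod_congr rfl fun i hi => ?_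
            rw [Function.update_of_ne (Finset.ne_of_mem_erase hi)])
      rw [update_pow] at h1
      convert! h1 using 4 with i
      by_cases hi : i = i₀
      · subst hi; simp [hm]
      · simp [hi]

/-- If all families of powers of the `f i` are Lech independent and the `f i` generate a proper
ideal, they are algebraically independent: multiply a relation by the power of the `f i` that moves
one of its minimal monomials to `∏ f i ^ D`, and all others into the ideal of the
`f i ^ (D + 1)`. -/
theorem algebraicIndependent_of_lechIndependent {k : Type*} [Field k] [Algebra k S] {f : ι → S}
    (hf : ∀ a : ι → ℕ, LechIndependent (fun i => f i ^ a i))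
    (h1 : (1 : S) ∉ Ideal.span (Set.range f)) : AlgebraicIndependent k f := by
  rw [algebraicIndependent_iff]
  intro Q hQ
  by_contra hQ0
  obtain ⟨m, hmin⟩ := Q.support.exists_minimal (support_nonempty.mpr hQ0)
  have hm := hmin.1
  have hdeg : ∀ i, m i ≤ Q.totalDegree := fun i =>
    (m.le_degree i).trans (by
      have := le_totalDegree hm
      exact this)
  set D := Q.totalDegree
  refine h1 (one_mem_of_prod_pow_mem hf _ (fun _ => D) rfl ?_)
  have hsum : ∑ n ∈ Q.support, (algebraMap k S (coeff n Q)) *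
      ((∏ i, f i ^ n i) * ∏ i, f i ^ (D - m i)) = 0 := by
    have : aeval f Q * ∏ i, f i ^ (D - m i) = 0 := by rw [hQ, zero_mul]
    rw [aeval_def, eval₂_eq', Finset.sum_mul] at this
    rw [← this]
    exact Finset.sum_congr rfl fun n _ => by ring
  rw [← Finset.add_sum_erase _ _ hm] at hsum
  have hprod : (∏ i, f i ^ m i) * ∏ i, f i ^ (D - m i) = ∏ i, f i ^ D := by
    rw [← Finset.prod_mul_distrib]
    refine Finset.prod_congr rfl fun i _ => ?_
    rw [← pow_add, Nat.add_sub_cancel' (hdeg i)]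
  rw [hprod] at hsum
  have hrest : ∑ n ∈ Q.support.erase m, (algebraMap k S (coeff n Q)) *
      ((∏ i, f i ^ n i) * ∏ i, f i ^ (D - m i)) ∈
        Ideal.span (Set.range fun i => f i ^ (D + 1)) := by
    refine Ideal.sum_mem _ fun n hn => Ideal.mul_mem_left _ _ ?_
    obtain ⟨i, hi⟩ : ∃ i, m i < n i := by
      by_contra hc
      push Not at hc
      have hle : n ≤ m := hc
      have := hmin.2 (Finset.mem_of_mem_erase hn) hle
      exact Finset.ne_of_mem_erase hn (le_antisymm hle this)
    rw [← Finset.prod_mul_distrib, ← Finset.mul_prod_erase _ _ (Finset.mem_univ i)]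
    refine Ideal.mul_mem_right _ _ ?_
    rw [← pow_add]
    have : D + 1 ≤ n i + (D - m i) := by have := hdeg i; omega
    exact Ideal.mem_of_dvd _ (pow_dvd_pow _ this) (Ideal.subset_span ⟨i, rfl⟩)
  have hc : coeff m Q ≠ 0 := mem_support_iff.mp hm
  have h2 : algebraMap k S (coeff m Q) * ∏ i, f i ^ D ∈
      Ideal.span (Set.range fun i => f i ^ (D + 1)) := by
    rw [eq_neg_of_add_eq_zero_left hsum]
    exact neg_mem hrest
  have h3 := Ideal.mul_mem_left _ (algebraMap k S (coeff m Q)⁻¹) h2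
  rwa [← mul_assoc, ← map_mul, inv_mul_cancel₀ hc, map_one, one_mul] at h3

end Lech

end GradedInvariants

namespace GradedInvariants

open MvPolynomial

/-! ### Frobenius and Lech independence -/

section Frobenius

variable {k σ : Type*} [Field k]

theorem LechIndependent.map_equiv {S S' ι : Type*} [CommRing S] [CommRing S'] [Fintype ι]
    (e : S ≃+* S') {u : ι → S} (hu : LechIndependent u) :
    LechIndependent (fun i => e (u i)) := by
  intro s hs i
  have h1 := hu (fun i => e.symm (s i)) (by
    apply e.injective
    rw [map_sum, map_zero, ← hs]
    simp) i
  have h2 := Ideal.mem_map_of_mem (e : S →+* S') h1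
  rw [Ideal.map_span, ← Set.range_comp] at h2
  simpa [Function.comp_def] using h2

/-- The coefficient at `β` of a polynomial in its expansion along the monomials whose exponents are
smaller than `p`, where `k[X ^ p]` is identified with `k[X]`. -/
noncomputable def residueCoeff (p : ℕ) (β : σ →₀ ℕ) : MvPolynomial σ k →ₗ[k] MvPolynomial σ k :=
  open Classical in
  (basisMonomials σ k).constr k fun n =>
    if n.mapRange (· % p) (Nat.zero_mod p) = β then
      monomial (n.mapRange (· / p) (Nat.zero_div p)) 1 else 0

open Classical in
theorem residueCoeff_monomial (p : ℕ) (β n : σ →₀ ℕ) (c : k) :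
    residueCoeff p β (monomial n c) = if n.mapRange (· % p) (Nat.zero_mod p) = β then
      monomial (n.mapRange (· / p) (Nat.zero_div p)) c else 0 := by
  have h1 : monomial n c = c • (basisMonomials σ k n) := by
    rw [coe_basisMonomials, smul_monomial, smul_eq_mul, mul_one]
  rw [h1, map_smul, residueCoeff, Module.Basis.constr_basis]
  split_ifs
  · rw [smul_monomial, smul_eq_mul, mul_one]
  · simp

theorem residueCoeff_mul_expand {p : ℕ} (hp : 0 < p) (β : σ →₀ ℕ) (s u : MvPolynomial σ k) :
    residueCoeff p β (s * expand p u) = residueCoeff p β s * u := by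
  classical
  induction s using MvPolynomial.induction_on' with
  | add a b ha hb => rw [add_mul, map_add, map_add, add_mul, ha, hb]
  | monomial n c =>
    induction u using MvPolynomial.induction_on' with
    | add a b ha hb => rw [map_add, mul_add, map_add, mul_add, ha, hb]
    | monomial m d =>
      rw [expand_monomial, monomial_mul, residueCoeff_monomial, residueCoeff_monomial]
      have h1 : (n + p • m).mapRange (· % p) (Nat.zero_mod p) =
          n.mapRange (· % p) (Nat.zero_mod p) := by
        ext i; simp
      have h2 : (n + p • m).mapRange (· / p) (Nat.zero_div p) =
          n.mapRange (· / p) (Nat.zero_div p) + m := by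
        ext i; simp [Nat.add_mul_div_left _ _ hp]
      rw [h1, h2]
      split_ifs
      · rw [monomial_mul]
      · rw [zero_mul]

theorem mem_span_expand_residueCoeff (p : ℕ) (s : MvPolynomial σ k) (J : Ideal (MvPolynomial σ k))
    (hJ : ∀ β, expand p (residueCoeff p β s) ∈ J) : s ∈ J := by
  classical
  set md : (σ →₀ ℕ) → (σ →₀ ℕ) := fun n => n.mapRange (· % p) (Nat.zero_mod p)
  have key : ∑ β ∈ s.support.image md, monomial β 1 * expand p (residueCoeff p β s) = s := by
    have h1 : ∀ β, residueCoeff p β s = ∑ n ∈ s.support,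
        residueCoeff p β (monomial n (coeff n s)) := by
      intro β
      conv_lhs => rw [← support_sum_monomial_coeff s]
      rw [map_sum]
    simp_rw [h1, map_sum, Finset.mul_sum]
    rw [Finset.sum_comm]
    conv_rhs => rw [← support_sum_monomial_coeff s]
    refine Finset.sum_congr rfl fun n hn => ?_
    rw [Finset.sum_eq_single_of_mem (md n) (Finset.mem_image_of_mem md hn)]
    · have h2 : md n + p • n.mapRange (· / p) (Nat.zero_div p) = n := by
        ext i
        simp only [md, Finsupp.add_apply, Finsupp.mapRange_apply, Finsupp.smul_apply, smul_eq_mul]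
        rw [add_comm, Nat.div_add_mod]
      rw [residueCoeff_monomial, if_pos rfl, expand_monomial, monomial_mul, one_mul, h2]
    · intro β _ hβ
      rw [residueCoeff_monomial, if_neg hβ.symm, map_zero, mul_zero]
  rw [← key]
  exact Ideal.sum_mem _ fun β _ => Ideal.mul_mem_left _ _ (hJ β)

/-- Raising variables to the `p`-th power is flat, so it preserves Lech independence. -/
theorem LechIndependent.expand {ι : Type*} [Fintype ι] {u : ι → MvPolynomial σ k}
    (hu : LechIndependent u) {p : ℕ} (hp : 0 < p) :
    LechIndependent (fun i => MvPolynomial.expand p (u i)) := by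
  intro s hs i
  refine mem_span_expand_residueCoeff p _ _ fun β => ?_
  have h1 := hu (fun i => residueCoeff p β (s i)) (by
    have := congrArg (residueCoeff p β) hs
    rw [map_sum, map_zero] at this
    rw [← this]
    exact Finset.sum_congr rfl fun i _ => (residueCoeff_mul_expand hp β _ _).symm) i
  have h2 := Ideal.mem_map_of_mem (MvPolynomial.expand p : _ →ₐ[k] MvPolynomial σ k).toRingHom h1
  rw [Ideal.map_span, ← Set.range_comp] at h2
  exact h2

/-- Over a perfect field the Frobenius endomorphism is an automorphism of the coefficients followed
by raising the variables to the `p`-th power. -/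
theorem LechIndependent.frobenius {p : ℕ} [Fact p.Prime] [CharP k p] [PerfectRing k p]
    {ι : Type*} [Fintype ι] {u : ι → MvPolynomial σ k} (hu : LechIndependent u) (e : ℕ) :
    LechIndependent (fun i => u i ^ p ^ e) := by
  induction e with
  | zero => simpa using hu
  | succ e ih =>
    have h1 := (ih.expand (p := p) (Nat.Prime.pos Fact.out)).map_equiv
      (mapEquiv σ (frobeniusEquiv k p))
    convert! h1 using 2 with i
    have := map_frobenius_expand (p := p) (f := u i ^ p ^ e)
    rw [pow_succ, pow_mul, ← this]
    rfl

theorem LechIndependent.pow {p : ℕ} [Fact p.Prime] [CharP k p] [PerfectRing k p]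
    {ι : Type*} [Fintype ι] [DecidableEq ι] {u : ι → MvPolynomial σ k} (hu : LechIndependent u)
    (a : ι → ℕ) : LechIndependent (fun i => u i ^ a i) := by
  refine LechIndependent.of_le (a := fun _ => p ^ (∑ i, a i)) (hu.frobenius _) fun i => ?_
  have h1 : a i ≤ ∑ i, a i := Finset.single_le_sum (fun _ _ => Nat.zero_le _) (Finset.mem_univ i)
  exact h1.trans (Nat.lt_pow_self (Nat.Prime.one_lt Fact.out)).le

end Frobenius
end GradedInvariants

namespace GradedInvariants

open MvPolynomial

/-! ### Finite generation of rings of invariants -/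

section Finiteness

variable {k S Γ : Type*} [Field k] [CommRing S] [Algebra k S] [Group Γ] [Finite Γ]

theorem isIntegral_fixedSubalgebra (φ : Γ →* (S →ₐ[k] S)) (K : Subgroup Γ) :
    Algebra.IsIntegral (fixedSubalgebra φ K) S := by
  let _ : MulSemiringAction K S :=
    { smul := fun g x => φ g x
      one_smul := fun x => by change φ ((1 : K) : Γ) x = x; simp
      mul_smul := fun g h x => map_mul_apply' (φ := φ) (g : Γ) h x
      smul_zero := fun g => map_zero (φ g)
      smul_add := fun g => map_add (φ g)
      smul_one := fun g => map_one (φ g)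
      smul_mul := fun g => map_mul (φ g) }
  have : SMulCommClass K (fixedSubalgebra φ K) S :=
    ⟨fun g r x => by
      change φ g (r * x) = r * φ g x
      rw [map_mul, r.2 g g.2]⟩
  have : Algebra.IsInvariant (fixedSubalgebra φ K) S K :=
    ⟨fun x hx => ⟨⟨x, fun g hg => hx ⟨g, hg⟩⟩, rfl⟩⟩
  exact Algebra.IsInvariant.isIntegral (fixedSubalgebra φ K) S K

theorem finite_fixedSubalgebra [Algebra.FiniteType k S] (φ : Γ →* (S →ₐ[k] S)) (K : Subgroup Γ) :
    Module.Finite (fixedSubalgebra φ K) S := by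
  have := isIntegral_fixedSubalgebra φ K
  have : Algebra.FiniteType (fixedSubalgebra φ K) S := .of_restrictScalars_finiteType k _ _
  exact Algebra.IsIntegral.finite

/-- Finite generation of invariants, by the Artin–Tate lemma. -/
theorem fixedSubalgebra_fg [Algebra.FiniteType k S] (φ : Γ →* (S →ₐ[k] S)) (K : Subgroup Γ) :
    (fixedSubalgebra φ K).FG := by
  have := finite_fixedSubalgebra φ K
  rw [← Subalgebra.fg_top]
  exact fg_of_fg_of_fg k (fixedSubalgebra φ K) S Algebra.FiniteType.out Module.Finite.fg_top
    Subtype.val_injective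

end Finiteness

section Polynomials

variable {k σ Γ : Type*} [Field k] [Group Γ]

/-- The chain rule. -/
theorem pderiv_aeval {ι : Type*} [Fintype ι] (f : ι → MvPolynomial σ k) (Q : MvPolynomial ι k)
    (x : σ) : pderiv x (aeval f Q) = ∑ j, aeval f (pderiv j Q) * pderiv x (f j) := by
  classical
  induction Q using MvPolynomial.induction_on with
  | C a => simp
  | add p q hp hq => simp only [map_add, hp, hq, add_mul, Finset.sum_add_distrib]
  | mul_X p i hp =>
    have h1 : ∀ j, aeval f (pderiv j (p * X i)) * pderiv x (f j) =
        f i * (aeval f (pderiv j p) * pderiv x (f j)) +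
          (if i = j then aeval f p * pderiv x (f j) else 0) := by
      intro j
      rw [Derivation.leibniz, pderiv_X, Pi.single_apply]
      split_ifs with h
      · subst h; simp; ring
      · simp; ring
    rw [Finset.sum_congr rfl fun j _ => h1 j, Finset.sum_add_distrib, ← Finset.mul_sum, ← hp]
    simp
    ring

theorem pderiv_eq_zero_or_totalDegree_lt (i : σ) (Q : MvPolynomial σ k) :
    pderiv i Q = 0 ∨ (pderiv i Q).totalDegree < Q.totalDegree := by
  by_cases h : pderiv i Q = 0
  · exact Or.inl h
  refine Or.inr ?_
  have h1 : ∀ m ∈ (pderiv i Q).support, m.degree < Q.totalDegree := by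
    intro m hm
    rw [mem_support_iff, coeff_pderiv] at hm
    have h2 : m + Finsupp.single i 1 ∈ Q.support := mem_support_iff.mpr (left_ne_zero_of_mul hm)
    have h3 := le_totalDegree h2
    have h4 : ((m + Finsupp.single i 1).sum fun _ e => e) = m.degree + 1 := by
      change (m + Finsupp.single i 1).degree = _
      rw [map_add, Finsupp.degree_single]
    omega
  obtain ⟨m, hm⟩ := support_nonempty.mpr h
  refine (Finset.sup_lt_iff ((Nat.zero_le _).trans_lt (h1 m hm))).mpr fun m hm => ?_
  exact h1 m hm

theorem eq_C_of_pderiv_eq_zero [CharZero k] {Q : MvPolynomial σ k} (h : ∀ i, pderiv i Q = 0) :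
    Q = C (coeff 0 Q) := by
  classical
  ext m
  rw [coeff_C]
  split_ifs with hm
  · rw [hm]
  · obtain ⟨i, hi⟩ : ∃ i, m i ≠ 0 := by
      by_contra! h0
      exact hm (Finsupp.ext fun i => (h0 i).symm)
    have h1 := congrArg (coeff (m - Finsupp.single i 1)) (h i)
    have h2 : m - Finsupp.single i 1 + Finsupp.single i 1 = m :=
      tsub_add_cancel_of_le (Finsupp.single_le_iff.mpr (Nat.one_le_iff_ne_zero.mpr hi))
    rw [coeff_pderiv, h2, coeff_zero, mul_eq_zero] at h1
    refine h1.resolve_right ?_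
    exact Nat.cast_add_one_ne_zero _

variable {φ : Γ →* (MvPolynomial σ k →ₐ[k] MvPolynomial σ k)}

theorem isHomogeneous_map (hφ : ∀ g i, (φ g (X i)).IsHomogeneous 1) (g : Γ) {n : ℕ}
    {x : MvPolynomial σ k} (hx : x.IsHomogeneous n) : (φ g x).IsHomogeneous n := by
  have h1 : φ g = aeval fun i => φ g (X i) := by ext i; simp
  rw [h1, ← one_mul n]
  exact hx.aeval _ (hφ g)

theorem totalDegree_map_le (hφ : ∀ g i, (φ g (X i)).IsHomogeneous 1) (g : Γ)
    (x : MvPolynomial σ k) : (φ g x).totalDegree ≤ x.totalDegree := by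
  conv_lhs => rw [← sum_homogeneousComponent x]
  rw [map_sum]
  refine totalDegree_finsetSum_le fun i hi => ?_
  exact (isHomogeneous_map hφ g (homogeneousComponent_isHomogeneous i x)).totalDegree_le.trans
    (Nat.lt_succ_iff.mp (Finset.mem_range.mp hi))

theorem augmentation_map (hφ : ∀ g i, (φ g (X i)).IsHomogeneous 1) (g : Γ)
    (x : MvPolynomial σ k) : aeval (0 : σ → k) (φ g x) = aeval (0 : σ → k) x := by
  have h1 : (aeval (0 : σ → k)).comp (φ g) = aeval (0 : σ → k) := by
    ext i
    rw [AlgHom.comp_apply, aeval_X, aeval_zero, constantCoeff_eq]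
    simpa using (hφ g i).coeff_eq_zero (d := 0) (by simp)
  exact DFunLike.congr_fun h1 x

end Polynomials

end GradedInvariants

namespace GradedInvariants

open MvPolynomial

/-! ### Chevalley's theorem -/

section Chevalley

variable {k σ Γ : Type*} [Field k] [Group Γ]
  {φ : Γ →* (MvPolynomial σ k →ₐ[k] MvPolynomial σ k)} {ε : MvPolynomial σ k →ₐ[k] k}

theorem mem_span_of_mem_augPart {ι : Type*} [Fintype ι] {f : ι → MvPolynomial σ k}
    (hf : ∀ i, ε (f i) = 0) {x : MvPolynomial σ k}
    (hx : x ∈ augPart ε (Algebra.adjoin k (Set.range f))) : x ∈ Ideal.span (Set.range f) := by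
  obtain ⟨c, -, hc⟩ := exists_sum_mul_sub_of_mem_adjoin ε f hx.1
  rw [show ε x = 0 from hx.2, map_zero, sub_zero] at hc
  simp only [hf, map_zero, sub_zero] at hc
  exact Ideal.mem_span_range_iff_exists_fun.mpr ⟨c, hc.symm⟩

theorem invariantIdeal_eq_span {ι : Type*} [Fintype ι] {f : ι → MvPolynomial σ k}
    (hf : ∀ i, ε (f i) = 0) (hadj : Algebra.adjoin k (Set.range f) = fixedSubalgebra φ ⊤) :
    invariantIdeal φ ε = Ideal.span (Set.range f) := by
  refine le_antisymm (Ideal.span_le.mpr fun x hx => ?_) (Ideal.span_le.mpr ?_)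
  · rw [← hadj] at hx
    exact mem_span_of_mem_augPart hf hx
  · rintro _ ⟨i, rfl⟩
    refine Ideal.subset_span ⟨?_, hf i⟩
    rw [← hadj]
    exact Algebra.subset_adjoin ⟨i, rfl⟩

/-- A relation between minimal generators of the algebra has coefficients in the augmentation
ideal, if these coefficients belong to the algebra. -/
theorem augmentation_eq_zero_of_sum {r : ℕ} {f : Fin r → MvPolynomial σ k}
    {B : Subalgebra k (MvPolynomial σ k)} (hfB : ∀ i, f i ∈ augPart ε B)
    (hmin : ∀ c : Fin r → k, ∑ i, c i • f i ∈ augPart ε B * augPart ε B → c = 0)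
    {s : Fin r → MvPolynomial σ k} (hs : ∀ i, s i ∈ B)
    (h : ∑ i, s i * f i ∈ augPart ε B * augPart ε B) (i : Fin r) : ε (s i) = 0 := by
  have h1 : (fun i => ε (s i)) = 0 := by
    apply hmin
    have h2 : ∑ i, ε (s i) • f i =
        ∑ i, s i * f i - ∑ i, (s i - algebraMap k _ (ε (s i))) * f i := by
      rw [← Finset.sum_sub_distrib]
      refine Finset.sum_congr rfl fun i _ => ?_
      rw [Algebra.smul_def]; ring
    rw [h2]
    exact sub_mem h (Submodule.sum_mem _ fun i _ =>
      Submodule.mul_mem_mul (sub_algebraMap_mem_augPart (hs i)) (hfB i))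
  exact congrFun h1 i

/-- Chevalley's lemma, applied to the minimal generators themselves. -/
theorem lechIndependent_of_minimal [Finite Γ] (hcard : (Nat.card Γ : k) ≠ 0)
    (hφ : ∀ g x, (φ g x).totalDegree ≤ x.totalDegree) {T : Set Γ} (hT : Subgroup.closure T = ⊤)
    (hrefl : ∀ t ∈ T, ∃ L : MvPolynomial σ k, L.IsHomogeneous 1 ∧ L ≠ 0 ∧ ∀ f, L ∣ f - φ t f)
    {r : ℕ} {f : Fin r → MvPolynomial σ k} (hfB : ∀ i, f i ∈ augPart ε (fixedSubalgebra φ ⊤))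
    (hmin : ∀ c : Fin r → k, ∑ i, c i • f i ∈
      augPart ε (fixedSubalgebra φ ⊤) * augPart ε (fixedSubalgebra φ ⊤) → c = 0)
    (hadj : Algebra.adjoin k (Set.range f) = fixedSubalgebra φ ⊤) : LechIndependent f := by
  intro s hs i
  rw [← invariantIdeal_eq_span (fun i => (hfB i).2) hadj]
  refine mem_invariantIdeal_of_sum_eq_zero hcard hφ hT hrefl (fun i => (hfB i).1) i ?_ s hs
  intro r hr h0
  exact augmentation_eq_zero_of_sum hfB hmin hr (by rw [h0]; exact zero_mem _) i

theorem exists_relation_pderiv_ne_zero [CharZero k] {r : ℕ} {f : Fin r → MvPolynomial σ k}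
    (hf : ¬ AlgebraicIndependent k f) :
    ∃ Q : MvPolynomial (Fin r) k, aeval f Q = 0 ∧ ∃ i, aeval f (pderiv i Q) ≠ 0 := by
  rw [algebraicIndependent_iff] at hf
  push Not at hf
  obtain ⟨Q₀, h0, h0'⟩ := hf
  suffices H : ∀ n, ∀ Q : MvPolynomial (Fin r) k, Q.totalDegree ≤ n → aeval f Q = 0 → Q ≠ 0 →
      ∃ Q : MvPolynomial (Fin r) k, aeval f Q = 0 ∧ ∃ i, aeval f (pderiv i Q) ≠ 0 from
    H _ Q₀ le_rfl h0 h0'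
  intro n
  induction n with
  | zero =>
    intro Q hn hQ hQ0
    rw [totalDegree_eq_zero_iff_eq_C.mp (Nat.le_zero.mp hn)] at hQ hQ0
    rw [aeval_C, map_eq_zero] at hQ
    exact absurd (by rw [hQ, map_zero]) hQ0
  | succ n ih =>
    intro Q hn hQ hQ0
    by_contra hcon
    have h1 : ∀ i, aeval f (pderiv i Q) = 0 := by
      by_contra! h
      exact hcon ⟨Q, hQ, h⟩
    by_cases h2 : ∀ i, pderiv i Q = 0
    · rw [eq_C_of_pderiv_eq_zero h2] at hQ hQ0
      rw [aeval_C, map_eq_zero] at hQ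
      exact hQ0 (by rw [hQ, map_zero])
    · push Not at h2
      obtain ⟨i, hi⟩ := h2
      have h3 := (pderiv_eq_zero_or_totalDegree_lt i Q).resolve_left hi
      exact hcon (ih (pderiv i Q) (by omega) (h1 i) hi)

/-- A finite family in a subalgebra `B` has, up to a multiplier `t ∈ B` outside the augmentation
ideal, a minimal generating subfamily, and relations between its members have no coefficient
outside the augmentation ideal. -/
theorem exists_minimal_subfamily {r : ℕ} {B : Subalgebra k (MvPolynomial σ k)}
    {u : Fin r → MvPolynomial σ k} (hu : ∃ i, u i ≠ 0) :
    ∃ (N : Finset (Fin r)) (i₀ : N) (t : MvPolynomial σ k) (V : Fin r → N → MvPolynomial σ k),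
      t ∈ B ∧ ε t ≠ 0 ∧ (∀ j i, V j i ∈ B) ∧ (∀ j, t * u j = ∑ i, V j i * u i) ∧
      ∀ s : N → MvPolynomial σ k, (∀ i, s i ∈ B) → ∑ i, s i * u i = 0 → ε (s i₀) = 0 := by
  classical
  let P : Finset (Fin r) → Prop := fun N => ∃ t ∈ B, ε t ≠ 0 ∧
    ∃ V : Fin r → Fin r → MvPolynomial σ k, (∀ j i, V j i ∈ B) ∧
      ∀ j, t * u j = ∑ i ∈ N, V j i * u i
  have hP : P Finset.univ := ⟨1, one_mem _, by simp, fun j i => if j = i then 1 else 0,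
    fun j i => by dsimp only; split_ifs; exacts [one_mem _, zero_mem _], fun j => by simp⟩
  obtain ⟨N, hN, hNmin⟩ := Finset.exists_minimal (s := Finset.univ.filter P)
    ⟨_, Finset.mem_filter.mpr ⟨Finset.mem_univ _, hP⟩⟩
  obtain ⟨t, htB, ht, V, hVB, hV⟩ := (Finset.mem_filter.mp hN).2
  have hne : N.Nonempty := by
    rw [Finset.nonempty_iff_ne_empty]
    rintro rfl
    obtain ⟨i, hi⟩ := hu
    have h1 := hV i
    rw [Finset.sum_empty] at h1
    refine (mul_ne_zero ?_ hi) h1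
    rintro rfl
    exact ht (map_zero _)
  obtain ⟨i₀, hi₀⟩ := hne
  refine ⟨N, ⟨i₀, hi₀⟩, t, fun j i => V j i, htB, ht, fun j i => hVB j i, fun j => ?_, ?_⟩
  · rw [hV j, ← Finset.sum_coe_sort N]
  · intro s hsB hs
    by_contra hcon
    let s' : Fin r → MvPolynomial σ k := fun i => if h : i ∈ N then s ⟨i, h⟩ else 0
    have hs'N : ∀ i : N, s' i = s i := fun i => dif_pos i.2
    have hs'B : ∀ i, s' i ∈ B := fun i => by
      simp only [s']; split_ifs; exacts [hsB _, zero_mem _]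
    have hs' : ∑ i ∈ N, s' i * u i = 0 := by
      rw [← hs, ← Finset.sum_coe_sort N]
      exact Finset.sum_congr rfl fun i _ => by rw [hs'N]
    have h1 : P (N.erase i₀) := by
      refine ⟨t * s' i₀, mul_mem htB (hs'B _), ?_,
        fun j i => V j i * s' i₀ - V j i₀ * s' i,
        fun j i => sub_mem (mul_mem (hVB _ _) (hs'B _)) (mul_mem (hVB _ _) (hs'B _)), fun j => ?_⟩
      · rw [map_mul]
        refine mul_ne_zero ht ?_
        rw [hs'N ⟨i₀, hi₀⟩]
        exact hcon
      · have h2 : ∑ i ∈ N, (V j i * s' i₀ - V j i₀ * s' i) * u i =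
            s' i₀ * ∑ i ∈ N, V j i * u i - V j i₀ * ∑ i ∈ N, s' i * u i := by
          rw [Finset.mul_sum, Finset.mul_sum, ← Finset.sum_sub_distrib]
          exact Finset.sum_congr rfl fun i _ => by ring
        rw [← hV, hs', ← Finset.add_sum_erase _ _ hi₀] at h2
        linear_combination -h2
    have h2 := hNmin (Finset.mem_filter.mpr ⟨Finset.mem_univ _, h1⟩) (Finset.erase_subset _ _)
    exact Finset.notMem_erase i₀ N (h2 hi₀)

/-- In characteristic zero, Chevalley's lemma applied to the partial derivatives of a relation
between minimal generators contradicts Euler's identity. -/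
theorem algebraicIndependent_of_minimal_of_charZero [Fintype σ] [CharZero k] [Finite Γ]
    (hφ : ∀ g i, (φ g (X i)).IsHomogeneous 1) {T : Set Γ} (hT : Subgroup.closure T = ⊤)
    (hrefl : ∀ t ∈ T, ∃ L : MvPolynomial σ k, L.IsHomogeneous 1 ∧ L ≠ 0 ∧ ∀ f, L ∣ f - φ t f)
    {r : ℕ} {f : Fin r → MvPolynomial σ k}
    (hfB : ∀ i, f i ∈ augPart (aeval (0 : σ → k)) (fixedSubalgebra φ ⊤))
    (hfn : ∀ i, ∃ n, 0 < n ∧ (f i).IsHomogeneous n)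
    (hmin : ∀ c : Fin r → k, ∑ i, c i • f i ∈ augPart (aeval (0 : σ → k)) (fixedSubalgebra φ ⊤) *
      augPart (aeval (0 : σ → k)) (fixedSubalgebra φ ⊤) → c = 0)
    (hadj : Algebra.adjoin k (Set.range f) = fixedSubalgebra φ ⊤) : AlgebraicIndependent k f := by
  classical
  have := Fintype.ofFinite Γ
  have hcard : (Nat.card Γ : k) ≠ 0 := by exact_mod_cast Nat.card_pos.ne'
  by_contra hf
  obtain ⟨Q, hQ, hQi⟩ := exists_relation_pderiv_ne_zero hf
  have hmemB : ∀ P : MvPolynomial (Fin r) k, aeval f P ∈ fixedSubalgebra φ ⊤ := by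
    intro P
    rw [← hadj, Algebra.adjoin_range_eq_range_aeval]
    exact ⟨P, rfl⟩
  obtain ⟨N, i₀, t, V, htB, ht, hVB, hV, hs⟩ := exists_minimal_subfamily
    (B := fixedSubalgebra φ ⊤) (ε := aeval (0 : σ → k)) (u := fun i => aeval f (pderiv i Q)) hQi
  have hεV : aeval (0 : σ → k) (V i₀ i₀) ≠ 0 := by
    have h1 := hs (fun i => V i₀ i - if i = i₀ then t else 0)
      (fun i => sub_mem (hVB _ _) (by split_ifs; exacts [htB, zero_mem _])) (by
        simp only [sub_mul, Finset.sum_sub_distrib]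
        rw [← hV]
        simp)
    rw [if_pos rfl, map_sub, sub_eq_zero] at h1
    rwa [h1]
  choose d hd0 hd using hfn
  have hI : ∀ x, ∑ j, V j i₀ * pderiv x (f j) ∈ Ideal.span (Set.range f) := by
    intro x
    rw [← invariantIdeal_eq_span (ε := aeval (0 : σ → k)) (fun i => (hfB i).2) hadj]
    refine mem_invariantIdeal_of_sum_eq_zero hcard (totalDegree_map_le hφ) hT hrefl
      (u := fun i : N => aeval f (pderiv (i : Fin r) Q)) (fun i => hmemB _) i₀ hs
      (fun i => ∑ j, V j i * pderiv x (f j)) ?_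
    have h1 := congrArg (pderiv x) hQ
    rw [pderiv_aeval, map_zero] at h1
    have h2 := congrArg (t * ·) h1
    simp only [mul_zero, Finset.mul_sum, ← mul_assoc] at h2
    rw [← h2]
    simp only [hV, Finset.sum_mul]
    rw [Finset.sum_comm]
    exact Finset.sum_congr rfl fun j _ => Finset.sum_congr rfl fun i _ => by ring
  choose c hc using fun x => Ideal.mem_span_range_iff_exists_fun.mp (hI x)
  -- Euler's identity turns the derivatives back into the generators.
  have hE : ∑ j, V j i₀ * (d j • f j) = ∑ l, (∑ x, X x * c x l) * f l := by
    calc ∑ j, V j i₀ * (d j • f j) = ∑ x, X x * ∑ j, V j i₀ * pderiv x (f j) := by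
          simp only [Finset.mul_sum, ← (hd _).sum_X_mul_pderiv]
          rw [Finset.sum_comm]
          exact Finset.sum_congr rfl fun j _ => Finset.sum_congr rfl fun i _ => by ring
      _ = ∑ x, X x * ∑ l, c x l * f l := by simp only [hc]
      _ = _ := by
          simp only [Finset.mul_sum, Finset.sum_mul]
          rw [Finset.sum_comm]
          exact Finset.sum_congr rfl fun j _ => Finset.sum_congr rfl fun i _ => by ring
  have hE' := congrArg (reynolds φ) hE
  have hVf : ∑ j, V j i₀ * (d j • f j) ∈ fixedSubalgebra φ ⊤ :=
    sum_mem fun j _ => mul_mem (hVB _ _) (nsmul_mem (hfB j).1 _)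
  rw [reynolds_of_mem hcard hVf, map_sum] at hE'
  have h1 : ∑ j, (V j i₀ * (d j : MvPolynomial σ k)) * f j ∈
      augPart (aeval (0 : σ → k)) (fixedSubalgebra φ ⊤) *
        augPart (aeval (0 : σ → k)) (fixedSubalgebra φ ⊤) := by
    have h2 : ∑ j, (V j i₀ * (d j : MvPolynomial σ k)) * f j = ∑ j, V j i₀ * (d j • f j) :=
      Finset.sum_congr rfl fun j _ => by rw [nsmul_eq_mul, mul_assoc]
    rw [h2, hE']
    refine Submodule.sum_mem _ fun l _ => ?_
    rw [reynolds_mul (hfB l).1]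
    refine Submodule.mul_mem_mul ⟨reynolds_mem _, ?_⟩ (hfB l)
    change aeval (0 : σ → k) (reynolds φ _) = 0
    rw [augmentation_reynolds hcard (augmentation_map hφ)]
    simp
  have h2 := augmentation_eq_zero_of_sum hfB hmin
    (fun j => mul_mem (hVB j i₀) (natCast_mem _ (d j))) h1 i₀
  rw [map_mul, map_natCast] at h2
  exact mul_ne_zero hεV (Nat.cast_ne_zero.mpr (hd0 _).ne') h2

attribute [local instance] MvPolynomial.gradedAlgebra

/-- Chevalley's theorem for linear actions on a polynomial ring: if the group is generated by
elements `t` for which some linear form divides all `f - t f`, and its order is invertible, then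
the ring of invariants is a polynomial ring. -/
theorem exists_algebraicIndependent_generators [Fintype σ] [PerfectField k] [Finite Γ]
    (hcard : (Nat.card Γ : k) ≠ 0)
    (hφ : ∀ g i, (φ g (X i)).IsHomogeneous 1) {T : Set Γ} (hT : Subgroup.closure T = ⊤)
    (hrefl : ∀ t ∈ T, ∃ L : MvPolynomial σ k, L.IsHomogeneous 1 ∧ L ≠ 0 ∧ ∀ f, L ∣ f - φ t f) :
    ∃ (r : ℕ) (f : Fin r → MvPolynomial σ k), (∀ i, ∃ n, 0 < n ∧ (f i).IsHomogeneous n) ∧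
      AlgebraicIndependent k f ∧ Algebra.adjoin k (Set.range f) = fixedSubalgebra φ ⊤ := by
  obtain ⟨s, hs⟩ := fixedSubalgebra_fg φ ⊤
  have hgen := augPart_adjoin_le (ε := aeval (0 : σ → k)) (s : Set (MvPolynomial σ k))
  rw [hs] at hgen
  let a : Fin s.card → MvPolynomial σ k := fun i =>
    (s.equivFin.symm i : MvPolynomial σ k) - algebraMap k _
      (aeval (0 : σ → k) (s.equivFin.symm i : MvPolynomial σ k))
  have ha : (fun x => x - algebraMap k _ (aeval (0 : σ → k) x)) '' (s : Set (MvPolynomial σ k)) ⊆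
      Set.range a := by
    rintro _ ⟨x, hx, rfl⟩
    exact ⟨s.equivFin ⟨x, hx⟩, by simp [a]⟩
  obtain ⟨r, f, -, hfB, hfn, hmin, hadj⟩ := exists_minimal_generators
    (𝒜 := homogeneousSubmodule σ k) (ε := aeval (0 : σ → k)) (B := fixedSubalgebra φ ⊤)
    (fun x hx => by
      rw [homogeneousSubmodule_zero] at hx
      obtain ⟨c, hc⟩ := Submodule.mem_one.mp hx
      exact ⟨c, hc⟩)
    (fun n hn x hx => by
      rw [aeval_zero, constantCoeff_eq]
      simpa using IsHomogeneous.coeff_eq_zero hx (d := 0) (by simpa using hn.ne))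
    (fun x hx n g _ => by
      rw [map_proj_of_graded (fun _ _ h => isHomogeneous_map hφ g h), hx g trivial])
    a (hgen.trans (sup_le_sup_right (Submodule.span_mono ha) _))
  refine ⟨r, f, hfn, ?_, hadj⟩
  obtain ⟨p, hp⟩ := ExpChar.exists k
  cases hp with
  | zero => exact algebraicIndependent_of_minimal_of_charZero hφ hT hrefl hfB hfn hmin hadj
  | prime hp =>
    have : Fact p.Prime := ⟨hp⟩
    have := PerfectField.toPerfectRing (K := k) p
    refine algebraicIndependent_of_lechIndependent (fun a =>
      (lechIndependent_of_minimal hcard (totalDegree_map_le hφ) hT hrefl hfB hmin hadj).pow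
        (p := p) a) fun h1 => ?_
    have h2 : Ideal.span (Set.range f) ≤ RingHom.ker (aeval (0 : σ → k) : _ →ₐ[k] k) := by
      rw [Ideal.span_le]
      rintro _ ⟨i, rfl⟩
      exact (hfB i).2
    have h3 := h2 h1
    rw [RingHom.mem_ker, map_one] at h3
    exact one_ne_zero h3

end Chevalley

end GradedInvariants

namespace GradedInvariants

/-! ### The action, the evaluations and the grading on `k[V]` -/

section Interface

variable {k V : Type*} [Field k] [AddCommGroup V] [Module k V]

open SymmetricAlgebra (ι)

@[simp]
theorem evalAt_ι (v : V) (ξ : Module.Dual k V) : evalAt v (ι k _ ξ) = ξ v :=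
  SymmetricAlgebra.lift_ι_apply _ _

instance [FiniteDimensional k V] : Algebra.FiniteType k (PolyRing k V) :=
  .equiv inferInstance
    (SymmetricAlgebra.equivMvPolynomial (Module.finBasis k (Module.Dual k V))).symm

section Grading

theorem mem_range_algebraMap_of_mem_polyGrading_zero {f : PolyRing k V}
    (hf : f ∈ polyGrading k V 0) : f ∈ (algebraMap k (PolyRing k V)).range := by
  rw [polyGrading, pow_zero] at hf
  obtain ⟨c, hc⟩ := Submodule.mem_one.mp hf
  exact ⟨c, hc⟩

theorem ι_mem_polyGrading (ξ : Module.Dual k V) : ι k _ ξ ∈ polyGrading k V 1 := by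
  rw [polyGrading, pow_one]
  exact LinearMap.mem_range_self _ _

/-- The substitution of `x • v`, with `x` in an arbitrary algebra, in a homogeneous polynomial. -/
theorem lift_smul_of_mem_polyGrading {A : Type*} [CommRing A] [Algebra k A]
    (ψ : Module.Dual k V →ₗ[k] A) (v : V) (x : A) (hψ : ∀ ξ, ψ ξ = ξ v • x) {n : ℕ} {f : PolyRing k V}
    (hf : f ∈ polyGrading k V n) : SymmetricAlgebra.lift ψ f = evalAt v f • x ^ n := by
  unfold polyGrading at hf
  induction hf using Submodule.pow_induction_on_left' with
  | algebraMap r => simp [Algebra.algebraMap_eq_smul_one]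
  | add x y i hx hy ihx ihy => rw [map_add, map_add, ihx, ihy, add_smul]
  | mem_mul m hm i x hx ih =>
    obtain ⟨ξ, rfl⟩ := hm
    rw [map_mul, map_mul, ih, SymmetricAlgebra.lift_ι_apply, evalAt_ι, hψ, smul_mul_smul_comm,
      pow_succ']

theorem evalAt_smul {n : ℕ} {f : PolyRing k V} (hf : f ∈ polyGrading k V n) (c : k) (v : V) :
    evalAt (c • v) f = c ^ n * evalAt v f := by
  have h1 := lift_smul_of_mem_polyGrading (Module.Dual.eval k V (c • v)) v c
    (fun ξ => by simp [mul_comm]) hf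
  rw [smul_eq_mul, mul_comm] at h1
  exact h1

theorem evalAt_zero_of_mem {n : ℕ} (hn : 0 < n) {f : PolyRing k V} (hf : f ∈ polyGrading k V n) :
    evalAt 0 f = 0 := by
  rw [← zero_smul k (0 : V), evalAt_smul hf, zero_pow hn.ne', zero_mul]

theorem evalAt_eq_sum_proj (v : V) (f : PolyRing k V) (s : Finset ℕ)
    (hs : ∑ i ∈ s, GradedAlgebra.proj (polyGrading k V) i f = f) :
    evalAt v f = ∑ i ∈ s, evalAt v (GradedAlgebra.proj (polyGrading k V) i f) := by
  conv_lhs => rw [← hs]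
  rw [map_sum]

theorem map_equivMvPolynomial_polyGrading {σ : Type*} (b : Module.Basis σ k (Module.Dual k V))
    (n : ℕ) : (polyGrading k V n).map (SymmetricAlgebra.equivMvPolynomial b).toAlgHom.toLinearMap =
      MvPolynomial.homogeneousSubmodule σ k n := by
  rw [polyGrading, Submodule.map_pow, ← MvPolynomial.homogeneousSubmodule_one_pow,
    MvPolynomial.homogeneousSubmodule_one_eq_span_X]
  congr 1
  rw [← LinearMap.range_comp, ← Submodule.map_top, ← b.span_eq, Submodule.map_span,
    ← Set.range_comp]
  congr 2
  funext i
  exact SymmetricAlgebra.equivMvPolynomial_ι_apply b i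

theorem isHomogeneous_equivMvPolynomial {σ : Type*} (b : Module.Basis σ k (Module.Dual k V))
    {n : ℕ} {f : PolyRing k V} :
    (SymmetricAlgebra.equivMvPolynomial b f).IsHomogeneous n ↔ f ∈ polyGrading k V n := by
  rw [← MvPolynomial.mem_homogeneousSubmodule, ← map_equivMvPolynomial_polyGrading b]
  constructor
  · rintro ⟨g, hg, h⟩
    rwa [← (SymmetricAlgebra.equivMvPolynomial b).injective h]
  · exact fun h => ⟨f, h, rfl⟩

end Grading

section Action

variable {G : Type*} [Group G] (ρ : Representation k G V)

theorem polyAct_ι (g : G) (ξ : Module.Dual k V) :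
    polyAct ρ g (ι k _ ξ) = ι k _ (ρ.dual g ξ) :=
  SymmetricAlgebra.lift_ι_apply _ _

/-- The action of `G` on `k[V]`, as a homomorphism to the monoid of algebra endomorphisms. -/
def polyActHom : G →* (PolyRing k V →ₐ[k] PolyRing k V) where
  toFun := polyAct ρ
  map_one' := by
    refine SymmetricAlgebra.algHom_ext (LinearMap.ext fun ξ => ?_)
    change polyAct ρ 1 (ι k _ ξ) = ι k _ ξ
    rw [polyAct_ι, map_one]
    rfl
  map_mul' g h := by
    refine SymmetricAlgebra.algHom_ext (LinearMap.ext fun ξ => ?_)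
    change polyAct ρ (g * h) (ι k _ ξ) = polyAct ρ g (polyAct ρ h (ι k _ ξ))
    rw [polyAct_ι, polyAct_ι, polyAct_ι, map_mul]
    rfl

variable {ρ}

theorem polyActHom_ι (g : G) (ξ : Module.Dual k V) :
    polyActHom ρ g (ι k _ ξ) = ι k _ (ρ.dual g ξ) := polyAct_ι ρ g ξ

theorem evalAt_polyActHom (g : G) (f : PolyRing k V) (v : V) :
    evalAt v (polyActHom ρ g f) = evalAt (ρ g⁻¹ v) f := by
  have h1 : (evalAt v).comp (polyActHom ρ g) = evalAt (ρ g⁻¹ v) := by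
    refine SymmetricAlgebra.algHom_ext (LinearMap.ext fun ξ => ?_)
    simp [polyActHom_ι]
    rfl
  exact DFunLike.congr_fun h1 f

theorem polyActHom_mem_polyGrading (g : G) (n : ℕ) (f : PolyRing k V)
    (hf : f ∈ polyGrading k V n) : polyActHom ρ g f ∈ polyGrading k V n := by
  have h1 : (polyGrading k V n).map (polyActHom ρ g).toLinearMap ≤ polyGrading k V n := by
    rw [polyGrading, Submodule.map_pow]
    refine pow_le_pow_left' ?_ n
    rintro _ ⟨_, ⟨ξ, rfl⟩, rfl⟩
    exact ⟨ρ.dual g ξ, (polyActHom_ι g ξ).symm⟩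
  exact h1 ⟨f, hf, rfl⟩

theorem proj_mem_fixedSubalgebra {K : Subgroup G} {f : PolyRing k V}
    (hf : f ∈ fixedSubalgebra (polyActHom ρ) K) (n : ℕ) :
    GradedAlgebra.proj (polyGrading k V) n f ∈ fixedSubalgebra (polyActHom ρ) K := by
  intro g hg
  rw [map_proj_of_graded (polyActHom_mem_polyGrading g), hf g hg]

theorem mem_invariantRing {f : PolyRing k V} :
    f ∈ invariantRing ρ ↔ ∀ g, polyActHom ρ g f = f := by
  simp [invariantRing, Algebra.mem_iInf, AlgHom.mem_equalizer, polyActHom]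

theorem invariantRing_eq : invariantRing ρ = fixedSubalgebra (polyActHom ρ) ⊤ := by
  ext f
  rw [mem_invariantRing, mem_fixedSubalgebra]
  simp

theorem invariantRing_le (K : Subgroup G) :
    invariantRing ρ ≤ fixedSubalgebra (polyActHom ρ) K :=
  fun _ hf g _ => mem_invariantRing.mp hf g

theorem sum_mem_fixedSubalgebra {S Γ : Type*} [CommRing S] [Algebra k S] [Group Γ]
    (φ : Γ →* (S →ₐ[k] S)) (K : Subgroup Γ) [Fintype K] (x : S) :
    ∑ h : K, φ h x ∈ fixedSubalgebra φ K := by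
  intro g hg
  rw [map_sum]
  refine Fintype.sum_equiv (Equiv.mulLeft (⟨g, hg⟩ : K)) _ _ fun h => ?_
  rw [Equiv.coe_mulLeft, Subgroup.coe_mul, map_mul_apply']

theorem prod_mem_fixedSubalgebra {S Γ : Type*} [CommRing S] [Algebra k S] [Group Γ]
    (φ : Γ →* (S →ₐ[k] S)) (K : Subgroup Γ) [Fintype K] (x : S) :
    ∏ h : K, φ h x ∈ fixedSubalgebra φ K := by
  intro g hg
  rw [map_prod]
  refine Fintype.prod_equiv (Equiv.mulLeft (⟨g, hg⟩ : K)) _ _ fun h => ?_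
  rw [Equiv.coe_mulLeft, Subgroup.coe_mul, map_mul_apply']

end Action

section Translation

/-- The translate `f (x + v)` of a polynomial `f (x)`. -/
def translate (v : V) : PolyRing k V →ₐ[k] PolyRing k V :=
  SymmetricAlgebra.lift (ι k _ + Algebra.linearMap k _ ∘ₗ Module.Dual.eval k V v)

theorem translate_ι (v : V) (ξ : Module.Dual k V) :
    translate v (ι k _ ξ) = ι k _ ξ + algebraMap k _ (ξ v) :=
  SymmetricAlgebra.lift_ι_apply _ _

theorem evalAt_translate (v w : V) (f : PolyRing k V) :
    evalAt w (translate v f) = evalAt (w + v) f := by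
  have h1 : (evalAt w).comp (translate v) = evalAt (k := k) (w + v) := by
    refine SymmetricAlgebra.algHom_ext (LinearMap.ext fun ξ => ?_)
    simp [translate_ι]
  exact DFunLike.congr_fun h1 f

theorem translate_translate_neg (v : V) (f : PolyRing k V) :
    translate v (translate (-v) f) = f := by
  have h1 : (translate v).comp (translate (-v)) = AlgHom.id k (PolyRing k V) := by
    refine SymmetricAlgebra.algHom_ext (LinearMap.ext fun ξ => ?_)
    simp [translate_ι]
  exact DFunLike.congr_fun h1 f

variable {G : Type*} [Group G] {ρ : Representation k G V}

theorem polyActHom_translate {g : G} {v : V} (hg : ρ g v = v) (f : PolyRing k V) :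
    polyActHom ρ g (translate v f) = translate v (polyActHom ρ g f) := by
  have hg' : ρ g⁻¹ v = v := by
    conv_lhs => rw [← hg]
    simp
  have h1 : (polyActHom ρ g).comp (translate v) = (translate v).comp (polyActHom ρ g) := by
    refine SymmetricAlgebra.algHom_ext (LinearMap.ext fun ξ => ?_)
    simp [translate_ι, polyActHom_ι]
    exact (congrArg ξ hg').symm
  exact DFunLike.congr_fun h1 f

theorem translate_mem_fixedSubalgebra {K : Subgroup G} {v : V} (hK : ∀ g ∈ K, ρ g v = v)
    {f : PolyRing k V} (hf : f ∈ fixedSubalgebra (polyActHom ρ) K) :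
    translate v f ∈ fixedSubalgebra (polyActHom ρ) K := by
  intro g hg
  rw [polyActHom_translate (hK g hg), hf g hg]

end Translation

section LinePolynomial

theorem exists_polynomial_on_line (x y : V) (f : PolyRing k V) :
    ∃ p : Polynomial k, ∀ t, p.eval t = evalAt (x + t • y) f := by
  let ψ : PolyRing k V →ₐ[k] Polynomial k := SymmetricAlgebra.lift
    (Algebra.linearMap k (Polynomial k) ∘ₗ Module.Dual.eval k V x +
      LinearMap.mulRight k Polynomial.X ∘ₗ
        Algebra.linearMap k (Polynomial k) ∘ₗ Module.Dual.eval k V y)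
  refine ⟨ψ f, fun t => ?_⟩
  have h1 : (Polynomial.aeval t).comp ψ = evalAt (x + t • y) := by
    refine SymmetricAlgebra.algHom_ext (LinearMap.ext fun ξ => ?_)
    change Polynomial.aeval t (ψ (ι k _ ξ)) = evalAt (x + t • y) (ι k _ ξ)
    have h2 : ψ (ι k _ ξ) = Polynomial.C (ξ x) + Polynomial.C (ξ y) * Polynomial.X :=
      SymmetricAlgebra.lift_ι_apply _ _
    rw [h2, evalAt_ι, Polynomial.coe_aeval_eq_eval, Polynomial.eval_add, Polynomial.eval_mul,
      Polynomial.eval_C, Polynomial.eval_C, Polynomial.eval_X, map_add, map_smul, smul_eq_mul,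
      mul_comm t]
  rw [← DFunLike.congr_fun h1 f, AlgHom.comp_apply, Polynomial.coe_aeval_eq_eval]

/-- Over an algebraically closed field, a polynomial without zeros on a plane outside the origin
has no zero at the origin: it is constant along the parallels to a coordinate axis, except possibly
along this axis, and hence along the axis as well. -/
theorem evalAt_zero_ne_zero [IsAlgClosed k] (x y : V) (f : PolyRing k V)
    (h : ∀ a b : k, a ≠ 0 ∨ b ≠ 0 → evalAt (a • x + b • y) f ≠ 0) : evalAt 0 f ≠ 0 := by
  have h1 : ∀ a : k, a ≠ 0 → evalAt (a • x + y) f = evalAt (a • x) f := by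
    intro a ha
    obtain ⟨p, hp⟩ := exists_polynomial_on_line (a • x) y f
    have h2 : p.degree ≤ 0 := by
      by_contra hcon
      obtain ⟨t, ht⟩ := IsAlgClosed.exists_root p (fun h0 => hcon h0.le)
      rw [Polynomial.IsRoot, hp] at ht
      exact h a t (Or.inl ha) ht
    rw [Polynomial.eq_C_of_degree_le_zero h2] at hp
    have h3 := hp 1
    have h4 := hp 0
    rw [Polynomial.eval_C] at h3 h4
    rw [one_smul] at h3
    rw [zero_smul, add_zero] at h4
    rw [← h3, ← h4]
  obtain ⟨p, hp⟩ := exists_polynomial_on_line y x f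
  obtain ⟨q, hq⟩ := exists_polynomial_on_line 0 x f
  have h2 : p - q = 0 := by
    refine Polynomial.eq_zero_of_infinite_isRoot _
      ((Set.finite_singleton (0 : k)).infinite_compl.mono fun a ha => ?_)
    rw [Set.mem_ofPred_eq, Polynomial.IsRoot, Polynomial.eval_sub, hp, hq, zero_add, add_comm,
      h1 a ha, sub_self]
  have h3 := congrArg (Polynomial.eval 0) h2
  rw [Polynomial.eval_sub, hp, hq, Polynomial.eval_zero, zero_smul, add_zero, add_zero,
    sub_eq_zero] at h3
  rw [← h3]
  simpa using h 0 1 (Or.inr one_ne_zero)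

end LinePolynomial

section Nullstellensatz

variable [FiniteDimensional k V]

theorem exists_evalAt_eq_aeval {σ : Type*} [Finite σ] (b : Module.Basis σ k (Module.Dual k V))
    (x : σ → k) : ∃ v : V, ∀ f, evalAt v f = MvPolynomial.aeval x
      (SymmetricAlgebra.equivMvPolynomial b f) := by
  obtain ⟨v, hv⟩ := (Module.evalEquiv k V).surjective (b.constr k x)
  refine ⟨v, fun f => ?_⟩
  have h1 : evalAt v = (MvPolynomial.aeval x).comp
      (SymmetricAlgebra.equivMvPolynomial b : PolyRing k V →ₐ[k] MvPolynomial σ k) := by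
    refine SymmetricAlgebra.algHom_ext (b.ext fun i => ?_)
    have h2 := DFunLike.congr_fun hv (b i)
    rw [Module.Basis.constr_basis] at h2
    simpa using h2
  exact DFunLike.congr_fun h1 f

/-- The Nullstellensatz for `k[V]`. -/
theorem exists_zero_not_zero [IsAlgClosed k] (P : Ideal (PolyRing k V)) [hP : P.IsPrime]
    {f : PolyRing k V} (hf : f ∉ P) : ∃ v : V, (∀ g ∈ P, evalAt v g = 0) ∧ evalAt v f ≠ 0 := by
  let b := Module.finBasis k (Module.Dual k V)
  let e := SymmetricAlgebra.equivMvPolynomial b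
  let P' := P.comap e.symm.toRingEquiv.toRingHom
  have hP' : P'.IsPrime := Ideal.comap_isPrime _ _
  have h1 : e f ∉ MvPolynomial.vanishingIdeal k (MvPolynomial.zeroLocus k P') := by
    rw [MvPolynomial.IsPrime.vanishingIdeal_zeroLocus]
    simpa [P'] using hf
  rw [MvPolynomial.mem_vanishingIdeal_iff] at h1
  push Not at h1
  obtain ⟨x, hx, hx0⟩ := h1
  obtain ⟨v, hv⟩ := exists_evalAt_eq_aeval b x
  refine ⟨v, fun g hg => ?_, ?_⟩
  · rw [hv]
    exact hx _ (by simpa [P', e] using hg)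
  · rw [hv]
    exact hx0

end Nullstellensatz

end Interface

end GradedInvariants

namespace GradedInvariants

/-! ### Reflection subgroups -/

/-- The order of a subgroup is invertible if that of the group is. -/
theorem natCast_card_subgroup_ne_zero {k G : Type*} [Field k] [Group G] (hG : (Nat.card G : k) ≠ 0)
    (K : Subgroup G) :
    (Nat.card K : k) ≠ 0 := by
  intro h0
  obtain ⟨c, hc⟩ := K.card_subgroup_dvd_card
  rw [hc, Nat.cast_mul, h0, zero_mul] at hG
  exact hG rfl

section Reflections

variable {k G V : Type*} [Field k] [Group G] [AddCommGroup V] [Module k V]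
  {ρ : Representation k G V}

open SymmetricAlgebra (ι)

/-- The elements that act on `V` as a reflection or as the identity. -/
def reflectionSet (ρ : Representation k G V) : Set G :=
  {g | ρ g = 1 ∨ Module.finrank k (LinearMap.range (ρ g - 1)) = 1}

/-- The subgroup of `H` generated by the elements that act as a reflection or as the identity. -/
def reflectionSubgroup (ρ : Representation k G V) (H : Subgroup G) : Subgroup G :=
  Subgroup.closure (H ∩ reflectionSet ρ)

theorem reflectionSubgroup_le (H : Subgroup G) : reflectionSubgroup ρ H ≤ H :=
  (Subgroup.closure_le _).mpr Set.inter_subset_left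

theorem mem_reflectionSubgroup {H : Subgroup G} {g : G} (hg : g ∈ H) (h : g ∈ reflectionSet ρ) :
    g ∈ reflectionSubgroup ρ H :=
  Subgroup.subset_closure ⟨hg, h⟩

/-- The elements of `H` that act trivially belong to `reflectionSubgroup ρ H`, so that this subgroup
is the preimage in `H` of the subgroup of `GL(V)` generated by the reflections. -/
theorem actsAsReflectionGroup_iff [Finite G] (H : Subgroup G) :
    ActsAsReflectionGroup ρ H ↔ reflectionSubgroup ρ H = H := by
  have hcoe : ∀ g, ((ρ.toHomUnits g : LinearMap.GeneralLinearGroup k V) : V →ₗ[k] V) = ρ g :=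
    fun g => rfl
  constructor
  · intro h
    refine le_antisymm (reflectionSubgroup_le H) fun g hg => ?_
    have h1 : Subgroup.closure {s | s ∈ H.map ρ.toHomUnits ∧ IsReflection s} ≤
        (reflectionSubgroup ρ H).map ρ.toHomUnits := by
      rw [Subgroup.closure_le]
      rintro _ ⟨⟨t, ht, rfl⟩, hr⟩
      refine ⟨t, mem_reflectionSubgroup ht (Or.inr ?_), rfl⟩
      rw [← hcoe]
      exact hr.2
    obtain ⟨w, hw, hwg⟩ := h1 (h.symm.le ⟨g, hg, rfl⟩)
    have h2 : ρ (w⁻¹ * g) = 1 := by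
      have h3 : ρ.toHomUnits (w⁻¹ * g) = 1 := by
        rw [map_mul, map_inv, hwg, inv_mul_cancel]
      rw [← hcoe, h3]
      rfl
    have h4 : w⁻¹ * g ∈ reflectionSubgroup ρ H :=
      mem_reflectionSubgroup (H.mul_mem (H.inv_mem (reflectionSubgroup_le H hw)) hg) (Or.inl h2)
    simpa using (reflectionSubgroup ρ H).mul_mem hw h4
  · intro h
    refine le_antisymm ((Subgroup.closure_le _).mpr fun s hs => hs.1) ?_
    conv_lhs => rw [← h]
    rw [reflectionSubgroup, MonoidHom.map_closure, Subgroup.closure_le]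
    rintro _ ⟨t, ⟨ht, ht'⟩, rfl⟩
    rcases ht' with ht' | ht'
    · have : ρ.toHomUnits t = 1 := Units.ext ht'
      rw [this]
      exact Subgroup.one_mem _
    · exact Subgroup.subset_closure ⟨⟨t, ht, rfl⟩,
        ρ.toHomUnits.isOfFinOrder (isOfFinOrder_of_finite t), ht'⟩

/-- The linear equation of the hyperplane of a reflection `t` divides `f - t f`. -/
theorem exists_linearForm_dvd_sub [FiniteDimensional k V] [Nontrivial V] {t : G}
    (ht : t ∈ reflectionSet ρ) :
    ∃ l : Module.Dual k V, l ≠ 0 ∧ ∀ f, ι k _ l ∣ f - polyActHom ρ t f := by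
  rcases ht with ht | ht
  · obtain ⟨l, hl⟩ := exists_ne (0 : Module.Dual k V)
    refine ⟨l, hl, fun f => ?_⟩
    have h1 : polyActHom ρ t = AlgHom.id k _ := by
      refine SymmetricAlgebra.algHom_ext (LinearMap.ext fun ξ => ?_)
      have h2 : ρ t⁻¹ = 1 := by
        have h3 : ρ t⁻¹ * ρ t = 1 := by rw [← map_mul, inv_mul_cancel, map_one]
        rwa [ht, mul_one] at h3
      change polyActHom ρ t (ι k _ ξ) = ι k _ ξ
      rw [polyActHom_ι, Representation.dual_apply, h2]
      rfl
    rw [h1, AlgHom.id_apply, sub_self]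
    exact dvd_zero _
  · obtain ⟨ψ⟩ := FiniteDimensional.nonempty_linearEquiv_of_finrank_eq
      (ht.trans (Module.finrank_self k).symm)
    let l₀ : Module.Dual k V := ψ.toLinearMap ∘ₗ (ρ t - 1).rangeRestrict
    let u : V := ψ.symm 1
    have h1 : ∀ v, ρ t v - v = l₀ v • u := by
      intro v
      have h2 : ψ.symm (l₀ v) = (ρ t - 1).rangeRestrict v := ψ.symm_apply_apply _
      have h3 : ψ.symm (l₀ v) = l₀ v • ψ.symm 1 := by rw [← map_smul, smul_eq_mul, mul_one]
      have h4 := congrArg Subtype.val (h2.symm.trans h3)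
      exact h4
    let l : Module.Dual k V := l₀ ∘ₗ ρ t⁻¹
    have hinv : ∀ v, ρ t (ρ t⁻¹ v) = v := fun v => by simp
    have hinv' : ∀ v, ρ t⁻¹ (ρ t v) = v := fun v => by simp
    refine ⟨l, ?_, fun f => ?_⟩
    · intro hl
      have h2 : ρ t - 1 = 0 := by
        ext v
        have h3 := DFunLike.congr_fun hl (ρ t v)
        have h5 : l₀ v = 0 := by
          simpa [l] using h3
        change ρ t v - v = 0
        rw [h1, h5, zero_smul]
      rw [h2, LinearMap.range_zero, finrank_bot] at ht
      exact zero_ne_one ht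
    · have hι : ∀ ξ, ι k _ ξ - polyActHom ρ t (ι k _ ξ) = ι k _ l * algebraMap k _ (ξ u) := by
        intro ξ
        rw [polyActHom_ι, ← map_sub, mul_comm, ← Algebra.smul_def, ← map_smul]
        congr 1
        ext v
        change ξ v - ξ (ρ t⁻¹ v) = ξ u * l₀ (ρ t⁻¹ v)
        have h2 := h1 (ρ t⁻¹ v)
        rw [hinv] at h2
        rw [← map_sub, h2, map_smul, smul_eq_mul, mul_comm]
      induction f using SymmetricAlgebra.induction with
      | algebraMap r => rw [AlgHom.commutes, sub_self]; exact dvd_zero _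
      | ι ξ => rw [hι]; exact dvd_mul_right _ _
      | mul a b ha hb =>
        have h2 : a * b - polyActHom ρ t (a * b) =
            a * (b - polyActHom ρ t b) + (a - polyActHom ρ t a) * polyActHom ρ t b := by
          rw [map_mul]; ring
        rw [h2]
        exact dvd_add (hb.mul_left _) (ha.mul_right _)
      | add a b ha hb =>
        rw [map_add, add_sub_add_comm]
        exact dvd_add ha hb

/-- Chevalley's theorem for the action on `k[V]` of a subgroup that is generated by elements acting
as a reflection or as the identity. -/
theorem exists_generators_fixedSubalgebra_closure [Finite G] [PerfectField k]
    [FiniteDimensional k V] [Nontrivial V] (hG : (Nat.card G : k) ≠ 0) {T : Set G}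
    (hT : T ⊆ reflectionSet ρ) :
    ∃ (r : ℕ) (g : Fin r → PolyRing k V), (∀ i, ∃ n, 0 < n ∧ g i ∈ polyGrading k V n) ∧
      AlgebraicIndependent k g ∧
      Algebra.adjoin k (Set.range g) = fixedSubalgebra (polyActHom ρ) (Subgroup.closure T) := by
  let b := Module.finBasis k (Module.Dual k V)
  let e := SymmetricAlgebra.equivMvPolynomial b
  let W := Subgroup.closure T
  let φ : W →* (MvPolynomial _ k →ₐ[k] MvPolynomial _ k) :=
    { toFun := fun w => e.toAlgHom.comp ((polyActHom ρ w).comp e.symm.toAlgHom)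
      map_one' := by ext; simp
      map_mul' := fun x y => by ext; simp }
  have hφ : ∀ w x, φ w x = e (polyActHom ρ w (e.symm x)) := fun _ _ => rfl
  have hcard : (Nat.card W : k) ≠ 0 := natCast_card_subgroup_ne_zero hG W
  obtain ⟨r, f, hfn, hf, hadj⟩ := exists_algebraicIndependent_generators (φ := φ)
    (T := ((↑) : W → G) ⁻¹' T) hcard (fun w i => by
      rw [hφ, isHomogeneous_equivMvPolynomial, SymmetricAlgebra.equivMvPolynomial_symm_X]
      exact polyActHom_mem_polyGrading _ _ _ (ι_mem_polyGrading _))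
    Subgroup.closure_closure_coe_preimage (fun t ht => by
      obtain ⟨l, hl, hdvd⟩ := exists_linearForm_dvd_sub (hT ht)
      refine ⟨e (ι k _ l), (isHomogeneous_equivMvPolynomial b).mpr (ι_mem_polyGrading l), ?_, ?_⟩
      · rw [map_ne_zero_iff e e.injective]
        intro h0
        apply hl
        ext v
        rw [← evalAt_ι, h0, map_zero]
        rfl
      · intro f
        rw [hφ]
        have h1 := map_dvd e (hdvd (e.symm f))
        rwa [map_sub, e.apply_symm_apply] at h1)
  refine ⟨r, fun i => e.symm (f i), fun i => ?_, hf.map' (f := e.symm.toAlgHom)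
    e.symm.injective, ?_⟩
  · obtain ⟨n, hn, h⟩ := hfn i
    refine ⟨n, hn, (isHomogeneous_equivMvPolynomial b).mp ?_⟩
    change (e (e.symm (f i))).IsHomogeneous n
    rwa [e.apply_symm_apply]
  · have h1 : Set.range (fun i => e.symm (f i)) = e.symm.toAlgHom '' Set.range f := by
      rw [← Set.range_comp]; rfl
    rw [h1, ← AlgHom.map_adjoin, hadj]
    ext x
    constructor
    · rintro ⟨y, hy, rfl⟩ w hw
      have h2 := hy ⟨w, hw⟩ trivial
      rw [hφ] at h2
      apply e.injective
      change e (polyActHom ρ w (e.symm y)) = e (e.symm y)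
      rw [h2, e.apply_symm_apply]
    · intro hx
      refine ⟨e x, fun w _ => ?_, e.symm_apply_apply x⟩
      rw [hφ, e.symm_apply_apply, hx w w.2]

end Reflections

end GradedInvariants

namespace GradedInvariants

open Polynomial

/-! ### Étaleness of rings of invariants at points -/

section EtalePoints

variable {k S Γ : Type*} [Field k] [CommRing S] [Algebra k S] [Group Γ]

/-- If `b` separates a point from its other conjugates modulo `K`, then near this point the maximal
ideal of the ring of `K`-invariants is generated by the maximal ideal of the ring of all
invariants. -/
theorem exists_mul_mem_of_separating {φ : Γ →* (S →ₐ[k] S)} {K : Subgroup Γ} [Finite (Γ ⧸ K)]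
    {R B : Subalgebra k S} (hRB : R ≤ B) (hR : ∀ x, x ∈ R ↔ ∀ g, φ g x = x)
    (hB : ∀ x, x ∈ B ↔ ∀ g ∈ K, φ g x = x) (ε : S →ₐ[k] k) {b : S} (hbB : b ∈ B)
    (hb : ∀ g, g ∉ K → ε b ≠ ε (φ g b)) (I : Ideal B)
    (hI : ∀ y : R, ε y = 0 → ∃ s : B, ε s ≠ 0 ∧ s * Subalgebra.inclusion hRB y ∈ I) (x : B)
    (hx : ε x = 0) : ∃ s : B, ε s ≠ 0 ∧ s * x ∈ I := by
  let _ : Algebra R B := (Subalgebra.inclusion hRB).toRingHom.toAlgebra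
  have : IsScalarTower R B S := .of_algebraMap_eq fun _ => rfl
  obtain ⟨F, Λ, hF, hΛ, hQ⟩ := exists_lagrange (φ := φ) (K := K) (R := R) (B := B)
    (fun x => by rw [← hR]; exact ⟨by rintro ⟨y, rfl⟩; exact y.2, fun h => ⟨⟨x, h⟩, rfl⟩⟩)
    (fun x => by rw [← hB]; exact ⟨by rintro ⟨y, rfl⟩; exact y.2, fun h => ⟨⟨x, h⟩, rfl⟩⟩)
    Subtype.val_injective Subtype.val_injective ⟨b, hbB⟩
  let Q : Ideal B := RingHom.ker (ε.comp B.val)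
  have hQp : Q.IsPrime := RingHom.ker_isPrime _
  have hQF : aeval (⟨b, hbB⟩ : B) (derivative F) ∉ Q :=
    hQ (RingHom.ker ε) (RingHom.ker_isPrime _) fun g hg h => hb g hg (by
      rwa [RingHom.mem_ker, map_sub, sub_eq_zero] at h)
  obtain ⟨s, hs, hsx⟩ := exists_mul_mem_map_under hF hΛ Q hQF (x := x) hx
  have key : ∀ z ∈ (Q.under R).map (algebraMap R B), ∃ s : B, ε s ≠ 0 ∧ s * z ∈ I := by
    intro z hz
    refine Submodule.span_induction (p := fun z _ => ∃ s : B, ε s ≠ 0 ∧ s * z ∈ I)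
      ?_ ?_ ?_ ?_ hz
    · rintro _ ⟨y, hy, rfl⟩
      exact hI y hy
    · exact ⟨1, by simp, by simp⟩
    · rintro x y _ _ ⟨s, hs, hsx⟩ ⟨t, ht, hty⟩
      refine ⟨s * t, by simp [hs, ht], ?_⟩
      have : s * t * (x + y) = t * (s * x) + s * (t * y) := by ring
      rw [this]
      exact add_mem (Ideal.mul_mem_left _ _ hsx) (Ideal.mul_mem_left _ _ hty)
    · rintro a x _ ⟨s, hs, hsx⟩
      refine ⟨s, hs, ?_⟩
      rw [smul_eq_mul, mul_left_comm]
      exact Ideal.mul_mem_left _ _ hsx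
  obtain ⟨t, ht, htx⟩ := key _ hsx
  refine ⟨t * s, ?_, by rwa [mul_assoc]⟩
  rw [Subalgebra.coe_mul, map_mul]
  exact mul_ne_zero ht hs

/-- Local generators of the maximal ideal of a rational point generate this ideal modulo its
square. -/
theorem augPart_le_of_local {B : Subalgebra k S} {ε : S →ₐ[k] k} {m : ℕ} (a : Fin m → B)
    (ha : ∀ i, ε (a i) = 0)
    (h : ∀ x : B, ε x = 0 → ∃ s : B, ε s ≠ 0 ∧ s * x ∈ Ideal.span (Set.range a)) :
    augPart ε B ≤ Submodule.span k (Set.range fun i => (a i : S)) ⊔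
      augPart ε B * augPart ε B := by
  rintro x ⟨hxB, hx⟩
  obtain ⟨s, hs, hsx⟩ := h ⟨x, hxB⟩ hx
  obtain ⟨c, hc⟩ := Ideal.mem_span_range_iff_exists_fun.mp hsx
  have hc' : ∑ i, (c i : S) * (a i : S) = s * x := by
    have := congrArg Subtype.val hc
    simpa using this
  have h1 : ε (s : S) • x = ∑ i, ε (c i) • (a i : S) +
      (∑ i, ((c i : S) - algebraMap k S (ε (c i))) * (a i : S) -
        ((s : S) - algebraMap k S (ε s)) * x) := by
    simp only [sub_mul, Finset.sum_sub_distrib, ← Algebra.smul_def, hc']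
    ring
  have h2 : x = (ε (s : S))⁻¹ • (ε (s : S) • x) := by rw [smul_smul, inv_mul_cancel₀ hs, one_smul]
  rw [h2, h1]
  refine Submodule.smul_mem _ _ (Submodule.add_mem_sup (Submodule.sum_mem _ fun i _ =>
    Submodule.smul_mem _ _ (Submodule.subset_span ⟨i, rfl⟩)) (Submodule.sub_mem _ ?_ ?_))
  · exact Submodule.sum_mem _ fun i _ => Submodule.mul_mem_mul
      (sub_algebraMap_mem_augPart (c i).2) ⟨(a i).2, ha i⟩
  · exact Submodule.mul_mem_mul (sub_algebraMap_mem_augPart s.2) ⟨hxB, hx⟩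

end EtalePoints

/-! ### Invariants that separate orbits -/

section Separation

variable {k G V : Type*} [Field k] [Group G] [AddCommGroup V] [Module k V]
  {ρ : Representation k G V}

open SymmetricAlgebra (ι)

/-- A linear form with value `1` at `v` that vanishes at `w`, unless `w` is a multiple of `v`. -/
theorem exists_dual_apply_eq_one (v w : V) (hv : v ≠ 0) :
    ∃ l : Module.Dual k V, l v = 1 ∧ ((∀ c : k, w ≠ c • v) → l w = 0) := by
  by_cases h : ∀ c : k, w ≠ c • v
  · have h1 : v ∉ Submodule.span k {w} := by
      intro hm
      obtain ⟨c, hc⟩ := Submodule.mem_span_singleton.mp hm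
      have hc0 : c ≠ 0 := by rintro rfl; exact hv (by rw [← hc, zero_smul])
      exact h c⁻¹ (by rw [← hc, smul_smul, inv_mul_cancel₀ hc0, one_smul])
    obtain ⟨l, hl, hl'⟩ := Submodule.exists_le_ker_of_notMem h1
    refine ⟨(l v)⁻¹ • l, by simp [hl], fun _ => ?_⟩
    have h2 : l w = 0 := hl' (Submodule.mem_span_singleton_self w)
    simp [h2]
  · obtain ⟨l, hl, -⟩ := Submodule.exists_le_ker_of_notMem (p := (⊥ : Submodule k V)) (v := v)
      (by simpa using hv)
    exact ⟨(l v)⁻¹ • l, by simp [hl], fun h' => absurd h' h⟩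

/-- A homogeneous polynomial with value `1` at `v` that vanishes at the vectors of the orbit of `v`
which are not proportional to `v`. Its degree can be prescribed modulo the order of `G`. -/
theorem exists_homogeneous_interpolation [Finite G] {v : V} (hv : v ≠ 0) (m : ℕ) :
    ∃ e ∈ polyGrading k V (m + Nat.card G), evalAt v e = 1 ∧
      ∀ g, (∀ c : k, ρ g v ≠ c • v) → evalAt (ρ g v) e = 0 := by
  have := Fintype.ofFinite G
  choose l hl hl' using fun g : G => exists_dual_apply_eq_one (k := k) v (ρ g v) hv
  refine ⟨ι k _ (l 1) ^ m * ∏ g, ι k _ (l g), ?_, ?_, fun g hg => ?_⟩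
  · refine SetLike.mul_mem_graded (A := polyGrading k V) ?_ ?_
    · simpa using SetLike.pow_mem_graded (A := polyGrading k V) m (ι_mem_polyGrading (l 1))
    · have h1 := SetLike.prod_mem_graded (polyGrading k V) (fun _ => 1) (fun g => ι k _ (l g))
        (fun g (_ : g ∈ Finset.univ) => ι_mem_polyGrading (l g))
      simpa [Nat.card_eq_fintype_card] using h1
  · simp [hl]
  · rw [map_mul, map_prod, Finset.prod_eq_zero (Finset.mem_univ g), mul_zero]
    rw [evalAt_ι, hl' g hg]

theorem pow_card_eq_one_of_smul {v : V} (hv : v ≠ 0) {g : G} {c : k} (hg : ρ g v = c • v) :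
    c ^ Nat.card G = 1 := by
  have h1 : ∀ n : ℕ, ρ (g ^ n) v = c ^ n • v := by
    intro n
    induction n with
    | zero => simp
    | succ n ih =>
      rw [pow_succ, map_mul, Module.End.mul_apply, hg, map_smul, ih, smul_smul, pow_succ']
  have h2 := h1 (Nat.card G)
  rw [pow_card_eq_one', map_one, Module.End.one_apply] at h2
  have h3 : (c ^ Nat.card G - 1) • v = 0 := by rw [sub_smul, ← h2, one_smul, sub_self]
  exact sub_eq_zero.mp ((smul_eq_zero.mp h3).resolve_right hv)

/-- A homogeneous invariant of the stabiliser `H` of `v` that separates `v` from the rest of its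
orbit. Its degree is congruent to `1` modulo the order of `G`, so that it separates `v` also from
the proportional vectors in the orbit. -/
theorem exists_homogeneous_separating [Finite G] (hG : (Nat.card G : k) ≠ 0) {v : V} (hv : v ≠ 0)
    {H : Subgroup G} (hH : ∀ g, g ∈ H ↔ ρ g v = v) :
    ∃ b ∈ fixedSubalgebra (polyActHom ρ) H, b ∈ polyGrading k V (1 + Nat.card G) ∧
      ∀ g, g ∉ H → evalAt v b ≠ evalAt v (polyActHom ρ g b) := by
  have := Fintype.ofFinite H
  obtain ⟨e, heg, hev, he0⟩ := exists_homogeneous_interpolation (ρ := ρ) hv 1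
  refine ⟨_, sum_mem_fixedSubalgebra (polyActHom ρ) H e,
    Submodule.sum_mem _ fun h _ => polyActHom_mem_polyGrading _ _ _ heg, ?_⟩
  have h1 : evalAt v (∑ h : H, polyActHom ρ h e) = (Nat.card H : k) := by
    rw [map_sum, Finset.sum_congr rfl fun (h : H) _ => ?_, Finset.sum_const, Finset.card_univ,
      nsmul_one, Nat.card_eq_fintype_card]
    rw [evalAt_polyActHom, (hH _).mp (H.inv_mem h.2), hev]
  intro g hg
  rw [evalAt_polyActHom]
  by_cases hc : ∃ c : k, ρ g⁻¹ v = c • v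
  · obtain ⟨c, hc⟩ := hc
    rw [hc, evalAt_smul (n := 1 + Nat.card G)
      (Submodule.sum_mem _ fun h _ => polyActHom_mem_polyGrading _ _ _ heg), pow_add, pow_one,
      pow_card_eq_one_of_smul hv hc, mul_one, h1]
    intro h2
    have h3 : c = 1 := by
      have := mul_right_cancel₀ (natCast_card_subgroup_ne_zero hG H) ((one_mul _).trans h2)
      exact this.symm
    rw [h3, one_smul, ← hH] at hc
    exact hg (by simpa using H.inv_mem hc)
  · rw [h1, map_sum, Finset.sum_eq_zero fun (h : H) _ => ?_]
    · exact natCast_card_subgroup_ne_zero hG H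
    rw [evalAt_polyActHom]
    have h2 : ρ (h : G)⁻¹ (ρ g⁻¹ v) = ρ ((h : G)⁻¹ * g⁻¹) v := by rw [map_mul]; rfl
    rw [h2]
    apply he0
    intro c h3
    apply hc
    refine ⟨c, ?_⟩
    have h4 : ρ (h : G) (ρ (h : G)⁻¹ (ρ g⁻¹ v)) = ρ g⁻¹ v := by simp
    rw [← h4, h2, h3, map_smul, (hH _).mp h.2]

/-- An invariant of `W` that vanishes on the rest of the `H`-orbit of `w`, but not on the `W`-orbit,
if `W` contains the stabiliser of `w` in `H`. -/
theorem exists_separating [Finite G] [Infinite k] {W H : Subgroup G} {w : V}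
    (hw : ∀ h ∈ H, ρ h w = w → h ∈ W) (hWH : W ≤ H) :
    ∃ b ∈ fixedSubalgebra (polyActHom ρ) W, evalAt w b ≠ 0 ∧
      ∀ h ∈ H, h ∉ W → evalAt w (polyActHom ρ h b) = 0 := by
  classical
  have := Fintype.ofFinite G
  have := Fintype.ofFinite W
  obtain ⟨ξ, hξ⟩ := Module.exists_dual_forall_apply_ne_zero (K := k)
    (fun p : {p : G × G // ρ p.1 w ≠ ρ p.2 w} => ρ p.1.1 w - ρ p.1.2 w)
    (fun p => sub_ne_zero.mpr p.2)
  let e : PolyRing k V := ∏ h ∈ Finset.univ.filter (fun h => h ∈ H ∧ h ∉ W),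
    (ι k _ ξ - algebraMap k _ (ξ (ρ h w)))
  have he : ∀ y, evalAt y e = ∏ h ∈ Finset.univ.filter (fun h => h ∈ H ∧ h ∉ W),
      (ξ y - ξ (ρ h w)) := by
    intro y
    simp [e, map_prod]
  refine ⟨_, prod_mem_fixedSubalgebra (polyActHom ρ) W e, ?_, fun h hH hhW => ?_⟩
  · rw [map_prod, Finset.prod_ne_zero_iff]
    intro x _
    rw [evalAt_polyActHom, he, Finset.prod_ne_zero_iff]
    intro h hh
    obtain ⟨hH, hhW⟩ := (Finset.mem_filter.mp hh).2
    rw [← map_sub]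
    refine hξ ⟨((x : G)⁻¹, h), fun heq => hhW ?_⟩
    have h1 : ρ ((x : G) * h) w = w := by
      rw [map_mul, Module.End.mul_apply, ← heq]
      simp
    have h2 := hw _ (H.mul_mem (hWH x.2) hH) h1
    simpa using W.mul_mem (W.inv_mem x.2) h2
  · rw [evalAt_polyActHom, map_prod]
    refine Finset.prod_eq_zero (Finset.mem_univ (1 : W)) ?_
    rw [evalAt_polyActHom, he]
    refine Finset.prod_eq_zero (i := h⁻¹) (Finset.mem_filter.mpr
      ⟨Finset.mem_univ _, H.inv_mem hH, fun h1 => hhW (by simpa using W.inv_mem h1)⟩) ?_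
    simp

end Separation

end GradedInvariants

namespace GradedInvariants

open MvPolynomial

/-! ### The Jacobian of one system of invariants with respect to another -/

section Jacobian

variable {k S : Type*} [Field k] [CommRing S] [Algebra k S] {r : ℕ} {g : Fin r → S}
  {ε : S →ₐ[k] k}

theorem augmentation_aeval (P : MvPolynomial (Fin r) k) :
    ε (aeval g P) = aeval (fun j => ε (g j)) P := by
  rw [← AlgHom.comp_apply, comp_aeval]

/-- If the functions `Pᵢ(g)` generate the maximal ideal of a point locally in the polynomial ring
`k[g]`, their Jacobian with respect to `g` does not vanish at this point. -/
theorem augmentation_det_pderiv_ne_zero (hg : AlgebraicIndependent k g)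
    {P : Fin r → MvPolynomial (Fin r) k} {B : Subalgebra k S}
    (hB : Algebra.adjoin k (Set.range g) = B) {a : Fin r → B}
    (ha : ∀ i, (a i : S) = aeval g (P i) - algebraMap k S (ε (aeval g (P i))))
    (h : ∀ x : B, ε x = 0 → ∃ s : B, ε s ≠ 0 ∧ s * x ∈ Ideal.span (Set.range a)) :
    ε (aeval g (Matrix.det (Matrix.of fun i j => pderiv j (P i)))) ≠ 0 := by
  classical
  set γ : Fin r → k := fun j => ε (g j)
  have hrep : ∀ x : B, ∃ p : MvPolynomial (Fin r) k, aeval g p = x := by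
    rintro ⟨x, hx⟩
    rw [← hB, Algebra.adjoin_range_eq_range_aeval] at hx
    exact hx
  have hgB : ∀ j, g j ∈ B := fun j => hB ▸ Algebra.subset_adjoin ⟨j, rfl⟩
  have key : ∀ j, ∃ (s : MvPolynomial (Fin r) k) (c : Fin r → MvPolynomial (Fin r) k),
      aeval γ s ≠ 0 ∧ s * (X j - C (γ j)) = ∑ i, c i * (P i - C (aeval γ (P i))) := by
    intro j
    obtain ⟨s, hs, hsx⟩ := h ⟨g j - algebraMap k S (γ j), sub_mem (hgB j) (B.algebraMap_mem _)⟩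
      (by simp [γ])
    obtain ⟨c, hc⟩ := Ideal.mem_span_range_iff_exists_fun.mp hsx
    obtain ⟨s', hs'⟩ := hrep s
    choose c' hc' using fun i => hrep (c i)
    refine ⟨s', c', ?_, hg ?_⟩
    · rw [← augmentation_aeval, hs']
      exact hs
    · have h1 := congrArg Subtype.val hc
      simp only [AddSubmonoidClass.coe_finsetSum, Subalgebra.coe_mul, ha] at h1
      simp only [map_mul, map_sub, map_sum, aeval_X, hs', hc', ← algebraMap_eq, AlgHom.commutes,
        show ∀ p, aeval γ p = ε (aeval g p) from fun p => (augmentation_aeval p).symm, h1]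
  choose s c hs hc using key
  have hmat : (Matrix.diagonal fun j => aeval γ (s j)) =
      (Matrix.of fun j i => aeval γ (c j i)) * (Matrix.of fun i l => aeval γ (pderiv l (P i))) := by
    ext j l
    have h1 := congrArg (fun q => aeval γ (pderiv l q)) (hc j)
    simp only [map_sum, Derivation.leibniz, map_add, map_sub, pderiv_C, smul_eq_mul, map_mul,
      aeval_X, aeval_C, Algebra.algebraMap_self, RingHom.id_apply, sub_self, zero_mul, sub_zero,
      add_zero, pderiv_X] at h1
    rw [Matrix.mul_apply, Matrix.diagonal_apply]
    simp only [Matrix.of_apply]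
    rw [← h1]
    by_cases hjl : j = l
    · subst hjl; simp
    · simp [hjl]
  have hdet := congrArg Matrix.det hmat
  rw [Matrix.det_diagonal, Matrix.det_mul] at hdet
  have h2 : (Matrix.of fun i l => aeval γ (pderiv l (P i))).det ≠ 0 := by
    intro h0
    rw [h0, mul_zero] at hdet
    exact Finset.prod_ne_zero_iff.mpr (fun j _ => hs j) hdet
  rw [augmentation_aeval, AlgHom.map_det]
  exact h2

/-- The Taylor expansion to first order. -/
theorem aeval_sub_sum_mem {B : Subalgebra k S} (hg : ∀ j, g j ∈ augPart ε B)
    (P : MvPolynomial (Fin r) k) :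
    aeval g P - algebraMap k S (ε (aeval g P)) - ∑ j, ε (aeval g (pderiv j P)) • g j ∈
      augPart ε B * augPart ε B := by
  classical
  have hB : ∀ P : MvPolynomial (Fin r) k, aeval g P ∈ B := by
    intro P
    have h1 : Algebra.adjoin k (Set.range g) ≤ B := Algebra.adjoin_le (by
      rintro _ ⟨j, rfl⟩
      exact (hg j).1)
    rw [Algebra.adjoin_range_eq_range_aeval] at h1
    exact h1 ⟨P, rfl⟩
  have hε : ∀ j, ε (g j) = 0 := fun j => (hg j).2
  induction P using MvPolynomial.induction_on with
  | C a =>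
    simp [zero_mem]
  | add p q hp hq =>
    have h1 := add_mem hp hq
    simp only [map_add, add_smul, Finset.sum_add_distrib] at h1 ⊢
    convert h1 using 1
    ring
  | mul_X p i hp =>
    have h1 : ∑ j, ε (aeval g (pderiv j (p * X i))) • g j = ε (aeval g p) • g i := by
      rw [Finset.sum_eq_single i]
      · simp [Derivation.leibniz, hε]
      · intro j _ hj
        simp [Derivation.leibniz, hε, pderiv_X_of_ne (Ne.symm hj)]
      · simp
    rw [h1, map_mul, aeval_X, map_mul, hε, mul_zero, map_zero, sub_zero, Algebra.smul_def,
      ← sub_mul]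
    exact Submodule.mul_mem_mul (sub_algebraMap_mem_augPart (hB p)) (hg i)

/-- If the Jacobian of `P(g)` with respect to `g` does not vanish at the augmentation, the
`Pᵢ(g)` generate the augmentation ideal modulo its square. -/
theorem augPart_le_of_det_ne_zero {B : Subalgebra k S}
    (hB : Algebra.adjoin k (Set.range g) = B) (hg : ∀ j, ε (g j) = 0)
    {P : Fin r → MvPolynomial (Fin r) k} (hP : ∀ i, ε (aeval g (P i)) = 0)
    (hdet : ε (aeval g (Matrix.det (Matrix.of fun i j => pderiv j (P i)))) ≠ 0) :
    augPart ε B ≤ Submodule.span k (Set.range fun i => aeval g (P i)) ⊔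
      augPart ε B * augPart ε B := by
  classical
  have hgB : ∀ j, g j ∈ augPart ε B := fun j => ⟨hB ▸ Algebra.subset_adjoin ⟨j, rfl⟩, hg j⟩
  set N := Submodule.span k (Set.range fun i => aeval g (P i)) ⊔ augPart ε B * augPart ε B
  let J : Matrix (Fin r) (Fin r) k := Matrix.of fun i j => ε (aeval g (pderiv j (P i)))
  have hJ : IsUnit J.det := by
    have h1 : J.det = ε (aeval g (Matrix.det (Matrix.of fun i j => pderiv j (P i)))) := by
      rw [AlgHom.map_det, AlgHom.map_det]
      rfl
    rw [h1]
    exact hdet.isUnit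
  have h1 : ∀ i, ∑ j, J i j • g j ∈ N := by
    intro i
    have h2 := aeval_sub_sum_mem hgB (P i)
    rw [hP, map_zero, sub_zero] at h2
    have h3 : aeval g (P i) ∈ N :=
      Submodule.mem_sup_left (Submodule.subset_span ⟨i, rfl⟩)
    have h4 := sub_mem h3 (Submodule.mem_sup_right h2)
    rwa [sub_sub_cancel] at h4
  have h2 : ∀ l, g l ∈ N := by
    intro l
    have h3 : g l = ∑ i, J⁻¹ l i • ∑ j, J i j • g j := by
      have h4 : ∑ i, J⁻¹ l i • ∑ j, J i j • g j = ∑ j, (J⁻¹ * J) l j • g j := by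
        simp only [Finset.smul_sum, Matrix.mul_apply, Finset.sum_smul, smul_smul]
        rw [Finset.sum_comm]
      rw [h4, Matrix.nonsing_inv_mul _ hJ]
      simp [Matrix.one_apply]
    rw [h3]
    exact Submodule.sum_mem _ fun i _ => Submodule.smul_mem _ _ (h1 i)
  have h3 := augPart_adjoin_le (ε := ε) (Set.range g)
  rw [hB] at h3
  refine h3.trans (sup_le (Submodule.span_le.mpr ?_) le_sup_right)
  rintro _ ⟨_, ⟨j, rfl⟩, rfl⟩
  simpa [hg] using h2 j

end Jacobian

/-! ### Rings of invariants with few generators -/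

section FewGenerators

variable {k G V : Type*} [Field k] [Group G] [Finite G] [AddCommGroup V] [Module k V]
  {ρ : Representation k G V}

/-- The elements of `H` outside its reflection subgroup fix only subspaces of codimension at least
two, and a general plane meets all these subspaces in the origin only. -/
theorem exists_plane [Infinite k] [FiniteDimensional k V] {H : Subgroup G}
    (hne : reflectionSubgroup ρ H ≠ H) :
    ∃ x y : V, ∀ a b : k, a ≠ 0 ∨ b ≠ 0 →
      ∀ h ∈ H, ρ h (a • x + b • y) = a • x + b • y → h ∈ reflectionSubgroup ρ H := by
  let I := {h : G // h ∈ H ∧ h ∉ reflectionSubgroup ρ H}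
  have hI : Nonempty I := by
    by_contra hcon
    refine hne (le_antisymm (reflectionSubgroup_le H) fun h hh => ?_)
    by_contra h0
    exact hcon ⟨⟨h, hh, h0⟩⟩
  let F : I → Submodule k V := fun h => LinearMap.ker (ρ h.1 - 1)
  have hF : ∀ h : I, ∀ x, x ∈ F h ↔ ρ h.1 x = x := fun h x => by
    simp [F, LinearMap.mem_ker, sub_eq_zero]
  -- The fixed spaces have codimension at least two.
  have hrank : ∀ h : I, Module.finrank k (F h) + 2 ≤ Module.finrank k V := by
    intro h
    have h1 := LinearMap.finrank_range_add_finrank_ker (ρ h.1 - 1)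
    have h2 : Module.finrank k (LinearMap.range (ρ h.1 - 1)) ≠ 0 := by
      intro h0
      rw [Submodule.finrank_eq_zero, LinearMap.range_eq_bot, sub_eq_zero] at h0
      exact h.2.2 (mem_reflectionSubgroup h.2.1 (Or.inl h0))
    have h3 : Module.finrank k (LinearMap.range (ρ h.1 - 1)) ≠ 1 := fun h0 =>
      h.2.2 (mem_reflectionSubgroup h.2.1 (Or.inr h0))
    change _ + Module.finrank k (F h) = _ at h1
    omega
  obtain ⟨x, hx⟩ := Submodule.exists_forall_notMem_of_forall_ne_top F fun h h0 => by
    have h1 := hrank h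
    rw [h0, finrank_top] at h1
    omega
  obtain ⟨y, hy⟩ := Submodule.exists_forall_notMem_of_forall_ne_top
    (fun h => F h ⊔ Submodule.span k {x}) fun h h0 => by
      have h1 := hrank h
      have h2 := Submodule.finrank_add_le_finrank_add_finrank (F h) (Submodule.span k {x})
      rw [h0, finrank_top] at h2
      have h3 := finrank_span_le_card (R := k) ({x} : Set V)
      rw [Set.toFinset_singleton, Finset.card_singleton] at h3
      omega
  refine ⟨x, y, fun a b hab h hh hfix => ?_⟩
  by_contra hW
  let i : I := ⟨h, hh, hW⟩
  have h1 : a • x + b • y ∈ F i := (hF i _).mpr hfix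
  have hb : b = 0 := by
    by_contra hb
    refine hy i ?_
    have h2 : y = b⁻¹ • ((a • x + b • y) - a • x) := by
      rw [add_sub_cancel_left, smul_smul, inv_mul_cancel₀ hb, one_smul]
    rw [h2]
    exact Submodule.smul_mem _ _ (Submodule.sub_mem _ (Submodule.mem_sup_left h1)
      (Submodule.mem_sup_right (Submodule.smul_mem _ _ (Submodule.mem_span_singleton_self x))))
  have ha : a ≠ 0 := by simpa [hb] using hab
  rw [hb, zero_smul, add_zero] at h1
  exact hx i (((F i).smul_mem_iff ha).mp h1)

/-- If the ring of invariants of `H` is generated by as many homogeneous elements as the ring of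
invariants of its reflection subgroup, then `H` is generated by reflections: outside a union of
subspaces of codimension two the extension is étale, so the Jacobian has no zeros there, and hence
no zeros at all. -/
theorem reflectionSubgroup_eq_of_generators [IsAlgClosed k] [FiniteDimensional k V]
    {H : Subgroup G} {r : ℕ} {g : Fin r → PolyRing k V}
    (hgn : ∀ i, ∃ n, 0 < n ∧ g i ∈ polyGrading k V n) (hg : AlgebraicIndependent k g)
    (hgadj : Algebra.adjoin k (Set.range g) =
      fixedSubalgebra (polyActHom ρ) (reflectionSubgroup ρ H))
    {f : Fin r → PolyRing k V} (hfn : ∀ i, ∃ n, 0 < n ∧ f i ∈ polyGrading k V n)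
    (hfadj : Algebra.adjoin k (Set.range f) = fixedSubalgebra (polyActHom ρ) H) :
    reflectionSubgroup ρ H = H := by
  by_contra hne
  have : Infinite k := IsAlgClosed.instInfinite
  set W := reflectionSubgroup ρ H with hWdef
  have hWH : W ≤ H := reflectionSubgroup_le H
  set B := fixedSubalgebra (polyActHom ρ) W
  set R := fixedSubalgebra (polyActHom ρ) H
  have hRB : R ≤ B := fun x hx w hw => hx w (hWH hw)
  have hfR : ∀ i, f i ∈ R := fun i => hfadj ▸ Algebra.subset_adjoin ⟨i, rfl⟩
  have hfP : ∀ i, ∃ P : MvPolynomial (Fin r) k, aeval g P = f i := by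
    intro i
    have h1 := hRB (hfR i)
    rw [← hgadj, Algebra.adjoin_range_eq_range_aeval] at h1
    exact h1
  choose P hP using hfP
  have hg0 : ∀ i, evalAt (k := k) (0 : V) (g i) = 0 := fun i => by
    obtain ⟨n, hn, h⟩ := hgn i
    exact evalAt_zero_of_mem hn h
  have hf0 : ∀ i, evalAt (k := k) (0 : V) (f i) = 0 := fun i => by
    obtain ⟨n, hn, h⟩ := hfn i
    exact evalAt_zero_of_mem hn h
  set D := aeval g (Matrix.det (Matrix.of fun i j => pderiv j (P i))) with hD
  have hDw : ∀ w : V, (∀ h ∈ H, ρ h w = w → h ∈ W) → evalAt w D ≠ 0 := by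
    intro w hw
    obtain ⟨b, hbB, hb, hb'⟩ := exists_separating hw hWH
    let a : Fin r → B := fun i => ⟨f i - algebraMap k _ (evalAt w (f i)),
      sub_mem (hRB (hfR i)) (B.algebraMap_mem _)⟩
    refine augmentation_det_pderiv_ne_zero hg hgadj (a := a) (fun i => by rw [hP]) ?_
    refine exists_mul_mem_of_separating (φ := (polyActHom ρ).comp H.subtype) (K := W.subgroupOf H)
      hRB (fun x => ⟨fun h g => h g g.2, fun h g hg => h ⟨g, hg⟩⟩)
      (fun x => ⟨fun h g hg => h g (Subgroup.mem_subgroupOf.mp hg), fun h g hg =>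
        h ⟨g, hWH hg⟩ (Subgroup.mem_subgroupOf.mpr hg)⟩) (evalAt w) hbB
      (fun h hh => ?_) _ (fun y hy => ⟨1, by simp, ?_⟩)
    · rw [MonoidHom.comp_apply, Subgroup.subtype_apply,
        hb' h h.2 (fun h' => hh (Subgroup.mem_subgroupOf.mpr h'))]
      exact hb
    · have hy' : (y : PolyRing k V) ∈ Algebra.adjoin k (Set.range f) := by
        rw [hfadj]; exact y.2
      obtain ⟨c, hc, hyc⟩ := exists_sum_mul_sub_of_mem_adjoin (evalAt w) f hy'
      rw [hy, map_zero, sub_zero] at hyc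
      rw [one_mul, Ideal.mem_span_range_iff_exists_fun]
      refine ⟨fun i => ⟨c i, hRB (hfadj ▸ hc i)⟩, Subtype.ext ?_⟩
      simp only [AddSubmonoidClass.coe_finsetSum, Subalgebra.coe_mul]
      exact hyc.symm
  obtain ⟨x, y, hxy⟩ := exists_plane hne
  have hD0 : evalAt 0 D ≠ 0 := evalAt_zero_ne_zero x y D fun a b hab => hDw _ (hxy a b hab)
  have hle := augPart_le_of_det_ne_zero hgadj hg0 (P := P) (fun i => by rw [hP, hf0]) hD0
  have hBR : B ≤ R := by
    rw [← hfadj]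
    refine le_adjoin_of_augPart_le (𝒜 := polyGrading k V) (ε := evalAt 0)
      (fun x hx => mem_range_algebraMap_of_mem_polyGrading_zero hx)
      (fun n hn x hx => evalAt_zero_of_mem hn hx) (fun x hx n => proj_mem_fixedSubalgebra hx n)
      (fun e he => ?_) ?_
    · obtain ⟨i, rfl⟩ := he
      obtain ⟨n, -, h⟩ := hfn i
      exact ⟨n, h⟩
    · simpa only [hP] using hle
  refine hne (le_antisymm hWH fun h hh => ?_)
  by_contra hhW
  -- Equal rings of invariants cannot separate the orbits of `W` in an orbit of `H`.
  have hx := hxy 1 0 (Or.inl one_ne_zero)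
  obtain ⟨b, hbB, hb, hb'⟩ := exists_separating hx hWH
  have h1 := hb' h hh hhW
  rw [hBR hbB h hh] at h1
  exact hb h1

end FewGenerators

end GradedInvariants

namespace GradedInvariants

/-! ### Regularity and localisation -/

section Localisation

variable {R : Type*} [CommRing R] (M : Submonoid R)

theorem isRegularLocalRing_localization_iff (P' : Ideal (Localization M)) [P'.IsPrime] :
    IsRegularLocalRing (Localization.AtPrime P') ↔
      IsRegularLocalRing (Localization.AtPrime (P'.under R)) := by
  have h1 : IsLocalization.AtPrime (Localization.AtPrime P') (P'.under R) :=
    IsLocalization.isLocalization_isLocalization_atPrime_isLocalization M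
      (Localization.AtPrime P') P'
  let e := IsLocalization.algEquiv (P'.under R).primeCompl (Localization.AtPrime P')
    (Localization.AtPrime (P'.under R))
  exact ⟨fun _ => .of_ringEquiv e.toRingEquiv, fun _ => .of_ringEquiv e.toRingEquiv.symm⟩

theorem isRegularLocalRing_congr {P Q : Ideal R} [P.IsPrime] [Q.IsPrime] (h : P = Q)
    [IsRegularLocalRing (Localization.AtPrime P)] :
    IsRegularLocalRing (Localization.AtPrime Q) := by
  subst h
  infer_instance

theorem isRegularLocalRing_of_isRegularRing_localization [IsRegularRing (Localization M)]
    (P : Ideal R) [hP : P.IsPrime] (h : M ≤ P.primeCompl) :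
    IsRegularLocalRing (Localization.AtPrime P) := by
  have hd : Disjoint (M : Set R) P := Set.disjoint_left.mpr fun x hx hxP => h hx hxP
  have := IsLocalization.isPrime_of_isPrime_disjoint M (Localization M) P hP hd
  have h1 := (isRegularLocalRing_localization_iff M (P.map (algebraMap R (Localization M)))).mp
    inferInstance
  exact isRegularLocalRing_congr
    (IsLocalization.under_map_of_isPrime_disjoint M (Localization M) hP hd)

theorem isRegularRing_localization [IsNoetherianRing R]
    (h : ∀ (P : Ideal R) [P.IsPrime], M ≤ P.primeCompl →
      IsRegularLocalRing (Localization.AtPrime P)) : IsRegularRing (Localization M) := by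
  have : IsNoetherianRing (Localization M) := IsLocalization.isNoetherianRing M _ inferInstance
  refine ⟨fun P' hP' => ?_⟩
  rw [isRegularLocalRing_localization_iff]
  refine h _ fun x hx hxP => ?_
  exact Set.disjoint_left.mp
    ((IsLocalization.isPrime_iff_isPrime_disjoint M (Localization M) P').mp hP').2 hx hxP

end Localisation

/-! ### Regularity implies generation by reflections -/

section Forward

variable {k G V : Type*} [Field k] [Group G] [AddCommGroup V] [Module k V]
  {ρ : Representation k G V}

theorem isIntegral_invariantRing [Finite G] :
    Algebra.IsIntegral (invariantRing ρ) (PolyRing k V) := by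
  have h1 := isIntegral_fixedSubalgebra (polyActHom ρ) ⊤
  rw [← invariantRing_eq] at h1
  exact h1

theorem isNoetherianRing_invariantRing [Finite G] [FiniteDimensional k V] :
    IsNoetherianRing (invariantRing ρ) := by
  have h1 := fixedSubalgebra_fg (polyActHom ρ) ⊤
  rw [← invariantRing_eq] at h1
  have : Algebra.FiniteType k (invariantRing ρ) := ⟨(Subalgebra.fg_top _).mpr h1⟩
  exact Algebra.FiniteType.isNoetherianRing k _

theorem isIntegral_inclusion {S : Type*} [CommRing S] [Algebra k S] {R B : Subalgebra k S}
    (h : R ≤ B) [Algebra.IsIntegral R S] :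
    (Subalgebra.inclusion h).toRingHom.IsIntegral := by
  let _ : Algebra R B := (Subalgebra.inclusion h).toRingHom.toAlgebra
  have : IsScalarTower R B S := .of_algebraMap_eq fun _ => rfl
  exact fun x => IsIntegral.tower_bot (A := B) (B := S) Subtype.val_injective
    (Algebra.IsIntegral.isIntegral (R := R) (x : S))

theorem ringKrullDim_adjoin_le {S : Type*} [CommRing S] [Algebra k S] {r : ℕ} {g : Fin r → S}
    (hg : AlgebraicIndependent k g) {B : Subalgebra k S}
    (hB : Algebra.adjoin k (Set.range g) = B) : ringKrullDim B ≤ r := by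
  subst hB
  rw [← ringKrullDim_eq_of_ringEquiv hg.aevalEquiv.toRingEquiv,
    MvPolynomial.ringKrullDim_of_isNoetherianRing, ringKrullDim_eq_zero_of_field, zero_add,
    Nat.card_fin]

/-- Translating the point `v` to the origin. -/
theorem augPart_zero_le_of_augPart {K : Subgroup G} {v : V} (hK : ∀ g ∈ K, ρ g v = v) {m : ℕ}
    {a : Fin m → PolyRing k V}
    (h : augPart (evalAt v) (fixedSubalgebra (polyActHom ρ) K) ≤ Submodule.span k (Set.range a) ⊔
      augPart (evalAt v) (fixedSubalgebra (polyActHom ρ) K) *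
        augPart (evalAt v) (fixedSubalgebra (polyActHom ρ) K)) :
    augPart (evalAt 0) (fixedSubalgebra (polyActHom ρ) K) ≤
      Submodule.span k (Set.range fun i => translate v (a i)) ⊔
        augPart (evalAt 0) (fixedSubalgebra (polyActHom ρ) K) *
          augPart (evalAt 0) (fixedSubalgebra (polyActHom ρ) K) := by
  have hmap : (augPart (evalAt v) (fixedSubalgebra (polyActHom ρ) K)).map
      (translate v).toLinearMap ≤ augPart (evalAt 0) (fixedSubalgebra (polyActHom ρ) K) := by
    rintro _ ⟨x, ⟨hxB, hx⟩, rfl⟩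
    refine ⟨translate_mem_fixedSubalgebra hK hxB, ?_⟩
    change evalAt 0 (translate v x) = 0
    rw [evalAt_translate, zero_add]
    exact hx
  rintro x ⟨hxB, hx⟩
  have hK' : ∀ g ∈ K, ρ g (-v) = -v := fun g hg => by rw [map_neg, hK g hg]
  have h1 : translate (-v) x ∈ augPart (evalAt v) (fixedSubalgebra (polyActHom ρ) K) := by
    refine ⟨translate_mem_fixedSubalgebra hK' hxB, ?_⟩
    change evalAt v (translate (-v) x) = 0
    rw [evalAt_translate, add_neg_cancel]
    exact hx
  have h2 := Submodule.mem_map_of_mem (f := (translate v).toLinearMap) (h h1)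
  rw [AlgHom.toLinearMap_apply, translate_translate_neg, Submodule.map_sup, Submodule.map_span,
    ← Set.range_comp, Submodule.map_mul] at h2
  exact sup_le_sup_left (mul_le_mul' hmap hmap) _ h2

/-- If the homogeneous localisation is regular at the line of `v`, the stabiliser of `v` is generated
by reflections. -/
theorem reflectionSubgroup_eq_of_isRegularRing [Finite G] [IsAlgClosed k] [FiniteDimensional k V]
    (hG : (Nat.card G : k) ≠ 0) {v : V} (hv : v ≠ 0) {H : Subgroup G}
    (hH : ∀ g, g ∈ H ↔ ρ g v = v) (q : Ideal (invariantRing ρ)) [q.IsPrime]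
    (hq : ∀ n, ∀ x ∈ invariantGrading ρ n, evalAt v (x : PolyRing k V) = 0 → x ∈ q)
    [IsRegularRing (GradedLocalisation (invariantGrading ρ) q)] :
    reflectionSubgroup ρ H = H := by
  have : Nontrivial V := ⟨v, 0, hv⟩
  obtain ⟨r, g, hgn, hg, hgadj⟩ := exists_generators_fixedSubalgebra_closure hG
    (T := H ∩ reflectionSet ρ) Set.inter_subset_right
  let P : Ideal (invariantRing ρ) := RingHom.ker ((evalAt v).comp (invariantRing ρ).val)
  have hPp : P.IsPrime := RingHom.ker_isPrime _
  have hreg : IsRegularLocalRing (Localization.AtPrime P) := by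
    refine isRegularLocalRing_of_isRegularRing_localization
      (homogeneousPrimeCompl (invariantGrading ρ) q) P ?_
    rintro x ⟨⟨n, hn⟩, hx⟩ hxP
    exact hx (hq n x hn hxP)
  have := isIntegral_invariantRing (ρ := ρ)
  have hheight : P.height ≤ r := by
    have hle := invariantRing_le (ρ := ρ) (Subgroup.closure (H ∩ reflectionSet ρ))
    let _ : Algebra (invariantRing ρ)
        (fixedSubalgebra (polyActHom ρ) (Subgroup.closure (H ∩ reflectionSet ρ))) :=
      (Subalgebra.inclusion hle).toRingHom.toAlgebra
    have : Algebra.IsIntegral (invariantRing ρ)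
        (fixedSubalgebra (polyActHom ρ) (Subgroup.closure (H ∩ reflectionSet ρ))) :=
      ⟨isIntegral_inclusion hle⟩
    exact height_le_of_ringKrullDim_le (Subalgebra.inclusion_injective hle) P
      (ringKrullDim_adjoin_le hg hgadj)
  obtain ⟨a, haP, ha⟩ := exists_fin_generators_of_isRegularLocalRing P hheight
  obtain ⟨b, hbB, -, hb⟩ := exists_homogeneous_separating hG hv hH
  set B := fixedSubalgebra (polyActHom ρ) H
  have hle : invariantRing ρ ≤ B := invariantRing_le H
  have hlocal := exists_mul_mem_of_separating (φ := polyActHom ρ) (K := H) hle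
    (fun x => mem_invariantRing) (fun x => Iff.rfl) (evalAt v) hbB hb
    (Ideal.span (Set.range fun i => Subalgebra.inclusion hle (a i))) (fun y hy => by
      obtain ⟨s, hs, hsy⟩ := ha y hy
      refine ⟨Subalgebra.inclusion hle s, hs, ?_⟩
      rw [← map_mul]
      have h1 := Ideal.mem_map_of_mem (Subalgebra.inclusion hle) hsy
      rw [Ideal.map_span, ← Set.range_comp] at h1
      exact h1)
  have haug := augPart_zero_le_of_augPart (fun g hg => (hH g).mp hg)
    (augPart_le_of_local (fun i => Subalgebra.inclusion hle (a i)) (fun i => haP i) hlocal)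
  obtain ⟨m, f, hmr, -, hfn, -, hfadj⟩ := exists_minimal_generators (𝒜 := polyGrading k V)
    (fun x hx => mem_range_algebraMap_of_mem_polyGrading_zero hx)
    (fun n hn x hx => evalAt_zero_of_mem hn hx)
    (fun x hx n => proj_mem_fixedSubalgebra hx n) _ haug
  -- If there are fewer generators than `r`, zeros are added.
  refine reflectionSubgroup_eq_of_generators hgn hg hgadj
    (f := fun i => if h : (i : ℕ) < m then f ⟨i, h⟩ else 0) (fun i => ?_) ?_
  · split_ifs
    · exact hfn _
    · exact ⟨1, one_pos, zero_mem _⟩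
  · rw [← hfadj]
    refine le_antisymm (Algebra.adjoin_le ?_) (Algebra.adjoin_mono ?_)
    · rintro _ ⟨i, rfl⟩
      dsimp only
      split_ifs
      · exact Algebra.subset_adjoin ⟨_, rfl⟩
      · exact zero_mem _
    · rintro _ ⟨i, rfl⟩
      exact ⟨⟨i, i.2.trans_le hmr⟩, by simp⟩

end Forward

/-! ### Generation by reflections implies regularity -/

section Backward

variable {k G V : Type*} [Field k] [Group G] [AddCommGroup V] [Module k V]
  {ρ : Representation k G V}

/-- The stabiliser of the line spanned by `v`. -/
def lineStabiliser (ρ : Representation k G V) (v : V) : Subgroup G where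
  carrier := {g | ∃ c : k, ρ g v = c • v}
  one_mem' := ⟨1, by simp⟩
  mul_mem' := by
    rintro g h ⟨c, hc⟩ ⟨d, hd⟩
    exact ⟨d * c, by rw [map_mul, Module.End.mul_apply, hd, map_smul, hc, smul_smul]⟩
  inv_mem' := by
    rintro g ⟨c, hc⟩
    have h1 : v = c • ρ g⁻¹ v := by rw [← map_smul, ← hc]; simp
    by_cases hc0 : c = 0
    · rw [hc0, zero_smul] at h1
      exact ⟨0, by rw [h1]; simp⟩
    · refine ⟨c⁻¹, ?_⟩
      conv_rhs => rw [h1]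
      rw [smul_smul, inv_mul_cancel₀ hc0, one_smul]

theorem mem_lineStabiliser {v : V} {g : G} :
    g ∈ lineStabiliser ρ v ↔ ∃ c : k, ρ g v = c • v := Iff.rfl

/-- A homogeneous polynomial that does not vanish at `v` has a conjugate outside any prime of `k[V]`
all of whose homogeneous invariants vanish at `v`. -/
theorem exists_map_notMem [Finite G] (hG : (Nat.card G : k) ≠ 0) {v : V} (hv : v ≠ 0)
    (Q : Ideal (PolyRing k V))
    (hQ : ∀ n, ∀ x ∈ polyGrading k V n, x ∈ invariantRing ρ → x ∈ Q → evalAt v x = 0)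
    {d : ℕ} {δ : PolyRing k V} (hδ : δ ∈ polyGrading k V d) (hδv : evalAt v δ ≠ 0) :
    ∃ g, polyActHom ρ g δ ∉ Q := by
  classical
  have := Fintype.ofFinite G
  by_contra! hcon
  -- The degree of `δ * e` is divisible by the order of `G`.
  obtain ⟨e, heg, hev, he0⟩ := exists_homogeneous_interpolation (ρ := ρ) hv (d * (Nat.card G - 1))
  have hdeg : d + (d * (Nat.card G - 1) + Nat.card G) = Nat.card G * (d + 1) := by
    obtain ⟨n, hn⟩ := Nat.exists_eq_succ_of_ne_zero (Nat.card_pos (α := G)).ne'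
    rw [hn, Nat.succ_sub_one, Nat.succ_eq_add_one]
    ring
  have hδe : δ * e ∈ polyGrading k V (Nat.card G * (d + 1)) :=
    hdeg ▸ SetLike.mul_mem_graded hδ heg
  have h1 : evalAt v (∑ g, polyActHom ρ g (δ * e)) = 0 := by
    refine hQ _ _ (Submodule.sum_mem _ fun g _ => polyActHom_mem_polyGrading g _ _ hδe) ?_ ?_
    · rw [mem_invariantRing]
      intro h
      rw [map_sum]
      refine Fintype.sum_equiv (Equiv.mulLeft h) _ _ fun g => ?_
      rw [Equiv.coe_mulLeft, map_mul_apply']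
    · refine Ideal.sum_mem _ fun g _ => ?_
      rw [map_mul]
      exact Ideal.mul_mem_right _ _ (hcon g)
  have h2 : ∀ g, evalAt v (polyActHom ρ g (δ * e)) =
      if g ∈ lineStabiliser ρ v then evalAt v δ else 0 := by
    intro g
    rw [evalAt_polyActHom, ← inv_mem_iff, mem_lineStabiliser]
    split_ifs with h
    · obtain ⟨c, hc⟩ := h
      rw [hc, evalAt_smul hδe, pow_mul, pow_card_eq_one_of_smul hv hc, one_pow, one_mul, map_mul,
        hev, mul_one]
    · rw [map_mul, he0 _ (fun c hc => h ⟨c, hc⟩), mul_zero]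
  rw [map_sum, Finset.sum_congr rfl fun g _ => h2 g, ← Finset.sum_filter, Finset.sum_const,
    nsmul_eq_mul, mul_eq_zero] at h1
  refine h1.elim (fun h => ?_) hδv
  apply natCast_card_subgroup_ne_zero hG (lineStabiliser ρ v)
  rw [← h, Nat.card_eq_fintype_card, Fintype.card_subtype]

/-- If the stabiliser of `v` is generated by reflections, the homogeneous localisation at the line of
`v` is regular. -/
theorem isRegularRing_of_reflectionSubgroup_eq [Finite G] [IsAlgClosed k] [FiniteDimensional k V]
    (hG : (Nat.card G : k) ≠ 0) {v : V} (hv : v ≠ 0) {H : Subgroup G}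
    (hH : ∀ g, g ∈ H ↔ ρ g v = v) (q : Ideal (invariantRing ρ)) [q.IsPrime]
    (hq : ∀ x ∈ q, evalAt v (x : PolyRing k V) = 0) (hW : reflectionSubgroup ρ H = H) :
    IsRegularRing (GradedLocalisation (invariantGrading ρ) q) := by
  classical
  have := Fintype.ofFinite G
  have : Nontrivial V := ⟨v, 0, hv⟩
  have := isNoetherianRing_invariantRing (ρ := ρ)
  have := isIntegral_invariantRing (ρ := ρ)
  obtain ⟨r, g, -, hg, hgadj⟩ := exists_generators_fixedSubalgebra_closure hG
    (T := H ∩ reflectionSet ρ) Set.inter_subset_right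
  rw [show Subgroup.closure (H ∩ reflectionSet ρ) = H from hW] at hgadj
  set B := fixedSubalgebra (polyActHom ρ) H
  have hregB : IsRegularRing B := by
    rw [← hgadj]
    exact IsRegularRing.of_ringEquiv hg.aevalEquiv.toRingEquiv
  obtain ⟨b, hbB, hbn, hb⟩ := exists_homogeneous_separating hG hv hH
  have hle : invariantRing ρ ≤ B := invariantRing_le H
  let _ : Algebra (invariantRing ρ) B := (Subalgebra.inclusion hle).toRingHom.toAlgebra
  have : IsScalarTower (invariantRing ρ) B (PolyRing k V) := .of_algebraMap_eq fun _ => rfl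
  have : Algebra.IsIntegral (invariantRing ρ) B := ⟨isIntegral_inclusion hle⟩
  obtain ⟨F, Λ, hF, hΛ, hQF⟩ := exists_lagrange (φ := polyActHom ρ) (K := H)
    (R := invariantRing ρ) (B := B)
    (fun x => by
      rw [← mem_invariantRing]
      exact ⟨by rintro ⟨y, rfl⟩; exact y.2, fun h => ⟨⟨x, h⟩, rfl⟩⟩)
    (fun x => ⟨by rintro ⟨y, rfl⟩; exact y.2, fun h => ⟨⟨x, h⟩, rfl⟩⟩)
    Subtype.val_injective Subtype.val_injective ⟨b, hbB⟩
  refine isRegularRing_localization _ fun P hP hdisj => ?_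
  obtain ⟨Q, hQ, hQP⟩ := Ideal.exists_ideal_over_prime_of_isIntegral_of_isDomain
    (S := PolyRing k V) P (by
      rw [(RingHom.injective_iff_ker_eq_bot _).mp
        (Subtype.val_injective : Function.Injective (algebraMap (invariantRing ρ) (PolyRing k V)))]
      exact bot_le)
  -- A conjugate of `Q`, which also lies over `P`, avoids all the differences `b - g b`.
  let s : Finset G := Finset.univ.filter (· ∉ H)
  have hδ : ∏ g ∈ s, (b - polyActHom ρ g b) ∈ polyGrading k V (∑ _g ∈ s, (1 + Nat.card G)) :=
    SetLike.prod_mem_graded (polyGrading k V) _ _ fun g _ =>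
      sub_mem hbn (polyActHom_mem_polyGrading g _ _ hbn)
  obtain ⟨g, hg⟩ := exists_map_notMem (ρ := ρ) hG hv Q (fun n x hx hxR hxQ => by
      by_contra hxv
      have h1 : (⟨x, hxR⟩ : invariantRing ρ) ∈ P := by rw [← hQP]; exact hxQ
      exact hdisj (show _ ∈ homogeneousPrimeCompl (invariantGrading ρ) q from
        ⟨⟨n, hx⟩, fun hxq => hxv (hq _ hxq)⟩) h1) hδ (by
      rw [map_prod, Finset.prod_ne_zero_iff]
      intro g hg
      rw [map_sub, sub_ne_zero]
      exact hb g (Finset.mem_filter.mp hg).2)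
  let Q' : Ideal (PolyRing k V) := Q.comap (polyActHom ρ g)
  have hQ' : Q'.IsPrime := Ideal.comap_isPrime _ _
  let QB : Ideal B := Q'.comap (algebraMap B (PolyRing k V))
  have hQB : QB.IsPrime := Ideal.comap_isPrime _ _
  have hQBP : QB.under (invariantRing ρ) = P := by
    rw [← hQP]
    ext x
    change polyActHom ρ g x ∈ Q ↔ (x : PolyRing k V) ∈ Q
    rw [mem_invariantRing.mp x.2]
  have hnot : Polynomial.aeval (⟨b, hbB⟩ : B) (Polynomial.derivative F) ∉ QB := by
    refine hQF Q' hQ' fun x hx hmem => hg ?_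
    change (∏ g ∈ s, (b - polyActHom ρ g b)) ∈ Q'
    exact Ideal.mem_of_dvd _ (Finset.dvd_prod_of_mem _
      (Finset.mem_filter.mpr ⟨Finset.mem_univ x, hx⟩)) hmem
  have := hregB.isRegularLocalRing_localization QB
  have := isRegularLocalRing_under hF hΛ QB hnot
  exact isRegularLocalRing_congr hQBP

end Backward

end GradedInvariants

namespace GradedInvariants

/-! ### Closed points of `Proj k[V]` -/

section ClosedPoints

variable {k V : Type*} [Field k] [AddCommGroup V] [Module k V]

open SymmetricAlgebra (ι)

/-- Restriction of polynomials to the line spanned by `v`. -/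
noncomputable def restrictToLine (v : V) : PolyRing k V →ₐ[k] Polynomial k :=
  SymmetricAlgebra.lift (LinearMap.mulRight k Polynomial.X ∘ₗ
    Algebra.linearMap k (Polynomial k) ∘ₗ Module.Dual.eval k V v)

theorem restrictToLine_of_mem (v : V) {n : ℕ} {f : PolyRing k V} (hf : f ∈ polyGrading k V n) :
    restrictToLine v f = evalAt v f • Polynomial.X ^ n :=
  lift_smul_of_mem_polyGrading _ v Polynomial.X
    (fun ξ => by simp [Algebra.smul_def]) hf

theorem coeff_restrictToLine (v : V) (f : PolyRing k V) (n : ℕ) :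
    (restrictToLine v f).coeff n = evalAt v (GradedAlgebra.proj (polyGrading k V) n f) := by
  obtain ⟨s, -, hs⟩ := exists_sum_proj_eq (polyGrading k V) f
  have h1 : ∀ i, (restrictToLine v (GradedAlgebra.proj (polyGrading k V) i f)).coeff n =
      if n = i then evalAt v (GradedAlgebra.proj (polyGrading k V) n f) else 0 := by
    intro i
    rw [restrictToLine_of_mem v (proj_mem i f), Polynomial.coeff_smul, Polynomial.coeff_X_pow]
    split_ifs with h
    · rw [h, smul_eq_mul, mul_one]
    · exact smul_zero _
  conv_lhs => rw [← hs, map_sum, Polynomial.finsetSum_coeff, Finset.sum_congr rfl fun i _ => h1 i,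
    Finset.sum_ite_eq]
  split_ifs with h
  · rfl
  · have h2 := congrArg (GradedAlgebra.proj (polyGrading k V) n) hs
    rw [map_sum, Finset.sum_eq_zero fun i hi => ?_] at h2
    · rw [← h2, map_zero]
    · rw [proj_of_mem (proj_mem i f), if_neg]
      rintro rfl
      exact h hi

/-- The point of `Proj k[V]` given by the line spanned by a nonzero vector. -/
noncomputable def pointOfLine {v : V} (hv : v ≠ 0) : ProjectiveSpectrum (polyGrading k V) where
  asHomogeneousIdeal :=
    { toSubmodule := RingHom.ker (restrictToLine (k := k) v)
      is_homogeneous' := by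
        intro n f hf
        rw [← GradedAlgebra.proj_apply]
        change restrictToLine v _ = 0
        have hf' : restrictToLine v f = 0 := hf
        rw [restrictToLine_of_mem v (proj_mem n f), ← coeff_restrictToLine, hf',
          Polynomial.coeff_zero, zero_smul] }
  isPrime := RingHom.ker_isPrime _
  not_irrelevant_le h := by
    obtain ⟨l, hl, -⟩ := exists_dual_apply_eq_one (k := k) v v hv
    have h1 : ι k _ l ∈ HomogeneousIdeal.irrelevant (polyGrading k V) := by
      rw [HomogeneousIdeal.mem_irrelevant_iff]
      exact (proj_of_mem (n := 0) (ι_mem_polyGrading l)).trans (if_neg one_ne_zero)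
    have h2 : restrictToLine v (ι k _ l) = 0 := h h1
    rw [restrictToLine_of_mem v (ι_mem_polyGrading l), evalAt_ι, hl, one_smul, pow_one] at h2
    exact Polynomial.X_ne_zero h2

theorem mem_pointOfLine {v : V} (hv : v ≠ 0) {f : PolyRing k V} :
    f ∈ (pointOfLine (k := k) hv).asHomogeneousIdeal.toIdeal ↔ restrictToLine v f = 0 := Iff.rfl

/-- The closed points of `Proj k[V]` over an algebraically closed field are the lines of `V`. -/
theorem exists_eq_pointOfLine [IsAlgClosed k] [FiniteDimensional k V]
    (p : ProjectiveSpectrum (polyGrading k V)) (hp : IsMax p) :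
    ∃ (v : V) (hv : v ≠ 0), p = pointOfLine hv := by
  have hprime := p.isPrime
  obtain ⟨l, hl⟩ : ∃ l : Module.Dual k V, ι k _ l ∉ p.asHomogeneousIdeal.toIdeal := by
    by_contra! hcon
    apply p.not_irrelevant_le
    intro f hf
    have hn : ∀ n, 0 < n → polyGrading k V n ≤
        p.asHomogeneousIdeal.toIdeal.restrictScalars k := by
      intro n hn f hf
      obtain ⟨n, rfl⟩ := Nat.exists_eq_succ_of_ne_zero hn.ne'
      rw [polyGrading, pow_succ] at hf
      refine Submodule.mul_induction_on hf ?_ fun x y hx hy => add_mem hx hy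
      rintro x - _ ⟨ξ, rfl⟩
      exact Ideal.mul_mem_left _ _ (hcon ξ)
    obtain ⟨s, -, hs⟩ := exists_sum_proj_eq (polyGrading k V) f
    change f ∈ p.asHomogeneousIdeal.toIdeal
    rw [← hs]
    refine Ideal.sum_mem _ fun i _ => ?_
    rcases Nat.eq_zero_or_pos i with rfl | hi
    · have h0 : GradedAlgebra.proj (polyGrading k V) 0 f = 0 :=
        (HomogeneousIdeal.mem_irrelevant_iff _ _).mp hf
      rw [h0]
      exact zero_mem _
    · exact hn i hi (proj_mem i f)
  obtain ⟨v, hv, hlv⟩ := exists_zero_not_zero _ hl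
  have hv0 : v ≠ 0 := by
    rintro rfl
    rw [evalAt_ι, map_zero] at hlv
    exact hlv rfl
  refine ⟨v, hv0, ?_⟩
  have hle : p ≤ pointOfLine hv0 := by
    intro f hf
    change restrictToLine v f = 0
    ext n
    rw [coeff_restrictToLine, Polynomial.coeff_zero]
    refine hv _ ?_
    rw [GradedAlgebra.proj_apply]
    exact p.asHomogeneousIdeal.is_homogeneous' n hf
  exact le_antisymm hle (hp hle)

theorem mem_zeroSet_pointOfLine {v : V} (hv : v ≠ 0) {w : V} :
    w ∈ zeroSet (pointOfLine (k := k) hv).asHomogeneousIdeal.toIdeal ↔ ∃ c : k, w = c • v := by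
  constructor
  · intro hw
    by_contra! hcon
    by_cases hw0 : w = 0
    · exact hcon 0 (by rw [hw0, zero_smul])
    obtain ⟨l, hl, hl'⟩ := exists_dual_apply_eq_one (k := k) w v hw0
    have h1 : l v = 0 := hl' fun c hc => by
      have hc0 : c ≠ 0 := by rintro rfl; exact hv (by rw [hc, zero_smul])
      exact hcon c⁻¹ (by rw [hc, smul_smul, inv_mul_cancel₀ hc0, one_smul])
    have h2 := hw (ι k _ l) (by
      rw [mem_pointOfLine, restrictToLine_of_mem v (ι_mem_polyGrading l), evalAt_ι, h1, zero_smul])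
    rw [evalAt_ι, hl] at h2
    exact one_ne_zero h2
  · rintro ⟨c, rfl⟩ f hf
    obtain ⟨s, -, hs⟩ := exists_sum_proj_eq (polyGrading k V) f
    rw [evalAt_eq_sum_proj _ f s hs]
    refine Finset.sum_eq_zero fun n _ => ?_
    rw [evalAt_smul (proj_mem n f), ← coeff_restrictToLine, (mem_pointOfLine hv).mp hf,
      Polynomial.coeff_zero, mul_zero]

end ClosedPoints

end GradedInvariants

theorem theorem3p3 {k : Type*} [Field k] [IsAlgClosed k]
    {G : Type*} [Group G] [Finite G] (hG : (Nat.card G : k) ≠ 0)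
    {V : Type*} [AddCommGroup V] [Module k V] [FiniteDimensional k V]
    (ρ : Representation k G V)
    (p : ProjectiveSpectrum (GradedInvariants.polyGrading k V)) (hp : IsMax p) :
    IsRegularRing (GradedInvariants.GradedLocalisation (GradedInvariants.invariantGrading ρ)
        (GradedInvariants.contraction ρ p.asHomogeneousIdeal.toIdeal)) ↔
      GradedInvariants.ActsAsReflectionGroup ρ
        (GradedInvariants.pointwiseStabiliser ρ p.asHomogeneousIdeal.toIdeal) := by
  obtain ⟨v, hv, rfl⟩ := GradedInvariants.exists_eq_pointOfLine p hp
  have hH : ∀ g, g ∈ GradedInvariants.pointwiseStabiliser ρ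
      (GradedInvariants.pointOfLine (k := k) hv).asHomogeneousIdeal.toIdeal ↔ ρ g v = v := by
    intro g
    constructor
    · exact fun h => h v ((GradedInvariants.mem_zeroSet_pointOfLine hv).mpr ⟨1, by rw [one_smul]⟩)
    · intro h w hw
      obtain ⟨c, rfl⟩ := (GradedInvariants.mem_zeroSet_pointOfLine hv).mp hw
      rw [map_smul, h]
  rw [GradedInvariants.actsAsReflectionGroup_iff]
  constructor
  · intro h
    refine GradedInvariants.reflectionSubgroup_eq_of_isRegularRing hG hv hH
      (GradedInvariants.contraction ρ
        (GradedInvariants.pointOfLine (k := k) hv).asHomogeneousIdeal.toIdeal) fun n x hx hxv => ?_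
    change GradedInvariants.restrictToLine v (x : GradedInvariants.PolyRing k V) = 0
    have hx' : (x : GradedInvariants.PolyRing k V) ∈ GradedInvariants.polyGrading k V n := hx
    rw [GradedInvariants.restrictToLine_of_mem v hx', hxv, zero_smul]
  · intro h
    refine GradedInvariants.isRegularRing_of_reflectionSubgroup_eq hG hv hH _ (fun x hx => ?_) h
    exact (GradedInvariants.mem_zeroSet_pointOfLine hv).mpr ⟨1, by rw [one_smul]⟩ _ hx
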